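/- For $\lambda=x+iy\in\mathbb{C}$ let $G_\lambda$ be the group of Möbius transformations of the sphere $\hat{\mathbb{C}}$ generated by (the transformations induced by) $S=\begin{pmatrix}1&0\\1&1\end{pmatrix}$ and $T=\begin{pmatrix}1&2\lambda\\0&1\end{pmatrix}$. A circle in $\hat{\mathbb{C}}$ is a Euclidean circle or a line together with $\infty$; where needed, one of its sides is chosen as its interior, the other being its exterior. A group of Möbius transformations is *classical T-Schottky* if it has generators $g_1,\dots,g_n$ for which there are circles $C_i,C_i'$ $(1\le i\le n)$ whose $2n$ interiors are pairwise disjoint, such that $g_i$ maps the exterior of $C_i$ onto the interior of $C_i'$ for each $i$. For $p\ne q$ in $\hat{\mathbb{C}}$ let $H_{[p,q]}$ be the half-turn about the hyperbolic line with ends $p,q$, that is, the Möbius transformation of order two fixing $p$ and $q$. The axis of a Möbius transformation is the hyperbolic line joining its two fixed points, or the improper line $[u,u]$ if it is parabolic with fixed point $u$; a line is perpendicular to $[u,u]$ if $u$ is one of its ends. A non-elementary group of Möbius transformations is *nsdc* (a non-separating disjoint circle group) if it has a pair of generators $A,B$ whose axes have a common perpendicular $[n,n']$, $n\neq n'$,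 and for which $A=H_{[a,a']}H_{[n,n']}$, $B=H_{[b,b']}H_{[n,n']}$ with $a\ne a'$, $b\ne b'$, such that there are three circles, through $a,a'$, through $n,n'$ and through $b,b'$ respectively, that are pairwise disjoint or tangent and none of which separates the other two. Put $\mathcal{NSDC}=\{\lambda\in\mathbb{C}\setminus\{0\}: G_\lambda\text{ is nsdc}\}$ and $c\mathcal{S}=\{\lambda\in\mathbb{C}\setminus\{0\}: G_\lambda\text{ is classical T-Schottky}\}$, and let $\partial$ denote the topological boundary in $\mathbb{C}$. Then: 1. For $\lambda=|\lambda|e^{i\omega}\neq 0$: $\lambda\in\mathcal{NSDC}$ if and only if $|\lambda|(1+|\cos\omega|)\ge 4$, and $\lambda\in\partial\,\mathcal{NSDC}$ if and only if $|\lambda|(1+|\cos\omega|)=4$. In Cartesian coordinates, $\partial\,\mathcal{NSDC}=\{x+iy: y^2=16-8|x|\}$. 2. $\partial\, c\mathcal{S}=\{x+iy: |y|=1-x^2/4\}=\left\{\dfrac{2e^{i\omega}}{1+|\sin\omega|}:\omega\in\mathbb{R}\right\}$. -/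

import Mathlib

open Complex

noncomputable section

namespace TwoParabolic

/-- The complex sphere. -/
abbrev Sphere : Type := OnePoint ℂ

/-- The group of Möbius transformations of the complex sphere: the permutations
`z ↦ (a z + b) / (c z + d)` with `a d - b c ≠ 0`. -/
def mobius : Subgroup (Equiv.Perm Sphere) :=
  (MulAction.toPermHom (GL (Fin 2) ℂ) Sphere).range

/-- The Möbius transformation induced by an invertible matrix. -/
def ofMatrix (M : GL (Fin 2) ℂ) : Equiv.Perm Sphere :=
  MulAction.toPermHom (GL (Fin 2) ℂ) Sphere M

/-- A circle in the complex sphere (a Euclidean circle, or a Euclidean line together with `∞`) with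
a choice of one of its two sides as its interior. It is the zero set of
`a |z|² + 2 Re (conj b * z) + c`, where `|b|² - a c > 0`; the interior is where this is negative. -/
structure Circle where
  /-- The coefficient of `|z|²`. -/
  a : ℝ
  /-- The coefficient of the linear term. -/
  b : ℂ
  /-- The constant term. -/
  c : ℝ
  nondegenerate : a * c < normSq b

namespace Circle

/-- The defining function of a circle. The sign of its value at `∞` is that of `a`, or zero if
`a = 0`, in which case the circle is a line and passes through `∞`. -/
def form (C : Circle) : Sphere → ℝ
  | none => C.a
  | some z => C.a * normSq z + 2 * ((starRingEnd ℂ) C.b * z).re + C.c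

/-- The points on the circle. -/
def carrier (C : Circle) : Set Sphere := {p | C.form p = 0}

/-- The chosen side of the circle. -/
def interior (C : Circle) : Set Sphere := {p | C.form p < 0}

/-- The other side of the circle. -/
def exterior (C : Circle) : Set Sphere := {p | 0 < C.form p}

/-- Two circles are disjoint or tangent: they have at most one common point. -/
def DisjointOrTangent (C D : Circle) : Prop := (C.carrier ∩ D.carrier).Subsingleton

/-- The circle `C` separates `D` from `E`: there are points of `D` and of `E` that
lie on different sides of `C`. -/
def Separates (C D E : Circle) : Prop :=
  ((D.carrier ∩ C.interior).Nonempty ∧ (E.carrier ∩ C.exterior).Nonempty) ∨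
    ((D.carrier ∩ C.exterior).Nonempty ∧ (E.carrier ∩ C.interior).Nonempty)

end Circle

/-- The group generated by `g 0, …, g (n - 1)` is a marked classical T-Schottky group on these
generators: there are circles `C i`, `C' i` whose `2 n` interiors are pairwise
disjoint, such that the Möbius transformation `g i` maps the exterior of `C i` onto the interior of
`C' i`. -/
def IsMarkedClassicalTSchottky {n : ℕ} (g : Fin n → Equiv.Perm Sphere) : Prop :=
  (∀ i, g i ∈ mobius) ∧
    ∃ C C' : Fin n → Circle,
      Pairwise (fun s t : Fin n ⊕ Fin n =>
        Disjoint (Sum.elim C C' s).interior (Sum.elim C C' t).interior) ∧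
      ∀ i, g i '' (C i).exterior = (C' i).interior

/-- A classical T-Schottky group: marked classical T-Schottky on some set of generators. -/
def IsClassicalTSchottky (G : Subgroup (Equiv.Perm Sphere)) : Prop :=
  ∃ (n : ℕ) (g : Fin n → Equiv.Perm Sphere),
    Subgroup.closure (Set.range g) = G ∧ IsMarkedClassicalTSchottky g

/-- `h` is the half-turn about the hyperbolic line with distinct ends `x` and `y`, acting on the
sphere at infinity: the Möbius transformation of order two that fixes `x` and `y`. -/
def IsHalfTurn (h : Equiv.Perm Sphere) (x y : Sphere) : Prop :=
  x ≠ y ∧ h ∈ mobius ∧ h x = x ∧ h y = y ∧ h ≠ 1 ∧ h * h = 1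

/-- The proper hyperbolic line `[n, n']` is perpendicular to the axis of the Möbius transformation
`A`. If `A` is parabolic with fixed point `u`, its axis is the improper line `[u, u]`, and this means
that `u` is an end of `[n, n']`. Otherwise the axis is the line that joins the two fixed points of
`A`, and this means that the half-turn about `[n, n']` interchanges them. -/
def IsPerpendicularToAxis (n n' : Sphere) (A : Equiv.Perm Sphere) : Prop :=
  (∃ u, Function.fixedPoints A = {u} ∧ (u = n ∨ u = n')) ∨
    (∃ p q, p ≠ q ∧ Function.fixedPoints A = {p, q} ∧
      ∃ h, IsHalfTurn h n n' ∧ h p = q ∧ h q = p)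

/-- `(a, a', n, n', b, b')` is the ortho-end of the pair `A`, `B`: the line `[n, n']` is the common
perpendicular of the axes of `A` and `B`, and `A = H_[a, a'] H_[n, n']`,
`B = H_[b, b'] H_[n, n']`, where `H` denotes half-turns. -/
def IsOrthoEnd (A B : Equiv.Perm Sphere) (a a' n n' b b' : Sphere) : Prop :=
  IsPerpendicularToAxis n n' A ∧ IsPerpendicularToAxis n n' B ∧
    ∃ hA hN hB, IsHalfTurn hA a a' ∧ IsHalfTurn hN n n' ∧ IsHalfTurn hB b b' ∧
      A = hA * hN ∧ B = hB * hN

/-- The non-separating disjoint circle property of six points. -/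
def HasNSDCProperty (a a' n n' b b' : Sphere) : Prop :=
  a ≠ a' ∧ n ≠ n' ∧ b ≠ b' ∧
    ∃ CA CN CB : Circle,
      a ∈ CA.carrier ∧ a' ∈ CA.carrier ∧
      n ∈ CN.carrier ∧ n' ∈ CN.carrier ∧
      b ∈ CB.carrier ∧ b' ∈ CB.carrier ∧
      CA.DisjointOrTangent CN ∧ CN.DisjointOrTangent CB ∧ CA.DisjointOrTangent CB ∧
      ¬ CA.Separates CN CB ∧ ¬ CN.Separates CA CB ∧ ¬ CB.Separates CA CN

/-- The (non-elementary) group generated by `A` and `B` is a marked nsdc group. -/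
def IsMarkedNSDC (A B : Equiv.Perm Sphere) : Prop :=
  A ∈ mobius ∧ B ∈ mobius ∧
    ∃ a a' n n' b b', IsOrthoEnd A B a a' n n' b b' ∧ HasNSDCProperty a a' n n' b b'

/-- The (non-elementary) group `G` is an nsdc group: some pair of generators is marked nsdc. -/
def IsNSDC (G : Subgroup (Equiv.Perm Sphere)) : Prop :=
  ∃ A B, Subgroup.closure {A, B} = G ∧ IsMarkedNSDC A B

/-- The parabolic transformation `S`. -/
def S : Equiv.Perm Sphere :=
  ofMatrix (Matrix.GeneralLinearGroup.mkOfDetNeZero !![1, 0; 1, 1] (by simp))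

/-- The parabolic transformation `T = T_lam`. -/
def T (lam : ℂ) : Equiv.Perm Sphere :=
  ofMatrix (Matrix.GeneralLinearGroup.mkOfDetNeZero !![1, 2 * lam; 0, 1] (by simp))

/-- The group `G_lam` generated by `S` and `T`. -/
def G (lam : ℂ) : Subgroup (Equiv.Perm Sphere) := Subgroup.closure {S, T lam}

/-- Nsdc-space. The standing assumption `lam ≠ 0` says that `G lam` is non-elementary. -/
def nsdcSpace : Set ℂ := {lam | lam ≠ 0 ∧ IsNSDC (G lam)}

/-- Two-parabolic classical T-Schottky space. The standing assumption `lam ≠ 0` says that `G lam` is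
non-elementary. -/
def classicalTSchottkySpace : Set ℂ := {lam | lam ≠ 0 ∧ IsClassicalTSchottky (G lam)}

end TwoParabolic

end

/-! ### Circles as Hermitian forms, and their images under Möbius transformations -/

noncomputable section

namespace TwoParabolic

open OnePoint Filter Topology ComplexConjugate

/-! Both spaces are superlevel sets: nsdc-space is `4 ≤ ‖λ‖ + |Re λ|` and classical T-Schottky space
is `2 ≤ ‖λ‖ + |Im λ|`. Both functions are continuous and homogeneous of degree one, so the
boundaries are the level sets, which are unions of arcs of parabolas with focus `0`.

If the inequality holds, explicit circles adapted to a square root of the direction of `λ` (rotated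
by a right angle in the Schottky case) do the job: `isClassicalTSchottky_of_le`, `isNSDC_of_le`.

The converse is hard because the generators that carry the circles are not given. A group with
paired circles is free by ping-pong on its generators, and here their number must be two
(`IsClassicalTSchottky.exists_isSchottky`). Write `S` and `T` as words in them. The fixed point of a
parabolic element given by a cyclically reduced word must be a point of tangency of two of the four
circles (`IsSchottky.form_eq_zero`). Following this point around the word shows that two consecutive
letters determine the next one, through permutations `σ v` of the four letters with `σ v v = v⁻¹`
and `σ v⁻¹ = (σ v)⁻¹` (`IsSchottky.exists_perms`). So the word is read off from a cycle of a
permutation of twelve states. There are 36 choices of `σ`. A finite check, which uses that a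
generating pair has determinant `±1` in `ℤ²` and no trivial member in a quotient isomorphic to the
symmetric group of degree three, shows that the words of `S` and `T` have total length at most three
(`add_le_three`). A second ping-pong, of a free group acting on itself, turns the separate
conjugations into a simultaneous one (`exists_simultaneous_conj`). Thus, up to conjugation and
order, `S` and `T` are `u` and `u ^ e * v` with `e ∈ {0, 1, -1}` and `u`, `v` letters of different
index (`IsSchottky.exists_normal_form`).

What remains is Euclidean geometry. Normalized so that `u` is the translation, the circles of `u`
are parallel lines and those of the other letter are discs between them. Comparing radii with
distances gives the Schottky bound when `e = 0` (`Circle.two_le_of_paired`) and also when the second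
generator is a product (`Circle.two_le_of_slid`).

For nsdc groups the three circles can be oriented to have disjoint interiors, and each half-turn
interchanges the sides of its circle. Such a triple yields a Schottky group of rank two, so the
normal form applies again. A product of generators either is a product of two of the half-turns up
to conjugation and inversion, which only permutes the roles of the circles, or cannot be parabolic.
The half-turns are then forced to be those about `[0, 2]`, `[0, ∞]` and `[∞, λ]`, and the disc must
fit into a strip (`IsTurnTriple.four_le_of_eq`). -/

theorem ofMatrix_mem_mobius (M : GL (Fin 2) ℂ) : ofMatrix M ∈ mobius := ⟨M, rfl⟩

theorem exists_eq_ofMatrix {k : Equiv.Perm Sphere} (hk : k ∈ mobius) :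
    ∃ M : GL (Fin 2) ℂ, k = ofMatrix M := by
  obtain ⟨M, rfl⟩ := hk
  exact ⟨M, rfl⟩

theorem ofMatrix_apply (M : GL (Fin 2) ℂ) (p : Sphere) : ofMatrix M p = M • p := rfl

theorem ofMatrix_coe (M : GL (Fin 2) ℂ) (z : ℂ) :
    ofMatrix M (z : Sphere) = if M 1 0 * z + M 1 1 = 0 then (∞ : Sphere)
      else (((M 0 0 * z + M 0 1) / (M 1 0 * z + M 1 1) : ℂ) : Sphere) := by
  rw [ofMatrix_apply, smul_some_eq_ite]

theorem ofMatrix_infty (M : GL (Fin 2) ℂ) :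
    ofMatrix M ∞ = if M 1 0 = 0 then (∞ : Sphere) else ((M 0 0 / M 1 0 : ℂ) : Sphere) := by
  rw [ofMatrix_apply, smul_infty_eq_ite]

namespace Circle

@[simp] theorem form_coe (C : Circle) (z : ℂ) :
    C.form (z : Sphere) = C.a * normSq z + 2 * (conj C.b * z).re + C.c := rfl

@[simp] theorem form_infty (C : Circle) : C.form ∞ = C.a := rfl

/-- The homogeneous Hermitian form of a circle. -/
def hform (C : Circle) (z w : ℂ) : ℝ :=
  C.a * normSq z + 2 * (conj C.b * z * conj w).re + C.c * normSq w

/-- The preimage of a circle under a Möbius transformation. -/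
def pull (M : GL (Fin 2) ℂ) (C : Circle) : Circle where
  a := C.hform (M 0 0) (M 1 0)
  b := conj (C.a * (M 0 0 * conj (M 0 1)) + conj C.b * (M 0 0 * conj (M 1 1))
    + C.b * (M 1 0 * conj (M 0 1)) + C.c * (M 1 0 * conj (M 1 1)))
  c := C.hform (M 0 1) (M 1 1)
  nondegenerate := by
    -- The discriminant `|b|² - a c` is multiplied by `|det M|²`.
    have hd : 0 < normSq (M 0 0 * M 1 1 - M 0 1 * M 1 0) := by
      rw [normSq_pos, ← Matrix.det_fin_two]
      exact M.det_ne_zero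
    have hC : 0 < normSq C.b - C.a * C.c := sub_pos.2 C.nondegenerate
    have := mul_pos hd hC
    rw [← sub_pos]
    refine this.trans_eq ?_
    simp only [hform, normSq_apply, conj_re, conj_im, mul_re, mul_im, add_re, add_im, ofReal_re,
      ofReal_im, sub_re, sub_im]
    ring

theorem hform_mul (C : Circle) (M : GL (Fin 2) ℂ) (z w : ℂ) :
    C.hform (M 0 0 * z + M 0 1 * w) (M 1 0 * z + M 1 1 * w) = (C.pull M).hform z w := by
  simp only [hform, pull, normSq_apply, conj_re, conj_im, mul_re, mul_im, add_re, add_im,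
    ofReal_re, ofReal_im]
  ring

theorem form_div (C : Circle) {z w : ℂ} (hw : w ≠ 0) :
    C.form ((z / w : ℂ) : Sphere) = (normSq w)⁻¹ * C.hform z w := by
  have h : normSq w ≠ 0 := (normSq_pos.2 hw).ne'
  have h2 : z / w = ((normSq w)⁻¹ : ℝ) * (z * conj w) := by
    rw [div_eq_mul_inv, inv_def]; ring
  rw [form_coe, normSq_div, h2]
  have : (conj C.b * (((normSq w)⁻¹ : ℝ) * (z * conj w))).re
      = (normSq w)⁻¹ * (conj C.b * z * conj w).re := by
    rw [← re_ofReal_mul]; congr 1; ring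
  rw [this, hform]
  field_simp

/-- On the projective line the Hermitian form is defined up to the positive factor `|w|²`, so its
sign, and hence the side of the circle, is transported. The cases are whether the point or its image
is `∞`. -/
theorem exists_form_ofMatrix (C : Circle) (M : GL (Fin 2) ℂ) (p : Sphere) :
    ∃ κ : ℝ, 0 < κ ∧ C.form (ofMatrix M p) = κ * (C.pull M).form p := by
  induction p using OnePoint.rec with
  | infty =>
    rw [ofMatrix_infty]
    split_ifs with h
    · have h0 : M 0 0 ≠ 0 := by
        intro h0
        apply M.det_ne_zero
        rw [Matrix.det_fin_two, h, h0]; simp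
      refine ⟨(normSq (M 0 0))⁻¹, inv_pos.2 (normSq_pos.2 h0), ?_⟩
      have h1 : normSq (M 0 0) ≠ 0 := (normSq_pos.2 h0).ne'
      simp only [form_infty, pull, hform, h]
      simp
      field_simp
    · refine ⟨(normSq (M 1 0))⁻¹, inv_pos.2 (normSq_pos.2 h), ?_⟩
      rw [form_div _ h]
      rfl
  | coe z =>
    rw [ofMatrix_coe]
    have key := C.hform_mul M z 1
    have hz : (C.pull M).hform z 1 = (C.pull M).form z := by simp [hform]
    simp only [mul_one] at key
    rw [← hz, ← key]
    split_ifs with h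
    · have h0 : M 0 0 * z + M 0 1 ≠ 0 := by
        intro h0
        apply M.det_ne_zero
        rw [Matrix.det_fin_two]
        by_cases h3 : M 1 0 = 0
        · rw [h3, zero_mul, zero_add] at h
          rw [h, h3]; ring
        · have : M 1 0 * (M 0 0 * M 1 1 - M 0 1 * M 1 0) = 0 := by
            linear_combination M 1 0 * M 0 0 * h - M 1 0 * M 1 0 * h0
          exact (mul_eq_zero.1 this).resolve_left h3
      refine ⟨(normSq (M 0 0 * z + M 0 1))⁻¹, inv_pos.2 (normSq_pos.2 h0), ?_⟩
      have h1 : normSq (M 0 0 * z + M 0 1) ≠ 0 := (normSq_pos.2 h0).ne'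
      rw [h]
      simp only [hform, form_infty]
      simp
      field_simp
    · exact ⟨(normSq (M 1 0 * z + M 1 1))⁻¹, inv_pos.2 (normSq_pos.2 h), form_div _ h⟩

/-- `D` is the image of `C`, with its sides, under `k`. -/
def IsImage (k : Equiv.Perm Sphere) (C D : Circle) : Prop :=
  ∀ p, SignType.sign (D.form (k p)) = SignType.sign (C.form p)

theorem isImage_pull (M : GL (Fin 2) ℂ) (C : Circle) : IsImage (ofMatrix M) (C.pull M) C := by
  intro p
  obtain ⟨κ, hκ, h⟩ := C.exists_form_ofMatrix M p
  rw [h, sign_mul, sign_pos hκ, one_mul]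

theorem exists_isImage {k : Equiv.Perm Sphere} (hk : k ∈ mobius) (C : Circle) :
    ∃ D, IsImage k C D := by
  obtain ⟨M, hM⟩ := exists_eq_ofMatrix (mobius.inv_mem hk)
  refine ⟨C.pull M, fun p => ?_⟩
  have := isImage_pull M C (k p)
  rw [← hM] at this
  simpa using this.symm

namespace IsImage

variable {k : Equiv.Perm Sphere} {C D : Circle}

theorem neg_iff (h : IsImage k C D) (p : Sphere) : D.form (k p) < 0 ↔ C.form p < 0 := by
  rw [← sign_eq_neg_one_iff, h p, sign_eq_neg_one_iff]

theorem pos_iff (h : IsImage k C D) (p : Sphere) : 0 < D.form (k p) ↔ 0 < C.form p := by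
  rw [← sign_eq_one_iff, h p, sign_eq_one_iff]

theorem zero_iff (h : IsImage k C D) (p : Sphere) : D.form (k p) = 0 ↔ C.form p = 0 := by
  rw [← sign_eq_zero_iff, h p, sign_eq_zero_iff]

theorem nonpos_iff (h : IsImage k C D) (p : Sphere) : D.form (k p) ≤ 0 ↔ C.form p ≤ 0 := by
  rw [← not_lt, h.pos_iff, not_lt]

theorem interior_eq (h : IsImage k C D) : D.interior = k '' C.interior := by
  ext p
  obtain ⟨q, rfl⟩ := k.surjective p
  simp [interior, h.neg_iff]

end IsImage

/-- The same circle with its sides interchanged. -/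
def flip (C : Circle) : Circle where
  a := -C.a
  b := -C.b
  c := -C.c
  nondegenerate := by simpa using C.nondegenerate

@[simp] theorem flip_form (C : Circle) (p : Sphere) : C.flip.form p = -C.form p := by
  induction p using OnePoint.rec with
  | infty => rfl
  | coe z => simp [flip]; ring

theorem flip_interior (C : Circle) : C.flip.interior = C.exterior := by
  ext p; simp [interior, exterior]

theorem flip_carrier (C : Circle) : C.flip.carrier = C.carrier := by
  ext p; simp [carrier]

theorem interior_nonempty (C : Circle) : C.interior.Nonempty := by
  have hC := C.nondegenerate
  rcases lt_trichotomy C.a 0 with h | h | h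
  · exact ⟨∞, h⟩
  · have hb : 0 < normSq C.b := by rw [h] at hC; simpa using hC
    refine ⟨((((-(|C.c| + 1) / normSq C.b : ℝ) : ℂ) * C.b : ℂ) : Sphere), ?_⟩
    have : (conj C.b * (((-(|C.c| + 1) / normSq C.b : ℝ) : ℂ) * C.b)).re = -(|C.c| + 1) := by
      rw [mul_left_comm, ← normSq_eq_conj_mul_self, ← ofReal_mul, ofReal_re]
      field_simp
    simp only [interior, Set.mem_ofPred_eq, form_coe, this, h]
    have := le_abs_self C.c
    have := abs_nonneg C.c
    linarith
  · refine ⟨((((-1 / C.a : ℝ) : ℂ) * C.b : ℂ) : Sphere), ?_⟩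
    have : (conj C.b * (((-1 / C.a : ℝ) : ℂ) * C.b)).re = -normSq C.b / C.a := by
      rw [mul_left_comm, ← normSq_eq_conj_mul_self, ← ofReal_mul, ofReal_re]
      field_simp
    simp only [interior, Set.mem_ofPred_eq, form_coe, this, normSq_mul, normSq_ofReal]
    have e : C.a * (-1 / C.a * (-1 / C.a) * normSq C.b) + 2 * (-normSq C.b / C.a) + C.c
      = (C.a * C.c - normSq C.b) / C.a := by field_simp; ring
    rw [e]
    exact div_neg_of_neg_of_pos (by linarith) h

theorem normSq_gradient (C : Circle) {z : ℂ} (h : C.form z = 0) :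
    normSq (C.a * z + C.b) = normSq C.b - C.a * C.c := by
  rw [form_coe] at h
  simp only [normSq_apply, conj_re, conj_im, mul_re, mul_im, add_re, add_im,
    ofReal_re, ofReal_im] at *
  linear_combination C.a * h

/-- The interior of a circle accumulates at each point of the circle: an inequality that holds
strictly at such a point for another circle holds somewhere in the interior. -/
theorem exists_mem_interior_of_form_neg (C D : Circle) {p : Sphere} (hC : C.form p ≤ 0)
    (hD : D.form p < 0) : ∃ q, C.form q < 0 ∧ D.form q < 0 := by
  rcases hC.lt_or_eq with hC | hC
  · exact ⟨p, hC, hD⟩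
  induction p using OnePoint.rec with
  | infty =>
    rw [form_infty] at hC hD
    have hb : 0 < normSq C.b := by
      have := C.nondegenerate; rw [hC] at this; simpa using this
    -- The circle is a line through `∞`, approached from inside along `-b / ε`: there the form is
    -- `-2 |b|² / ε + c`, while `D` is dominated by its quadratic term.
    have l1 : ∀ᶠ ε : ℝ in 𝓝[>] 0, -2 * normSq C.b + ε * C.c < 0 := by
      have : Continuous fun ε : ℝ => -2 * normSq C.b + ε * C.c := by fun_prop
      have := (this.tendsto 0).eventually_lt_const (show -2 * normSq C.b + 0 * C.c < 0 by linarith)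
      exact this.filter_mono nhdsWithin_le_nhds
    have l2 : ∀ᶠ ε : ℝ in 𝓝[>] 0,
        D.a * normSq C.b - 2 * ε * (conj D.b * C.b).re + ε ^ 2 * D.c < 0 := by
      have : Continuous fun ε : ℝ =>
        D.a * normSq C.b - 2 * ε * (conj D.b * C.b).re + ε ^ 2 * D.c := by fun_prop
      have := (this.tendsto 0).eventually_lt_const
        (show D.a * normSq C.b - 2 * 0 * (conj D.b * C.b).re + 0 ^ 2 * D.c < 0 by
          have := mul_neg_of_neg_of_pos hD hb
          linarith)
      exact this.filter_mono nhdsWithin_le_nhds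
    obtain ⟨ε, h1, h2, h0⟩ := (l1.and (l2.and self_mem_nhdsWithin)).exists
    have h0 : 0 < ε := h0
    refine ⟨((((-ε⁻¹ : ℝ) : ℂ) * C.b : ℂ) : Sphere), ?_, ?_⟩
    · have e : C.form ((((-ε⁻¹ : ℝ) : ℂ) * C.b : ℂ) : Sphere)
          = ε⁻¹ * (-2 * normSq C.b + ε * C.c) := by
        rw [form_coe, mul_left_comm, ← normSq_eq_conj_mul_self, ← ofReal_mul, ofReal_re, hC]
        field_simp; ring
      rw [e]
      exact mul_neg_of_pos_of_neg (inv_pos.2 h0) h1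
    · have e : D.form ((((-ε⁻¹ : ℝ) : ℂ) * C.b : ℂ) : Sphere)
          = (ε⁻¹) ^ 2 * (D.a * normSq C.b - 2 * ε * (conj D.b * C.b).re + ε ^ 2 * D.c) := by
        rw [form_coe, mul_left_comm, re_ofReal_mul, normSq_mul, normSq_ofReal]
        field_simp; ring
      rw [e]
      exact mul_neg_of_pos_of_neg (by positivity) h2
  | coe z =>
    have hg : 0 < normSq (C.a * z + C.b) := by
      rw [C.normSq_gradient hC]; linarith [C.nondegenerate]
    -- Half the gradient of the form. It does not vanish on the circle, so a small step against it
    -- enters the interior.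
    set g := C.a * z + C.b with hgdef
    have l1 : ∀ᶠ ε : ℝ in 𝓝[>] 0, C.a * ε - 2 < 0 := by
      have : Continuous fun ε : ℝ => C.a * ε - 2 := by fun_prop
      have := (this.tendsto 0).eventually_lt_const (show C.a * 0 - 2 < 0 by linarith)
      exact this.filter_mono nhdsWithin_le_nhds
    have l2 : ∀ᶠ ε : ℝ in 𝓝[>] 0, D.form ((z - ε * g : ℂ) : Sphere) < 0 := by
      have : Continuous fun ε : ℝ => D.form ((z - ε * g : ℂ) : Sphere) := by
        simp only [form_coe]
        have := continuous_normSq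
        fun_prop
      have := (this.tendsto 0).eventually_lt_const (show _ < (0 : ℝ) by simpa using hD)
      exact this.filter_mono nhdsWithin_le_nhds
    obtain ⟨ε, h1, h2, h0⟩ := (l1.and (l2.and self_mem_nhdsWithin)).exists
    have h0 : 0 < ε := h0
    refine ⟨_, ?_, h2⟩
    have e : C.form ((z - ε * g : ℂ) : Sphere) = C.form z + ε * normSq g * (C.a * ε - 2) := by
      rw [hgdef]
      simp only [form_coe, normSq_apply, conj_re, conj_im, mul_re, mul_im, add_re, add_im,
        ofReal_re, ofReal_im, sub_re, sub_im]
      ring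
    rw [e, hC, zero_add]
    exact mul_neg_of_pos_of_neg (mul_pos h0 hg) h1

/-- Disjointness of open discs passes to a closed disc and an open one, since the closed disc is in
the closure of its interior. All later statements on tangency rest on this. -/
theorem form_nonneg_of_disjoint {C D : Circle} (h : Disjoint C.interior D.interior) {p : Sphere}
    (hp : C.form p ≤ 0) : 0 ≤ D.form p := by
  by_contra! hD
  obtain ⟨q, h1, h2⟩ := exists_mem_interior_of_form_neg C D hp hD
  exact Set.disjoint_left.1 h h1 h2

theorem form_eq_zero_of_disjoint {C D : Circle} (h : Disjoint C.interior D.interior) {p : Sphere}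
    (hC : C.form p ≤ 0) (hD : D.form p ≤ 0) : C.form p = 0 ∧ D.form p = 0 :=
  ⟨le_antisymm hC (form_nonneg_of_disjoint h.symm hD), le_antisymm hD (form_nonneg_of_disjoint h hC)⟩

end Circle

end TwoParabolic

end

/-! ### Parabolic transformations, and tangent circles with disjoint interiors -/

noncomputable section

namespace TwoParabolic

open OnePoint Filter Topology ComplexConjugate

theorem ofMatrix_mul (M N : GL (Fin 2) ℂ) : ofMatrix (M * N) = ofMatrix M * ofMatrix N :=
  map_mul (MulAction.toPermHom (GL (Fin 2) ℂ) Sphere) M N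

theorem T_mem_mobius (lam : ℂ) : T lam ∈ mobius := ofMatrix_mem_mobius _

theorem S_mem_mobius : S ∈ mobius := ofMatrix_mem_mobius _

@[simp] theorem T_coe (lam z : ℂ) : T lam (z : Sphere) = ((z + 2 * lam : ℂ) : Sphere) := by
  rw [T, ofMatrix_coe]
  simp [Matrix.GeneralLinearGroup.mkOfDetNeZero]

@[simp] theorem T_infty (lam : ℂ) : T lam ∞ = ∞ := by
  rw [T, ofMatrix_infty]
  simp [Matrix.GeneralLinearGroup.mkOfDetNeZero]

theorem S_coe (z : ℂ) :
    S (z : Sphere) = if z + 1 = 0 then (∞ : Sphere) else ((z / (z + 1) : ℂ) : Sphere) := by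
  rw [S, ofMatrix_coe]
  simp [Matrix.GeneralLinearGroup.mkOfDetNeZero]

theorem S_infty : S ∞ = ((1 : ℂ) : Sphere) := by
  rw [S, ofMatrix_infty]
  simp [Matrix.GeneralLinearGroup.mkOfDetNeZero]

theorem T_inv (lam : ℂ) : (T lam)⁻¹ = T (-lam) := by
  rw [inv_eq_iff_mul_eq_one]
  ext p
  induction p using OnePoint.rec with
  | infty => simp
  | coe z => simp

/-- The transformation `z ↦ c / z`. -/
def invol (c : ℂ) (hc : c ≠ 0) : Equiv.Perm Sphere :=
  ofMatrix (Matrix.GeneralLinearGroup.mkOfDetNeZero !![0, c; 1, 0] (by simpa using hc))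

theorem invol_mem_mobius (c : ℂ) (hc : c ≠ 0) : invol c hc ∈ mobius := ofMatrix_mem_mobius _

theorem invol_zero (c : ℂ) (hc : c ≠ 0) : invol c hc ((0 : ℂ) : Sphere) = ∞ := by
  rw [invol, ofMatrix_coe]
  simp [Matrix.GeneralLinearGroup.mkOfDetNeZero]

theorem invol_mul_S (c : ℂ) (hc : c ≠ 0) : invol c hc * S = T (c / 2) * invol c hc := by
  rw [invol, S, T, ← ofMatrix_mul, ← ofMatrix_mul]
  congr 1
  ext i j
  fin_cases i <;> fin_cases j <;>
    simp [Matrix.GeneralLinearGroup.mkOfDetNeZero, Matrix.mul_apply, mul_div_cancel₀]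

theorem invol_mul_T (lam : ℂ) (hl : 2 * lam ≠ 0) :
    invol (2 * lam) hl * T lam = S * invol (2 * lam) hl := by
  rw [invol, S, T, ← ofMatrix_mul, ← ofMatrix_mul]
  congr 1
  ext i j
  fin_cases i <;> fin_cases j <;>
    simp [Matrix.GeneralLinearGroup.mkOfDetNeZero, Matrix.mul_apply]

theorem exists_mobius_apply_eq_infty (p : Sphere) : ∃ k ∈ mobius, k p = ∞ := by
  induction p using OnePoint.rec with
  | infty => exact ⟨1, mobius.one_mem, rfl⟩
  | coe z =>
    refine ⟨ofMatrix (Matrix.GeneralLinearGroup.mkOfDetNeZero !![0, 1; 1, -z] (by simp)),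
      ofMatrix_mem_mobius _, ?_⟩
    rw [ofMatrix_coe]
    simp [Matrix.GeneralLinearGroup.mkOfDetNeZero]

/-- `f` is parabolic with fixed point `p`: it is conjugate to a translation. -/
def IsParabolicAt (f : Equiv.Perm Sphere) (p : Sphere) : Prop :=
  ∃ k ∈ mobius, ∃ t : ℂ, t ≠ 0 ∧ k p = ∞ ∧ k * f = T t * k

theorem isParabolicAt_T {lam : ℂ} (hl : lam ≠ 0) : IsParabolicAt (T lam) ∞ :=
  ⟨1, mobius.one_mem, lam, hl, rfl, by simp⟩

theorem isParabolicAt_S : IsParabolicAt S ((0 : ℂ) : Sphere) :=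
  ⟨invol 1 one_ne_zero, invol_mem_mobius _ _, 1 / 2, by norm_num, invol_zero _ _,
    invol_mul_S _ _⟩

namespace IsParabolicAt

variable {f : Equiv.Perm Sphere} {p : Sphere}

theorem conjugate (h : IsParabolicAt f p) {g : Equiv.Perm Sphere} (hg : g ∈ mobius) :
    IsParabolicAt (g * f * g⁻¹) (g p) := by
  obtain ⟨k, hk, t, ht, hp, hf⟩ := h
  refine ⟨k * g⁻¹, mobius.mul_mem hk (mobius.inv_mem hg), t, ht, by simpa using hp, ?_⟩
  rw [← mul_assoc (T t), ← hf]
  group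

theorem inv (h : IsParabolicAt f p) : IsParabolicAt f⁻¹ p := by
  obtain ⟨k, hk, t, ht, hp, hf⟩ := h
  refine ⟨k, hk, -t, neg_ne_zero.2 ht, hp, ?_⟩
  rw [← T_inv, eq_inv_mul_iff_mul_eq, ← mul_assoc, ← hf, mul_inv_cancel_right]

theorem apply_eq_iff (h : IsParabolicAt f p) (q : Sphere) : f q = q ↔ q = p := by
  obtain ⟨k, hk, t, ht, hp, hf⟩ := h
  rw [← k.injective.eq_iff, ← k.injective.eq_iff (a := q), hp, ← Equiv.Perm.mul_apply, hf,
    Equiv.Perm.mul_apply]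
  induction k q using OnePoint.rec with
  | infty => simp
  | coe z => simp [ht]

theorem apply_self (h : IsParabolicAt f p) : f p = p := (h.apply_eq_iff p).2 rfl

/-- The fixed point of a parabolic transformation lies in every closed disc that is mapped into
itself. -/
theorem form_nonpos (h : IsParabolicAt f p) {C : Circle}
    (hC : ∀ q, C.form q ≤ 0 → C.form (f q) ≤ 0) : C.form p ≤ 0 := by
  obtain ⟨k, hk, t, ht, hp, hf⟩ := h
  obtain ⟨D, hD⟩ := Circle.exists_isImage hk C
  rw [← hD.nonpos_iff, hp]
  have hT : ∀ q, D.form q ≤ 0 → D.form (T t q) ≤ 0 := by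
    intro q hq
    obtain ⟨r, rfl⟩ := k.surjective q
    rw [← Equiv.Perm.mul_apply, ← hf, Equiv.Perm.mul_apply, hD.nonpos_iff]
    exact hC r ((hD.nonpos_iff r).1 hq)
  by_contra! ha
  rw [Circle.form_infty] at ha
  obtain ⟨z, hz⟩ : ∃ z : ℂ, D.form z ≤ 0 := by
    obtain ⟨q, hq⟩ := D.interior_nonempty
    induction q using OnePoint.rec with
    | infty => exact absurd hq (not_lt.2 ha.le)
    | coe z => exact ⟨z, le_of_lt hq⟩
  -- The forward orbit under the translation stays in the closed disc, although the form along it is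
  -- a quadratic polynomial in `n` with positive leading coefficient `A`.
  have hn : ∀ n : ℕ, D.form ((z + n * (2 * t) : ℂ) : Sphere) ≤ 0 := by
    intro n
    induction n with
    | zero => simpa using hz
    | succ n ih =>
      have := hT _ ih
      rw [T_coe] at this
      convert this using 3
      push_cast; ring
  set A := D.a * normSq (2 * t) with hA
  have hApos : 0 < A := mul_pos ha (normSq_pos.2 (by simpa using ht))
  set B := 2 * ((D.a * z + D.b) * starRingEnd ℂ (2 * t)).re with hB
  have hq : ∀ n : ℕ, A * (n : ℝ) ^ 2 + B * n + D.form z ≤ 0 := by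
    intro n
    refine le_of_eq_of_le ?_ (hn n)
    rw [hA, hB]
    simp only [Circle.form_coe, normSq_apply, conj_re, conj_im, mul_re, mul_im, add_re, add_im,
      ofReal_re, ofReal_im, natCast_re, natCast_im]
    ring
  obtain ⟨n, hn⟩ := exists_nat_gt ((|B| + |D.form z|) / A + 1)
  have hn1 : (1 : ℝ) < n := by
    have : 0 ≤ (|B| + |D.form z|) / A := by positivity
    linarith
  have h3 : |B| + |D.form z| < A * n := by
    have : (|B| + |D.form z|) / A < n := by linarith
    rw [div_lt_iff₀ hApos] at this
    linarith
  have := hq n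
  have h4 := neg_abs_le B
  have h5 := neg_abs_le (D.form z)
  have h6 := abs_nonneg (D.form z)
  nlinarith

end IsParabolicAt

namespace Circle

/-- Disjoint half-planes have opposite normals. -/
theorem exists_b_eq_neg_mul {C D : Circle} (hC : C.a = 0) (hD : D.a = 0)
    (h : Disjoint C.interior D.interior) : ∃ μ : ℝ, 0 < μ ∧ D.b = -(μ * C.b) := by
  have hb : ∀ E : Circle, E.a = 0 → 0 < ‖E.b‖ := by
    intro E hE
    have := E.nondegenerate
    rw [hE, zero_mul] at this
    exact norm_pos_iff.2 (normSq_pos.1 this)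
  have hβ := hb C hC
  have hγ := hb D hD
  set β := ‖C.b‖ with hβd
  set γ := ‖D.b‖ with hγd
  have hβ2 : normSq C.b = β ^ 2 := normSq_eq_norm_sq _
  have hγ2 : normSq D.b = γ ^ 2 := normSq_eq_norm_sq _
  set r := (conj C.b * D.b).re with hr
  -- Unless the normals are opposite, both forms tend to `-∞` in the direction opposite to the sum
  -- of the unit normals. `R` is chosen so large that both constant terms are beaten.
  have hq : β * γ + r ≤ 0 := by
    by_contra! hq
    set R : ℝ := (|C.c| + 1) / (β * (β * γ + r)) + (|D.c| + 1) / (γ * (β * γ + r)) with hR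
    set z : ℂ := -(R * (γ * C.b + β * D.b)) with hz
    have e1 : C.form z = -2 * R * (β * (β * γ + r)) + C.c := by
      have : (conj C.b * z).re = -(R * (γ * normSq C.b + β * r)) := by
        simp only [hz, hr, normSq_apply, conj_re, conj_im, mul_re, mul_im, add_re, add_im,
          ofReal_re, ofReal_im, neg_re, neg_im]
        ring
      rw [form_coe, hC, this, hβ2]; ring
    have e2 : D.form z = -2 * R * (γ * (β * γ + r)) + D.c := by
      have : (conj D.b * z).re = -(R * (γ * r + β * normSq D.b)) := by
        simp only [hz, hr, normSq_apply, conj_re, conj_im, mul_re, mul_im, add_re, add_im,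
          ofReal_re, ofReal_im, neg_re, neg_im]
        ring
      rw [form_coe, hD, this, hγ2]; ring
    have k1 : |C.c| + 1 ≤ R * (β * (β * γ + r)) := by
      rw [← div_le_iff₀ (by positivity), hR]
      have : 0 ≤ (|D.c| + 1) / (γ * (β * γ + r)) := by positivity
      linarith
    have k2 : |D.c| + 1 ≤ R * (γ * (β * γ + r)) := by
      rw [← div_le_iff₀ (by positivity), hR]
      have : 0 ≤ (|C.c| + 1) / (β * (β * γ + r)) := by positivity
      linarith
    have n1 : C.form z < 0 := by
      rw [e1]
      linarith [le_abs_self C.c, abs_nonneg C.c]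
    have n2 : D.form z < 0 := by
      rw [e2]
      linarith [le_abs_self D.c, abs_nonneg D.c]
    exact Set.disjoint_left.1 h n1 n2
  have hz : normSq (γ * C.b + β * D.b) ≤ 0 := by
    have : normSq (γ * C.b + β * D.b) = γ ^ 2 * normSq C.b + β ^ 2 * normSq D.b + 2 * (β * γ) * r := by
      simp only [hr, normSq_apply, conj_re, conj_im, mul_re, mul_im, add_re, add_im,
          ofReal_re, ofReal_im]
      ring
    rw [this, hβ2, hγ2]
    have := mul_nonpos_of_nonneg_of_nonpos (mul_nonneg hβ.le hγ.le) hq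
    linarith
  have hz0 : γ * C.b + β * D.b = 0 := normSq_eq_zero.1 (le_antisymm hz (normSq_nonneg _))
  refine ⟨γ / β, by positivity, ?_⟩
  have hβ' : (β : ℂ) ≠ 0 := ofReal_ne_zero.2 hβ.ne'
  push_cast
  field_simp
  linear_combination hz0

theorem not_three_halfplanes {C D E : Circle} (hC : C.a = 0) (hD : D.a = 0) (hE : E.a = 0)
    (hCD : Disjoint C.interior D.interior) (hCE : Disjoint C.interior E.interior)
    (hDE : Disjoint D.interior E.interior) : False := by
  obtain ⟨μ, hμ, h1⟩ := exists_b_eq_neg_mul hC hD hCD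
  obtain ⟨ν, hν, h2⟩ := exists_b_eq_neg_mul hC hE hCE
  obtain ⟨ρ, hρ, h3⟩ := exists_b_eq_neg_mul hD hE hDE
  have hb : C.b ≠ 0 := by
    have := C.nondegenerate
    rw [hC, zero_mul] at this
    exact normSq_pos.1 this
  rw [h1, h2] at h3
  have : ((ν + ρ * μ : ℝ) : ℂ) * C.b = 0 := by push_cast; linear_combination -h3
  have h4 := ofReal_eq_zero.1 ((mul_eq_zero.1 this).resolve_right hb)
  have := mul_pos hρ hμ
  linarith

/-- Three circles with disjoint interiors have no common point. -/
theorem not_common_of_disjoint {C D E : Circle}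
    (hCD : Disjoint C.interior D.interior) (hCE : Disjoint C.interior E.interior)
    (hDE : Disjoint D.interior E.interior) {p : Sphere} (h1 : C.form p = 0) (h2 : D.form p = 0)
    (h3 : E.form p = 0) : False := by
  obtain ⟨k, hk, hp⟩ := exists_mobius_apply_eq_infty p
  obtain ⟨C', hC'⟩ := exists_isImage hk C
  obtain ⟨D', hD'⟩ := exists_isImage hk D
  obtain ⟨E', hE'⟩ := exists_isImage hk E
  rw [← hC'.zero_iff, hp] at h1
  rw [← hD'.zero_iff, hp] at h2
  rw [← hE'.zero_iff, hp] at h3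
  refine not_three_halfplanes h1 h2 h3 ?_ ?_ ?_ <;>
    simpa only [hC'.interior_eq, hD'.interior_eq, hE'.interior_eq,
      Set.disjoint_image_iff k.injective]

/-- Of three circles with disjoint interiors, two have at most one common point. -/
theorem eq_of_common_of_disjoint {C D E : Circle}
    (hCD : Disjoint C.interior D.interior) (hCE : Disjoint C.interior E.interior)
    (hDE : Disjoint D.interior E.interior) {p q : Sphere} (h1 : C.form p = 0) (h2 : D.form p = 0)
    (h3 : C.form q = 0) (h4 : D.form q = 0) : p = q := by
  obtain ⟨k, hk, hp⟩ := exists_mobius_apply_eq_infty p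
  obtain ⟨C', hC'⟩ := exists_isImage hk C
  obtain ⟨D', hD'⟩ := exists_isImage hk D
  obtain ⟨E', hE'⟩ := exists_isImage hk E
  rw [← hC'.zero_iff] at h1 h3
  rw [← hD'.zero_iff] at h2 h4
  rw [hp] at h1 h2
  replace hCD : Disjoint C'.interior D'.interior := by
    simpa only [hC'.interior_eq, hD'.interior_eq, Set.disjoint_image_iff k.injective]
  replace hCE : Disjoint C'.interior E'.interior := by
    simpa only [hC'.interior_eq, hE'.interior_eq, Set.disjoint_image_iff k.injective]
  replace hDE : Disjoint D'.interior E'.interior := by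
    simpa only [hD'.interior_eq, hE'.interior_eq, Set.disjoint_image_iff k.injective]
  by_contra hne
  have hq : k q ≠ ∞ := by
    rw [← hp]; exact fun h => hne (k.injective h).symm
  obtain ⟨w, hw⟩ := OnePoint.ne_infty_iff_exists.1 hq
  rw [← hw] at h3 h4
  obtain ⟨μ, hμ, hb⟩ := exists_b_eq_neg_mul h1 h2 hCD
  rw [form_infty] at h1 h2
  obtain ⟨e, he⟩ := E'.interior_nonempty
  have he1 : 0 ≤ C'.form e := form_nonneg_of_disjoint hCE.symm (le_of_lt he)
  have he2 : 0 ≤ D'.form e := form_nonneg_of_disjoint hDE.symm (le_of_lt he)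
  -- Parallel lines with a finite common point coincide, so the two half-planes fill the complement
  -- of the line and leave no room for the third interior.
  have he3 : D'.form e = -μ * C'.form e := by
    induction e using OnePoint.rec with
    | infty => simp [h1, h2]
    | coe z =>
      simp only [form_coe, h1, h2, hb, map_neg, map_mul, conj_ofReal, neg_mul, neg_re] at *
      rw [mul_assoc, re_ofReal_mul] at *
      linear_combination h4 + μ * h3
  have he4 : C'.form e = 0 := by
    rw [he3] at he2
    nlinarith
  exact absurd he (not_lt.2 (form_nonneg_of_disjoint hCE he4.le))

end Circle

end TwoParabolic

end

/-! ### Ping-pong and conjugated bases in free groups -/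

noncomputable section

namespace TwoParabolic

section FreeGroupPingPong

variable {ι : Type*}

/-- The inverse of a letter. -/
def invLetter (v : ι × Bool) : ι × Bool := (v.1, !v.2)

@[simp] theorem invLetter_invLetter (v : ι × Bool) : invLetter (invLetter v) = v := by
  simp [invLetter]

@[simp] theorem invLetter_fst (v : ι × Bool) : (invLetter v).1 = v.1 := rfl

theorem invLetter_ne (v : ι × Bool) : invLetter v ≠ v := by
  rintro h
  have := congrArg Prod.snd h
  simp [invLetter] at this

theorem ne_invLetter_iff {v w : ι × Bool} : w ≠ invLetter v ↔ (v.1 = w.1 → v.2 = w.2) := by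
  obtain ⟨i, b⟩ := v
  obtain ⟨j, c⟩ := w
  simp only [invLetter, ne_eq, Prod.mk.injEq, not_and]
  constructor
  · intro h h'
    have := h h'.symm
    revert this; cases b <;> cases c <;> simp
  · intro h h'
    have := h h'.symm
    revert this; cases b <;> cases c <;> simp

theorem mk_invLetter (v : ι × Bool) :
    FreeGroup.mk [invLetter v] = (FreeGroup.mk [v])⁻¹ := by
  rw [FreeGroup.inv_mk]; rfl

theorem mk_cons (v : ι × Bool) (l : List (ι × Bool)) :
    FreeGroup.mk (v :: l) = FreeGroup.mk [v] * FreeGroup.mk l := by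
  rw [FreeGroup.mul_mk]; rfl

theorem exists_ne_ne [Nontrivial ι] (a b : ι × Bool) : ∃ u, u ≠ a ∧ u ≠ b := by
  obtain ⟨j, hj⟩ := exists_ne a.1
  by_cases h : (j, true) = b
  · exact ⟨(j, false), fun h' => hj (congrArg Prod.fst h'), by rw [← h]; simp⟩
  · exact ⟨(j, true), fun hab => hj (congrArg Prod.fst hab), h⟩

/-- The ping-pong principle for reduced words. -/
theorem ping_pong {Ω : Type*} (φ : FreeGroup ι →* Equiv.Perm Ω) (X : ι × Bool → Set Ω)
    (hX : ∀ v u, u ≠ invLetter v → ∀ p ∈ X u, φ (FreeGroup.mk [v]) p ∈ X v) :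
    ∀ (l : List (ι × Bool)) (hne : l ≠ []), FreeGroup.IsReduced l → ∀ p : Ω,
      φ (FreeGroup.mk [l.getLast hne]) p ∈ X (l.getLast hne) →
      φ (FreeGroup.mk l) p ∈ X (l.head hne)
  | [], hne, _, _, _ => absurd rfl hne
  | [_], _, _, _, hp => hp
  | v :: w :: l, _, hl, p, hp => by
    rw [FreeGroup.IsReduced, List.isChain_cons_cons] at hl
    have ih := ping_pong φ X hX (w :: l) (by simp) hl.2 p (by simpa using hp)
    rw [mk_cons, map_mul, Equiv.Perm.mul_apply]
    exact hX v w (ne_invLetter_iff.2 hl.1) _ ih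

variable [DecidableEq ι]

theorem toWord_letter_mul {v : ι × Bool} {g : FreeGroup ι}
    (h : g.toWord.head? ≠ some (invLetter v)) :
    (FreeGroup.mk [v] * g).toWord = v :: g.toWord := by
  have hr : FreeGroup.IsReduced (v :: g.toWord) := by
    have hg : FreeGroup.IsReduced g.toWord := FreeGroup.isReduced_toWord
    rcases hw : g.toWord with _ | ⟨w, l⟩
    · simp [FreeGroup.IsReduced]
    · rw [hw] at hg h
      rw [FreeGroup.IsReduced, List.isChain_cons_cons]
      exact ⟨ne_invLetter_iff.1 (by simpa using h), hg⟩
  conv_lhs => rw [← FreeGroup.mk_toWord (x := g), FreeGroup.mul_mk, FreeGroup.toWord_mk]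
  exact hr.reduce_eq

end FreeGroupPingPong

section SimultaneousConjugation

open FreeGroup

theorem closure_conj_eq_top {H : Type*} [Group H] {s t c : H}
    (h : Subgroup.closure {s, t} = ⊤) : Subgroup.closure {c * s * c⁻¹, c * t * c⁻¹} = ⊤ := by
  have := congrArg (Subgroup.map (MulAut.conj c).toMonoidHom) h
  rw [MonoidHom.map_closure, Set.image_pair] at this
  simp only [MulEquiv.coe_toMonoidHom, MulAut.conj_apply] at this
  rw [this]
  exact Subgroup.map_top_of_surjective _ (MulAut.conj c).surjective

/-- Let `k` begin with a power of `y` and end with a power of `x`. In the action of the free group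
on itself, `x` and `k y k⁻¹` play ping-pong with the words that begin with `x^±1` and the translates
by `k` of those that begin with `y^±1`. The latter all begin with the first letter `h` of `k`, since
nothing cancels. No nontrivial word in the two elements equals `h`: `h` does not begin with a power
of `x`, and `k⁻¹ h` does not begin with a power of `y`. -/
theorem not_closure_eq_top {k : FreeGroup (Fin 2)} {l : List (Fin 2 × Bool)} {h : Fin 2 × Bool}
    (hk : k.toWord = h :: l) (hh : h.1 = 1) (hl : ∀ a ∈ (h :: l).getLast?, a.1 = 0) :
    Subgroup.closure {of (0 : Fin 2), k * of 1 * k⁻¹} ≠ ⊤ := by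
  intro htop
  have hne : l ≠ [] := by
    rintro rfl
    have := hl h (by simp)
    simp [hh] at this
  have hlast : (l.getLast hne).1 = 0 := hl _ (by
    rw [List.getLast?_cons_of_ne_nil hne]; simp [List.getLast?_eq_getLast_of_ne_nil hne])
  have hkinv : ∀ a ∈ (k⁻¹).toWord.head?, a.1 = 0 := by
    intro a ha
    rw [toWord_inv, hk, invRev, List.head?_reverse, List.getLast?_map,
      List.getLast?_cons_of_ne_nil hne, List.getLast?_eq_getLast_of_ne_nil hne] at ha
    simp only [Option.map_some, Option.mem_def, Option.some.injEq] at ha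
    rw [← ha]; exact hlast
  have hlred : IsReduced l := by
    have : IsReduced k.toWord := isReduced_toWord
    rw [hk, FreeGroup.IsReduced] at this
    exact this.tail
  have hkh : ∀ a ∈ (k⁻¹ * FreeGroup.mk [h]).toWord.head?, a.1 = 0 := by
    have e : k⁻¹ * FreeGroup.mk [h] = (FreeGroup.mk l)⁻¹ := by
      rw [← mk_toWord (x := k), hk, mk_cons]; group
    intro a ha
    rw [e, toWord_inv, toWord_mk, hlred.reduce_eq, invRev, List.head?_reverse, List.getLast?_map,
      List.getLast?_eq_getLast_of_ne_nil hne] at ha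
    simp only [Option.map_some, Option.mem_def, Option.some.injEq] at ha
    rw [← ha]; exact hlast
  have hrange : (lift ![of (0 : Fin 2), k * of 1 * k⁻¹]).range = ⊤ := by
    rw [range_lift_eq_closure, ← htop]
    congr 1
    ext x
    simp [or_comm]
  obtain ⟨r, hr⟩ : FreeGroup.mk [h] ∈ (lift ![of (0 : Fin 2), k * of 1 * k⁻¹]).range := by
    rw [hrange]; trivial
  let φ : FreeGroup (Fin 2) →* Equiv.Perm (FreeGroup (Fin 2)) :=
    (MulAction.toPermHom (FreeGroup (Fin 2)) (FreeGroup (Fin 2))).comp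
      (lift ![of (0 : Fin 2), k * of 1 * k⁻¹])
  have hφ : ∀ a p, φ a p = lift ![of (0 : Fin 2), k * of 1 * k⁻¹] a * p := fun a p => rfl
  have hφ0 : ∀ b p, φ (FreeGroup.mk [(0, b)]) p = FreeGroup.mk [(0, b)] * p := by
    intro b p
    rw [hφ]
    cases b <;> simp [lift_mk, of, invRev]
  have hφ1 : ∀ b p, φ (FreeGroup.mk [(1, b)]) p = k * (FreeGroup.mk [(1, b)] * (k⁻¹ * p)) := by
    intro b p
    rw [hφ]
    cases b <;> simp [lift_mk, of, mul_assoc, invRev]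
  let W : Fin 2 × Bool → Set (FreeGroup (Fin 2)) := fun v => {g | g.toWord.head? = some v}
  have hW : ∀ v g, g ∉ W (invLetter v) → FreeGroup.mk [v] * g ∈ W v := by
    intro v g hg
    change (FreeGroup.mk [v] * g).toWord.head? = some v
    rw [toWord_letter_mul hg]; rfl
  let X : Fin 2 × Bool → Set (FreeGroup (Fin 2)) := fun v =>
    if v.1 = 0 then W v else {g | k⁻¹ * g ∈ W v}
  have hX0 : ∀ b, X (0, b) = W (0, b) := fun b => if_pos rfl
  have hX1 : ∀ b, X (1, b) = {g | k⁻¹ * g ∈ W (1, b)} := fun b => if_neg one_ne_zero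
  -- left translation by `k` moves `W v`, `v` a power of the second letter, into `W h`
  have hkW : ∀ b c g, k⁻¹ * g ∈ W (1, b) → g ∉ W (0, c) := by
    intro b c g hg hg'
    have key := ping_pong (MulAction.toPermHom (FreeGroup (Fin 2)) (FreeGroup (Fin 2))) W
      (fun v u huv p hp => hW v p (fun hp' => huv (by
        have h1 : p.toWord.head? = some u := hp
        have h2 : p.toWord.head? = some (invLetter v) := hp'
        rw [h1] at h2; exact Option.some.inj h2)))
      (h :: l) (by simp) (hk ▸ isReduced_toWord) (k⁻¹ * g)
      (hW _ _ (fun hp' => by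
        have h1 : (k⁻¹ * g).toWord.head? = some (1, b) := hg
        have h2 : (k⁻¹ * g).toWord.head? = some (invLetter ((h :: l).getLast (by simp))) := hp'
        rw [h1] at h2
        have h3 := congrArg Prod.fst (Option.some.inj h2)
        rw [invLetter_fst, List.getLast_cons hne, hlast] at h3
        simp at h3))
    have e : (MulAction.toPermHom (FreeGroup (Fin 2)) (FreeGroup (Fin 2)))
        (FreeGroup.mk (h :: l)) (k⁻¹ * g) = g := by
      rw [← hk, mk_toWord]; simp
    rw [e] at key
    have h1 : g.toWord.head? = some h := key
    have h2 : g.toWord.head? = some (0, c) := hg'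
    rw [h1] at h2
    have := congrArg Prod.fst (Option.some.inj h2)
    simp [hh] at this
  have hdisj : ∀ v w g, g ∈ W v → g ∈ W w → v = w := by
    intro v w g h1 h2
    have h1 : g.toWord.head? = some v := h1
    have h2 : g.toWord.head? = some w := h2
    rw [h1] at h2; exact Option.some.inj h2
  have hping : ∀ v u, u ≠ invLetter v → ∀ p ∈ X u, φ (FreeGroup.mk [v]) p ∈ X v := by
    rintro ⟨i, b⟩ ⟨j, c⟩ huv p hp
    fin_cases i <;> fin_cases j <;> simp only [Fin.zero_eta, Fin.mk_one, Fin.isValue] at *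
    · rw [hX0] at hp ⊢
      rw [hφ0]
      exact hW _ _ fun h' => huv (hdisj _ _ _ hp h')
    · rw [hX0, hφ0]
      rw [hX1] at hp
      exact hW _ _ fun h' => hkW _ _ _ hp h'
    · rw [hX0] at hp
      rw [hX1, hφ1]
      rw [Set.mem_ofPred_eq]
      rw [inv_mul_cancel_left]
      exact hW _ _ fun h' => hkW _ _ _ h' hp
    · rw [hX1] at hp ⊢
      rw [hφ1]
      rw [Set.mem_ofPred_eq]
      rw [inv_mul_cancel_left]
      exact hW _ _ fun h' => huv (hdisj _ _ _ hp h')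
  have hbase : ∀ v, φ (FreeGroup.mk [v]) 1 ∈ X v := by
    rintro ⟨i, b⟩
    fin_cases i <;> simp only [Fin.zero_eta, Fin.mk_one, Fin.isValue] at *
    · rw [hX0, hφ0]
      exact hW _ _ (by intro h'; change (1 : FreeGroup (Fin 2)).toWord.head? = _ at h'; simp at h')
    · rw [hX1, hφ1]
      rw [Set.mem_ofPred_eq]
      rw [inv_mul_cancel_left, mul_one]
      refine hW _ _ fun h' => ?_
      have := hkinv _ h'
      simp [invLetter] at this
  have hrne : r.toWord ≠ [] := by
    intro h'
    rw [toWord_eq_nil_iff] at h'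
    rw [h', _root_.map_one] at hr
    have := congrArg toWord hr
    simp at this
  have hfin := ping_pong φ X hping r.toWord hrne isReduced_toWord 1 (hbase _)
  rw [mk_toWord, hφ, hr, mul_one] at hfin
  revert hfin
  generalize r.toWord.head hrne = v
  obtain ⟨i, b⟩ := v
  fin_cases i <;> simp only [Fin.zero_eta, Fin.mk_one, Fin.isValue]
  · rw [hX0]
    intro h'
    have h' : (FreeGroup.mk [h]).toWord.head? = some (0, b) := h'
    simp only [toWord_mk, reduce_singleton, List.head?_cons, Option.some.injEq] at h'
    rw [h'] at hh
    simp at hh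
  · rw [hX1]
    intro h'
    have := hkh _ h'
    simp at this

/-- Leading powers of `x` and trailing powers of `y` can be stripped from `k` without affecting
generation: the former by conjugation with a power of `x`, the latter since they commute with `y`. A
word that allows neither is excluded by `not_closure_eq_top`. -/
theorem eq_zpow_mul_zpow_of_closure_eq_top (n : ℕ) : ∀ k : FreeGroup (Fin 2), k.toWord.length ≤ n →
    Subgroup.closure {of (0 : Fin 2), k * of 1 * k⁻¹} = ⊤ →
    ∃ a b : ℤ, k = of 0 ^ a * of 1 ^ b := by
  induction n with
  | zero =>
    intro k hk _
    refine ⟨0, 0, ?_⟩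
    have : k = 1 := by rw [← toWord_eq_nil_iff]; exact List.length_eq_zero_iff.1 (by omega)
    simp [this]
  | succ n ih =>
    intro k hk htop
    rcases hw : k.toWord with _ | ⟨h, l⟩
    · rw [toWord_eq_nil_iff] at hw
      exact ⟨0, 0, by simp [hw]⟩
    rw [hw, List.length_cons] at hk
    have hred : IsReduced (h :: l) := hw ▸ isReduced_toWord
    by_cases hh : h.1 = 0
    · obtain ⟨e, he⟩ : ∃ e : ℤ, FreeGroup.mk [h] = of 0 ^ e := by
        obtain ⟨i, b⟩ := h
        obtain rfl : i = 0 := hh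
        cases b
        · exact ⟨-1, by rw [zpow_neg_one]; rfl⟩
        · exact ⟨1, by rw [zpow_one]; rfl⟩
      have hk1 : k = of 0 ^ e * FreeGroup.mk l := by
        rw [← he, ← mk_cons, ← hw, mk_toWord]
      obtain ⟨a, b, hab⟩ := ih (FreeGroup.mk l) ((FreeGroup.norm_mk_le).trans (by omega)) (by
        have := closure_conj_eq_top (c := (of (0 : Fin 2) ^ e)⁻¹) htop
        convert this using 3
        · group
        · rw [hk1]; group)
      exact ⟨e + a, b, by rw [hk1, hab, zpow_add, mul_assoc]⟩
    · have hh : h.1 = 1 := by omega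
      by_cases hl : ∀ a ∈ (h :: l).getLast?, a.1 = 0
      · exact absurd htop (not_closure_eq_top hw hh hl)
      · push Not at hl
        obtain ⟨a, ha, ha0⟩ := hl
        have ha1 : a.1 = 1 := by omega
        obtain ⟨l', hl'⟩ := List.getLast?_eq_some_iff.1 ha
        obtain ⟨e, he⟩ : ∃ e : ℤ, FreeGroup.mk [a] = of 1 ^ e := by
          obtain ⟨i, b⟩ := a
          obtain rfl : i = 1 := ha1
          cases b
          · exact ⟨-1, by rw [zpow_neg_one]; rfl⟩
          · exact ⟨1, by rw [zpow_one]; rfl⟩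
        have hk1 : k = FreeGroup.mk l' * of 1 ^ e := by
          rw [← he, mul_mk, ← hl', ← hw, mk_toWord]
        have hlen := congrArg List.length hl'
        simp only [List.length_cons, List.length_append, List.length_nil] at hlen
        obtain ⟨a', b', hab⟩ := ih (FreeGroup.mk l') ((FreeGroup.norm_mk_le).trans (by omega)) (by
          rw [← htop, hk1]
          congr 2
          group)
        exact ⟨a', b' + e, by rw [hk1, hab, zpow_add, mul_assoc]⟩

/-- If conjugates of the two elements of a basis of a free group of rank two generate the group,
then they are simultaneously conjugate to the basis. -/
theorem exists_simultaneous_conj {H : Type*} [Group H] {f : FreeGroup (Fin 2) →* H}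
    (hf : Function.Bijective f) {u v : H}
    (h : Subgroup.closure {u * f (of 0) * u⁻¹, v * f (of 1) * v⁻¹} = ⊤) :
    ∃ c, u * f (of 0) * u⁻¹ = c * f (of 0) * c⁻¹ ∧ v * f (of 1) * v⁻¹ = c * f (of 1) * c⁻¹ := by
  obtain ⟨k, hk⟩ := hf.2 (u⁻¹ * v)
  have htop : Subgroup.closure {of (0 : Fin 2), k * of 1 * k⁻¹} = ⊤ := by
    apply Subgroup.map_injective hf.1
    rw [MonoidHom.map_closure, Set.image_pair, Subgroup.map_top_of_surjective _ hf.2]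
    have := closure_conj_eq_top (c := u⁻¹) h
    convert this using 3
    · group
    · simp only [_root_.map_mul, _root_.map_inv, hk]; group
  obtain ⟨a, b, hab⟩ := eq_zpow_mul_zpow_of_closure_eq_top _ k le_rfl htop
  have hv : v = u * f (of 0) ^ a * f (of 1) ^ b := by
    rw [hab] at hk
    rw [mul_assoc, ← map_zpow, ← map_zpow, ← _root_.map_mul, hk, mul_inv_cancel_left]
  refine ⟨u * f (of 0) ^ a, ?_, ?_⟩
  · group
  · rw [hv]; group

end SimultaneousConjugation

end TwoParabolic

end

/-! ### The finite check on periodic words -/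

noncomputable section

namespace TwoParabolic

section Words

/-! The letters of the free group on two generators `x`, `y` are coded as `x = 0`, `x⁻¹ = 1`,
`y = 2`, `y⁻¹ = 3`, and a map from the letters to themselves as a number in base four. A pair of
letters is a state; a permutation of the letters for each generator lets a state evolve. -/

/-- The value at `v` of the map coded by `t`. -/
def digit (t v : ℕ) : ℕ := t / 4 ^ v % 4

/-- The evolution of a coded state. -/
def stepCode (m : (ℕ × ℕ) × (ℕ × ℕ)) (s : ℕ × ℕ) : ℕ × ℕ :=
  (s.2, digit (if s.2 = 0 then m.1.1 else if s.2 = 1 then m.1.2 else if s.2 = 2 then m.2.1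
    else m.2.2) (digit 177 s.1))

/-- The word of length `k` read off from the evolution of a coded state. -/
def wordCode (m : (ℕ × ℕ) × (ℕ × ℕ)) : ℕ → ℕ × ℕ → List ℕ
  | 0, _ => []
  | k + 1, s => s.1 :: wordCode m k (stepCode m s)

/-- The image of a coded word in the abelianization. -/
def abelCode : List ℕ → ℤ × ℤ
  | [] => (0, 0)
  | v :: l => ((if v = 0 then 1 else if v = 1 then -1 else 0) + (abelCode l).1,
      (if v = 2 then 1 else if v = 3 then -1 else 0) + (abelCode l).2)

/-- The action of a coded word on the points that the permutations `r v` permute. -/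
def actCode (r : ℕ → ℕ) : List ℕ → ℕ → ℕ
  | [], j => j
  | v :: l, j => digit (r v) (actCode r l j)

/-- The codes of two homomorphisms to the symmetric group of degree three: one generator goes to a
transposition and the other one to a cycle. -/
def homCode (b : Bool) (v : ℕ) : ℕ :=
  if b then (if v = 0 then 33 else if v = 1 then 33 else if v = 2 then 9 else 18)
  else (if v = 0 then 9 else if v = 1 then 18 else 33)

/-- Whether a coded word is in the kernel of one of these homomorphisms. -/
def killedCode (b : Bool) (l : List ℕ) : Bool :=
  actCode (homCode b) l 0 == 0 && actCode (homCode b) l 1 == 1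

/-- The coded states that occur in reduced words. -/
def statesCode : List (ℕ × ℕ) :=
  [(0, 0), (0, 2), (0, 3), (1, 1), (1, 2), (1, 3), (2, 0), (2, 1), (2, 2), (3, 0), (3, 1), (3, 3)]

/-- Lengths and abelianizations of the cycles of states whose words are in neither kernel. -/
def cyclesCode (m : (ℕ × ℕ) × (ℕ × ℕ)) : List (ℕ × ℤ × ℤ) :=
  statesCode.flatMap fun s => [1, 2, 3, 4, 5, 6].filterMap fun k =>
    if (stepCode m)^[k] s = s then
      let w := wordCode m k s
      bif killedCode true w || killedCode false w then none else some (k, abelCode w)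
    else none

/-- Two cycles are short, or their words do not generate the abelianization. -/
def pairCode (x y : ℕ × ℤ × ℤ) : Bool :=
  Nat.ble (x.1 + y.1) 3 || !Nat.beq (x.2.1 * y.2.2 - x.2.2 * y.2.1).natAbs 1

/-- The permutations, with their inverses, that take `x` to `x⁻¹`. -/
def tables₀ : List (ℕ × ℕ) :=
  [(225, 225), (177, 177), (201, 210), (57, 147), (141, 114), (45, 99)]

/-- The permutations, with their inverses, that take `y` to `y⁻¹`. -/
def tables₁ : List (ℕ × ℕ) :=
  [(180, 180), (120, 156), (177, 177), (57, 147), (114, 141), (54, 135)]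


/-- The combinatorial heart: for each of the 36 evolutions, two surviving cycles whose
abelianizations have determinant `±1` have total length at most three. The coding by numerals keeps
the evaluation feasible. -/
theorem pairCode_eq_true : (tables₀.all fun m₀ => tables₁.all fun m₁ =>
    (cyclesCode (m₀, m₁)).all fun x => (cyclesCode (m₀, m₁)).all fun y => pairCode x y) = true := by
  decide +kernel

/-- The bound is half the number of states. The involution `(a, b) ↦ (b⁻¹, a⁻¹)` reverses the
evolution and preserves no cycle, because a reflection of a cyclic word fixes a letter or a gap
between neighbours, and a letter is never its own inverse nor followed by it. So the cycles come in
pairs of equal length. -/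
theorem exists_return : ∀ m₀ ∈ tables₀, ∀ m₁ ∈ tables₁, ∀ s ∈ statesCode,
    ∃ k ∈ [1, 2, 3, 4, 5, 6], (stepCode (m₀, m₁))^[k] s = s := by
  decide +kernel

/-- The code of a letter. -/
def enc (v : Fin 2 × Bool) : ℕ := 2 * v.1.val + if v.2 then 0 else 1

theorem enc_injective : Function.Injective enc := by
  unfold Function.Injective
  decide

theorem digit_enc_inv : ∀ v, digit 177 (enc v) = enc (invLetter v) := by decide

theorem exists_table₀ : ∀ f : Equiv.Perm (Fin 2 × Bool), f (0, true) = (0, false) →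
    ∃ m ∈ tables₀, ∀ v, digit m.1 (enc v) = enc (f v) ∧ digit m.2 (enc v) = enc (f⁻¹ v) := by
  decide +kernel

theorem exists_table₁ : ∀ f : Equiv.Perm (Fin 2 × Bool), f (1, true) = (1, false) →
    ∃ m ∈ tables₁, ∀ v, digit m.1 (enc v) = enc (f v) ∧ digit m.2 (enc v) = enc (f⁻¹ v) := by
  decide +kernel

/-- The evolution of a state under a family of permutations of the letters. -/
def step (σ : Fin 2 × Bool → Equiv.Perm (Fin 2 × Bool)) (s : (Fin 2 × Bool) × (Fin 2 × Bool)) :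
    (Fin 2 × Bool) × (Fin 2 × Bool) := (s.2, σ s.2 (invLetter s.1))

/-- The word of length `k` read off from the evolution of a state. -/
def stepWord (σ : Fin 2 × Bool → Equiv.Perm (Fin 2 × Bool)) :
    ℕ → (Fin 2 × Bool) × (Fin 2 × Bool) → List (Fin 2 × Bool)
  | 0, _ => []
  | k + 1, s => s.1 :: stepWord σ k (step σ s)

theorem stepWord_add (σ : Fin 2 × Bool → Equiv.Perm (Fin 2 × Bool)) (i j : ℕ) :
    ∀ s, stepWord σ (i + j) s = stepWord σ i s ++ stepWord σ j ((step σ)^[i] s) := by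
  induction i with
  | zero => intro s; simp [stepWord]
  | succ i ih =>
    intro s
    rw [Nat.succ_add, stepWord, ih, stepWord, Function.iterate_succ_apply, List.cons_append]

variable {σ : Fin 2 × Bool → Equiv.Perm (Fin 2 × Bool)}

theorem exists_code (h : ∀ v, σ v v = invLetter v) (h' : ∀ v, σ (invLetter v) = (σ v)⁻¹) :
    ∃ m₀ ∈ tables₀, ∃ m₁ ∈ tables₁, ∀ s : (Fin 2 × Bool) × (Fin 2 × Bool),
      stepCode (m₀, m₁) (Prod.map enc enc s) = Prod.map enc enc (step σ s) := by
  obtain ⟨m₀, hm₀, h₀⟩ := exists_table₀ (σ (0, true)) (h _)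
  obtain ⟨m₁, hm₁, h₁⟩ := exists_table₁ (σ (1, true)) (h _)
  have e0 : σ (0, false) = (σ (0, true))⁻¹ := h' (0, true)
  have e1 : σ (1, false) = (σ (1, true))⁻¹ := h' (1, true)
  refine ⟨m₀, hm₀, m₁, hm₁, ?_⟩
  rintro ⟨a, i, b⟩
  simp only [stepCode, step, Prod.map, digit_enc_inv]
  generalize invLetter a = w
  have v0 : enc (0, true) = 0 := rfl
  have v1 : enc (0, false) = 1 := rfl
  have v2 : enc (1, true) = 2 := rfl
  have v3 : enc (1, false) = 3 := rfl
  fin_cases i <;> cases b <;>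
    simp only [Fin.zero_eta, Fin.mk_one, v0, v1, v2, v3, e0, e1, Prod.mk.injEq, true_and]
  · exact (h₀ w).2
  · exact (h₀ w).1
  · exact (h₁ w).2
  · exact (h₁ w).1

theorem stepWord_map_enc {m : (ℕ × ℕ) × (ℕ × ℕ)}
    (hm : ∀ s, stepCode m (Prod.map enc enc s) = Prod.map enc enc (step σ s)) (k : ℕ) :
    ∀ s, wordCode m k (Prod.map enc enc s) = (stepWord σ k s).map enc := by
  induction k with
  | zero => intro s; rfl
  | succ k ih =>
    intro s
    rw [wordCode, hm, ih, stepWord]; rfl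

/-- The abelianization of the free group of rank two. -/
def abel : FreeGroup (Fin 2) →* Multiplicative (ℤ × ℤ) :=
  FreeGroup.lift ![Multiplicative.ofAdd (1, 0), Multiplicative.ofAdd (0, 1)]

theorem abel_mk (l : List (Fin 2 × Bool)) :
    abel (FreeGroup.mk l) = Multiplicative.ofAdd (abelCode (l.map enc)) := by
  induction l with
  | nil => rfl
  | cons v l ih =>
    rw [mk_cons, map_mul, ih, List.map_cons, abelCode]
    obtain ⟨i, b⟩ := v
    fin_cases i <;> cases b <;> simp [abel, enc, FreeGroup.lift_mk, ← ofAdd_neg, ← ofAdd_add] <;>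
      ext <;> simp

/-- A homomorphism that takes one generator to a transposition and the other one to a cycle. -/
def permHom (b : Bool) : FreeGroup (Fin 2) →* Equiv.Perm (Fin 3) :=
  FreeGroup.lift fun i => if (i = 0) = (b = true) then Equiv.swap 0 1 else finRotate 3

theorem permHom_mk (b : Bool) (l : List (Fin 2 × Bool)) (j : Fin 3) :
    (permHom b (FreeGroup.mk l) j : ℕ) = actCode (homCode b) (l.map enc) j := by
  induction l with
  | nil => rfl
  | cons v l ih =>
    rw [mk_cons, map_mul, Equiv.Perm.mul_apply, List.map_cons, actCode, ← ih]
    generalize permHom b (FreeGroup.mk l) j = q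
    clear ih
    revert b v q
    decide

theorem permHom_mk_eq_one {b : Bool} {l : List (Fin 2 × Bool)}
    (h : killedCode b (l.map enc) = true) : permHom b (FreeGroup.mk l) = 1 := by
  simp only [killedCode, Bool.and_eq_true, beq_iff_eq] at h
  have h0 := permHom_mk b l 0
  have h1 := permHom_mk b l 1
  simp only [Fin.val_zero, Fin.val_one] at h0 h1
  rw [h.1] at h0
  rw [h.2] at h1
  revert h0 h1
  generalize permHom b (FreeGroup.mk l) = f
  revert f
  decide

theorem permHom_not_commute (b : Bool) :
    permHom b (FreeGroup.of 0) * permHom b (FreeGroup.of 1)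
      ≠ permHom b (FreeGroup.of 1) * permHom b (FreeGroup.of 0) := by
  revert b
  simp only [permHom, FreeGroup.lift_apply_of]
  decide

/-- A pair of elements that generates the free group does not have a trivial element in a nonabelian
quotient. -/
theorem map_ne_one_of_closure_eq_top {H : Type*} [Group H] (f : FreeGroup (Fin 2) →* H)
    (hf : f (FreeGroup.of 0) * f (FreeGroup.of 1) ≠ f (FreeGroup.of 1) * f (FreeGroup.of 0))
    {x y : FreeGroup (Fin 2)} (h : Subgroup.closure {x, y} = ⊤) : f x ≠ 1 ∧ f y ≠ 1 := by
  have key : ∀ x y : FreeGroup (Fin 2), Subgroup.closure {x, y} = ⊤ → f x ≠ 1 := by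
    intro x y h hx
    have hz : ∀ z, f z ∈ Subgroup.zpowers (f y) := by
      intro z
      have hz : z ∈ Subgroup.closure {x, y} := by rw [h]; trivial
      induction hz using Subgroup.closure_induction with
      | mem z hz =>
        rcases hz with rfl | rfl
        · rw [hx]; exact one_mem _
        · exact Subgroup.mem_zpowers _
      | one => rw [map_one]; exact one_mem _
      | mul a b _ _ ha hb => rw [map_mul]; exact mul_mem ha hb
      | inv a _ ha => rw [map_inv]; exact inv_mem ha
    obtain ⟨i, hi⟩ := Subgroup.mem_zpowers_iff.1 (hz (FreeGroup.of 0))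
    obtain ⟨j, hj⟩ := Subgroup.mem_zpowers_iff.1 (hz (FreeGroup.of 1))
    apply hf
    rw [← hi, ← hj, ← zpow_add, ← zpow_add, add_comm]
  exact ⟨key x y h, key y x (by rwa [Set.pair_comm])⟩

/-- The images of a generating pair span `ℤ²`, so the determinant has an inverse: that of the matrix
expressing the standard basis through them. -/
theorem natAbs_det_eq_one_of_closure_eq_top {x y : FreeGroup (Fin 2)}
    (h : Subgroup.closure {x, y} = ⊤) {a b : ℤ × ℤ} (hx : abel x = Multiplicative.ofAdd a)
    (hy : abel y = Multiplicative.ofAdd b) : (a.1 * b.2 - a.2 * b.1).natAbs = 1 := by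
  have hz : ∀ z, ∃ i j : ℤ, abel z = Multiplicative.ofAdd (i • a + j • b) := by
    intro z
    have hz : z ∈ Subgroup.closure {x, y} := by rw [h]; trivial
    induction hz using Subgroup.closure_induction with
    | mem z hz =>
      rcases hz with rfl | rfl
      · exact ⟨1, 0, by rw [hx]; simp⟩
      · exact ⟨0, 1, by rw [hy]; simp⟩
    | one => exact ⟨0, 0, by simp⟩
    | mul p q _ _ hp hq =>
      obtain ⟨i, j, hp⟩ := hp
      obtain ⟨i', j', hq⟩ := hq
      refine ⟨i + i', j + j', ?_⟩
      rw [map_mul, hp, hq, ← ofAdd_add]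
      congr 1
      rw [add_smul, add_smul]; abel
    | inv p _ hp =>
      obtain ⟨i, j, hp⟩ := hp
      refine ⟨-i, -j, ?_⟩
      rw [map_inv, hp, ← ofAdd_neg]
      congr 1
      rw [neg_smul, neg_smul]; abel
  obtain ⟨i, j, h0⟩ := hz (FreeGroup.of 0)
  obtain ⟨i', j', h1⟩ := hz (FreeGroup.of 1)
  simp only [abel, FreeGroup.lift_apply_of] at h0 h1
  have h0 := Multiplicative.ofAdd.injective h0
  have h1 := Multiplicative.ofAdd.injective h1
  have e1 := congrArg Prod.fst h0
  have e2 := congrArg Prod.snd h0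
  have e3 := congrArg Prod.fst h1
  have e4 := congrArg Prod.snd h1
  simp at e1 e2 e3 e4
  rw [← Int.isUnit_iff_natAbs_eq]
  refine IsUnit.of_mul_eq_one (i * j' - j * i') ?_
  linear_combination (-1) * (i' * a.2 + j' * b.2) * e1 + (i' * a.1 + j' * b.1) * e2 - e4

/-- Two generators of the free group of rank two that are, up to conjugation, read off from cycles
of states have total length at most three. -/
theorem add_le_three (h : ∀ v, σ v v = invLetter v) (h' : ∀ v, σ (invLetter v) = (σ v)⁻¹)
    {s t : (Fin 2 × Bool) × (Fin 2 × Bool)} (hs : s.2 ≠ invLetter s.1) (ht : t.2 ≠ invLetter t.1)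
    {k l : ℕ} (hk : (step σ)^[k] s = s) (hl : (step σ)^[l] t = t) (hk0 : 0 < k) (hl0 : 0 < l)
    {x y : FreeGroup (Fin 2)} (hx : IsConj x (FreeGroup.mk (stepWord σ k s)))
    (hy : IsConj y (FreeGroup.mk (stepWord σ l t))) (hxy : Subgroup.closure {x, y} = ⊤) :
    k + l ≤ 3 := by
  obtain ⟨m₀, hm₀, m₁, hm₁, hm⟩ := exists_code h h'
  have hst : ∀ s : (Fin 2 × Bool) × (Fin 2 × Bool), s.2 ≠ invLetter s.1 →
      Prod.map enc enc s ∈ statesCode := by decide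
  have hiter : ∀ (k : ℕ) s, (stepCode (m₀, m₁))^[k] (Prod.map enc enc s)
      = Prod.map enc enc ((step σ)^[k] s) := fun k s =>
    (Function.Semiconj.iterate_right (f := Prod.map enc enc) (fun s => (hm s).symm) k s).symm
  have hinj : Function.Injective (Prod.map enc enc) := enc_injective.prodMap enc_injective
  -- the period of a state is at most six, and a longer word is a power
  have hper : ∀ s : (Fin 2 × Bool) × (Fin 2 × Bool), s.2 ≠ invLetter s.1 →
      ∀ k, (step σ)^[k] s = s → ∃ d m, k = d * m ∧ d ∈ [0, 1, 2, 3, 4, 5, 6] ∧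
        (step σ)^[d] s = s ∧
        abel (FreeGroup.mk (stepWord σ k s)) = abel (FreeGroup.mk (stepWord σ d s)) ^ m := by
    intro s hs k hk
    obtain ⟨m, hm'⟩ : Function.minimalPeriod (step σ) s ∣ k :=
      Function.IsPeriodicPt.minimalPeriod_dvd hk
    refine ⟨Function.minimalPeriod (step σ) s, m, hm', ?_, Function.isPeriodicPt_minimalPeriod _ _,
      ?_⟩
    · obtain ⟨j, hj, hj'⟩ := exists_return m₀ hm₀ m₁ hm₁ _ (hst s hs)
      rw [hiter] at hj'
      have h1 : 0 < j ∧ j ≤ 6 := by simp at hj; omega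
      have h2 := Function.IsPeriodicPt.minimalPeriod_le h1.1 (hinj hj')
      have h3 := h2.trans h1.2
      interval_cases Function.minimalPeriod (step σ) s <;> simp
    · subst hm'
      have hd : (step σ)^[Function.minimalPeriod (step σ) s] s = s :=
        Function.isPeriodicPt_minimalPeriod _ _
      clear hk
      generalize Function.minimalPeriod (step σ) s = d at *
      induction m with
      | zero => simp [stepWord, ← FreeGroup.one_eq_mk]
      | succ m ih =>
        have e : d * (m + 1) = d + d * m := by ring
        rw [e, stepWord_add, hd, ← FreeGroup.mul_mk, map_mul, ih, pow_succ']
  obtain ⟨d, m, rfl, hd, hds, had⟩ := hper s hs k hk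
  obtain ⟨e, n, rfl, he, het, hae⟩ := hper t ht l hl
  have habx : abel x = abel (FreeGroup.mk (stepWord σ d s)) ^ m := by
    rw [← had]; exact isConj_iff_eq.1 (abel.map_isConj hx)
  have haby : abel y = abel (FreeGroup.mk (stepWord σ e t)) ^ n := by
    rw [← hae]; exact isConj_iff_eq.1 (abel.map_isConj hy)
  rw [abel_mk, ← ofAdd_nsmul] at habx haby
  have hdet := natAbs_det_eq_one_of_closure_eq_top hxy habx haby
  set a := abelCode ((stepWord σ d s).map enc) with ha
  set b := abelCode ((stepWord σ e t).map enc) with hb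
  -- A word that runs `m` times through its cycle is divisible by `m` in the abelianization, so
  -- determinant `±1` leaves only simple cycles, which the finite check covers.
  have hdet' : m * n * (a.1 * b.2 - a.2 * b.1).natAbs = 1 := by
    rw [← hdet, ← Int.natAbs_natCast m, ← Int.natAbs_natCast n, ← Int.natAbs_mul,
      ← Int.natAbs_mul]
    congr 1
    simp; ring
  have hmn : m * n = 1 := Nat.eq_one_of_mul_eq_one_right hdet'
  obtain rfl : m = 1 := Nat.eq_one_of_mul_eq_one_right hmn
  obtain rfl : n = 1 := by simpa using hmn
  simp only [mul_one] at *
  have hmem : ∀ s : (Fin 2 × Bool) × (Fin 2 × Bool), s.2 ≠ invLetter s.1 →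
      ∀ d, 0 < d → d ∈ [0, 1, 2, 3, 4, 5, 6] → (step σ)^[d] s = s →
      ∀ z, IsConj z (FreeGroup.mk (stepWord σ d s)) → (∀ b, permHom b z ≠ 1) →
      (d, abelCode ((stepWord σ d s).map enc)) ∈ cyclesCode (m₀, m₁) := by
    intro s hs d hd0 hd hds z hz hzb
    simp only [cyclesCode, List.mem_flatMap, List.mem_filterMap]
    refine ⟨_, hst s hs, d, ?_, ?_⟩
    · simp at hd ⊢; omega
    · rw [if_pos (by rw [hiter, hds]), stepWord_map_enc hm]
      have hk : ∀ b, killedCode b ((stepWord σ d s).map enc) = false := by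
        intro b
        by_contra hb
        rw [Bool.not_eq_false] at hb
        have h1 := permHom_mk_eq_one hb
        have h2 := (permHom b).map_isConj hz
        rw [h1] at h2
        exact hzb b (isConj_one_left.1 h2)
      simp [hk]
  have hkill := fun b => map_ne_one_of_closure_eq_top (permHom b) (permHom_not_commute b) hxy
  have key := pairCode_eq_true
  simp only [List.all_eq_true] at key
  have := key m₀ hm₀ m₁ hm₁ _ (hmem s hs d hk0 hd hds x hx fun b => (hkill b).1) _
    (hmem t ht e hl0 he het y hy fun b => (hkill b).2)
  simp only [pairCode, Bool.or_eq_true, Nat.ble_eq, Bool.not_eq_true', ← ha, ← hb] at this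
  rcases this with h | h
  · exact h
  · rw [one_mul] at hdet'
    rw [hdet'] at h
    simp at h

end Words

end TwoParabolic

end

/-! ### Schottky configurations and parabolic fixed points -/

noncomputable section

namespace TwoParabolic

open OnePoint

namespace Circle

/-- The interior determines the circle. The definition of a T-Schottky group prescribes only the
image of an exterior; this upgrades it to equality of signs everywhere, including on the circles. -/
theorem sign_form_eq_of_interior_eq {C D : Circle} (h : C.interior = D.interior) (p : Sphere) :
    SignType.sign (C.form p) = SignType.sign (D.form p) := by
  have key : ∀ C D : Circle, C.interior = D.interior → C.form p ≤ 0 → D.form p ≤ 0 := by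
    intro C D h hC
    by_contra! hD
    obtain ⟨q, hq, hq'⟩ := exists_mem_interior_of_form_neg C D.flip hC (by simpa using hD)
    have hq : q ∈ D.interior := h ▸ hq
    have hq : D.form q < 0 := hq
    rw [flip_form] at hq'
    linarith
  have hlt : C.form p < 0 ↔ D.form p < 0 := by
    change p ∈ C.interior ↔ p ∈ D.interior
    rw [h]
  have hle : C.form p ≤ 0 ↔ D.form p ≤ 0 := ⟨key C D h, key D C h.symm⟩
  rcases lt_trichotomy (C.form p) 0 with h1 | h1 | h1
  · rw [sign_neg h1, sign_neg (hlt.1 h1)]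
  · have h2 : D.form p = 0 :=
      le_antisymm (hle.1 h1.le) (not_lt.1 fun h' => (hlt.2 h').ne h1)
    rw [h1, h2]
  · rw [sign_pos h1, sign_pos (not_le.1 fun h' => absurd (hle.2 h') (not_le.2 h1))]

namespace IsImage

variable {k : Equiv.Perm Sphere} {C D : Circle}

theorem inv (h : IsImage k C D) : IsImage k⁻¹ D C := by
  intro p
  have := h (k⁻¹ p)
  rw [show k (k⁻¹ p) = p from k.apply_symm_apply p] at this
  exact this.symm

theorem flip (h : IsImage k C D) : IsImage k C.flip D.flip := by
  intro p
  rw [flip_form, flip_form, Left.sign_neg, Left.sign_neg, h p]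

theorem trans {k' : Equiv.Perm Sphere} {E : Circle} (h : IsImage k C D) (h' : IsImage k' D E) :
    IsImage (k' * k) C E := fun p => (h' (k p)).trans (h p)

end IsImage

theorem flip_flip (C : Circle) : C.flip.flip = C := by
  cases C; simp [flip]

theorem IsImage.flip_left {k : Equiv.Perm Sphere} {C D : Circle} (h : IsImage k C.flip D) :
    IsImage k C D.flip := by
  have := h.flip
  rwa [flip_flip] at this

end Circle

/-- The transformations `g i` pair the circles `D (i, false)` and `D (i, true)`, which have pairwise
disjoint interiors. -/
structure IsSchottky {ι : Type*} (g : ι → Equiv.Perm Sphere) (D : ι × Bool → Circle) : Prop where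
  mem : ∀ i, g i ∈ mobius
  disj : ∀ u v, u ≠ v → Disjoint (D u).interior (D v).interior
  image : ∀ v, Circle.IsImage (FreeGroup.lift g (FreeGroup.mk [v])) (D (invLetter v)).flip (D v)

theorem lift_mk_true {ι H : Type*} [Group H] (g : ι → H) (i : ι) :
    FreeGroup.lift g (FreeGroup.mk [(i, true)]) = g i := by simp [FreeGroup.lift_mk]

theorem lift_mk_false {ι H : Type*} [Group H] (g : ι → H) (i : ι) :
    FreeGroup.lift g (FreeGroup.mk [(i, false)]) = (g i)⁻¹ := by simp [FreeGroup.lift_mk]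

theorem isSchottky_of_isImage {ι : Type*} {g : ι → Equiv.Perm Sphere} {D : ι × Bool → Circle}
    (mem : ∀ i, g i ∈ mobius)
    (disj : ∀ u v, u ≠ v → Disjoint (D u).interior (D v).interior)
    (h : ∀ i, Circle.IsImage (g i) (D (i, false)).flip (D (i, true))) : IsSchottky g D := by
  refine ⟨mem, disj, ?_⟩
  rintro ⟨i, b⟩
  cases b
  · rw [lift_mk_false]
    exact (h i).flip_left.inv
  · rw [lift_mk_true]
    exact h i

theorem IsMarkedClassicalTSchottky.exists_isSchottky {n : ℕ} {g : Fin n → Equiv.Perm Sphere}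
    (h : IsMarkedClassicalTSchottky g) : ∃ D, IsSchottky g D := by
  obtain ⟨hmem, C, C', hdisj, hmap⟩ := h
  let e : Fin n × Bool → Fin n ⊕ Fin n := fun v => if v.2 then Sum.inr v.1 else Sum.inl v.1
  have he : Function.Injective e := by
    rintro ⟨i, b⟩ ⟨j, c⟩
    cases b <;> cases c <;> simp [e]
  refine ⟨fun v => Sum.elim C C' (e v), isSchottky_of_isImage hmem
    (fun u v huv => hdisj (he.ne huv)) fun i => ?_⟩
  obtain ⟨E, hE⟩ := Circle.exists_isImage (hmem i) (C i).flip
  intro p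
  change SignType.sign ((C' i).form _) = SignType.sign ((C i).flip.form p)
  rw [← hE p]
  apply Circle.sign_form_eq_of_interior_eq
  rw [hE.interior_eq, Circle.flip_interior, hmap]

namespace IsSchottky

variable {ι : Type*} {g : ι → Equiv.Perm Sphere} {D : ι × Bool → Circle}

theorem lift_mem (h : IsSchottky g D) (x : FreeGroup ι) : FreeGroup.lift g x ∈ mobius := by
  have : (FreeGroup.lift g).range ≤ mobius := by
    rw [FreeGroup.range_lift_eq_closure, Subgroup.closure_le]
    rintro _ ⟨i, rfl⟩
    exact h.mem i
  exact this ⟨x, rfl⟩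

theorem nonpos_of_nonpos (h : IsSchottky g D) {u v : ι × Bool} (huv : u ≠ invLetter v)
    {p : Sphere} (hp : (D u).form p ≤ 0) :
    (D v).form (FreeGroup.lift g (FreeGroup.mk [v]) p) ≤ 0 := by
  rw [(h.image v).nonpos_iff, Circle.flip_form, neg_nonpos]
  exact Circle.form_nonneg_of_disjoint (h.disj _ _ huv) hp

theorem neg_of_neg (h : IsSchottky g D) {u v : ι × Bool} (huv : u ≠ invLetter v)
    {p : Sphere} (hp : (D u).form p < 0) :
    (D v).form (FreeGroup.lift g (FreeGroup.mk [v]) p) < 0 := by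
  rw [(h.image v).neg_iff, Circle.flip_form, neg_lt_zero]
  by_contra! h'
  exact absurd hp (not_lt.2 (Circle.form_nonneg_of_disjoint (h.disj _ _ huv).symm h'))

theorem zero_iff (h : IsSchottky g D) (v : ι × Bool) (p : Sphere) :
    (D v).form (FreeGroup.lift g (FreeGroup.mk [v]) p) = 0 ↔ (D (invLetter v)).form p = 0 := by
  rw [(h.image v).zero_iff, Circle.flip_form, neg_eq_zero]

/-- With at least two generators there is a disc that differs both from that of the first letter and
from that of the inverse of the last letter. The word moves its interior into the disc of the first
letter, so it does not act trivially. -/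
theorem injective [Nontrivial ι] (h : IsSchottky g D) :
    Function.Injective (FreeGroup.lift g) := by
  classical
  rw [injective_iff_map_eq_one]
  intro x hx
  by_contra hne
  have hw : x.toWord ≠ [] := by rwa [ne_eq, FreeGroup.toWord_eq_nil_iff]
  obtain ⟨u, hu1, hu2⟩ := exists_ne_ne (x.toWord.head hw) (invLetter (x.toWord.getLast hw))
  obtain ⟨p, hp⟩ := (D u).interior_nonempty
  have := ping_pong (FreeGroup.lift g) (fun v => (D v).interior)
    (fun v u huv p hp => h.neg_of_neg huv hp) x.toWord hw FreeGroup.isReduced_toWord p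
    (h.neg_of_neg hu2 hp)
  rw [FreeGroup.mk_toWord, hx] at this
  exact Set.disjoint_left.1 (h.disj _ _ hu1) hp this

/-- Conjugation of a Schottky configuration. -/
theorem exists_conj (h : IsSchottky g D) {k : Equiv.Perm Sphere} (hk : k ∈ mobius) :
    ∃ D', IsSchottky (fun i => k * g i * k⁻¹) D' ∧ ∀ v, Circle.IsImage k (D v) (D' v) := by
  choose D' hD' using fun v => Circle.exists_isImage hk (D v)
  refine ⟨D', isSchottky_of_isImage
    (fun i => mobius.mul_mem (mobius.mul_mem hk (h.mem i)) (mobius.inv_mem hk)) ?_ ?_, hD'⟩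
  · intro u v huv
    rw [(hD' u).interior_eq, (hD' v).interior_eq, Set.disjoint_image_iff k.injective]
    exact h.disj u v huv
  · intro i
    have := h.image (i, true)
    rw [lift_mk_true] at this
    exact (hD' (i, false)).flip.inv.trans (this.trans (hD' (i, true)))

section Tangency

variable {l : List (ι × Bool)} {p : Sphere}

/-- Cyclic reduction lets the last letter act on the closed disc of the first one, so ping-pong maps
that closed disc into itself, and it contains the parabolic fixed point. -/
theorem form_head_nonpos (h : IsSchottky g D) (hl : FreeGroup.IsCyclicallyReduced l) (hne : l ≠ [])
    (hp : IsParabolicAt (FreeGroup.lift g (FreeGroup.mk l)) p) :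
    (D (l.head hne)).form p ≤ 0 := by
  refine hp.form_nonpos fun q hq => ?_
  refine ping_pong (FreeGroup.lift g) (fun v => {p | (D v).form p ≤ 0})
    (fun v u huv p hp => h.nonpos_of_nonpos huv hp) l hne hl.1 q ?_
  refine h.nonpos_of_nonpos ?_ hq
  rw [ne_invLetter_iff]
  exact hl.2 _ (List.getLast?_eq_getLast_of_ne_nil hne) _ (List.head?_eq_some_head hne)

/-- The fixed point of a parabolic element given by a cyclically reduced word is a point of tangency
of two of the circles. -/
theorem form_eq_zero (h : IsSchottky g D) (hl : FreeGroup.IsCyclicallyReduced l) (hne : l ≠ [])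
    (hp : IsParabolicAt (FreeGroup.lift g (FreeGroup.mk l)) p) :
    l.head hne ≠ invLetter (l.getLast hne) ∧
      (D (l.head hne)).form p = 0 ∧ (D (invLetter (l.getLast hne))).form p = 0 := by
  have hhl : l.head hne ≠ invLetter (l.getLast hne) := by
    rw [ne_invLetter_iff]
    exact hl.2 _ (List.getLast?_eq_getLast_of_ne_nil hne) _ (List.head?_eq_some_head hne)
  refine ⟨hhl, Circle.form_eq_zero_of_disjoint (h.disj _ _ hhl) (h.form_head_nonpos hl hne hp) ?_⟩
  -- The inverse word has the same fixed point and begins with the inverse of the last letter. The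
  -- point thus lies in two closed discs with disjoint interiors.
  have hne' : FreeGroup.invRev l ≠ [] := by
    intro h'
    apply hne
    have := congrArg List.length h'
    rw [FreeGroup.invRev_length] at this
    exact List.length_eq_zero_iff.1 this
  have hhead : (FreeGroup.invRev l).head hne' = invLetter (l.getLast hne) := by
    simp [FreeGroup.invRev, invLetter]
  rw [← hhead]
  refine h.form_head_nonpos ?_ hne' ?_
  · rw [FreeGroup.IsCyclicallyReduced]
    refine ⟨?_, ?_⟩
    · classical
      rw [FreeGroup.isReduced_iff_reduce_eq, FreeGroup.reduce_invRev, hl.1.reduce_eq]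
    · intro a ha b hb hab
      rw [FreeGroup.invRev, List.getLast?_reverse, List.head?_map] at ha
      rw [FreeGroup.invRev, List.head?_reverse, List.getLast?_map] at hb
      simp only [Option.mem_def, Option.map_eq_some_iff] at ha hb
      obtain ⟨a', ha', rfl⟩ := ha
      obtain ⟨b', hb', rfl⟩ := hb
      have := hl.2 b' hb' a' ha' hab.symm
      simp [this]
  · rw [← FreeGroup.inv_mk, map_inv]
    exact hp.inv

theorem isCyclicallyReduced_rotate {v : ι × Bool} {l : List (ι × Bool)}
    (hl : FreeGroup.IsCyclicallyReduced (v :: l)) : FreeGroup.IsCyclicallyReduced (l ++ [v]) := by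
  rcases List.eq_nil_or_concat l with rfl | ⟨l', w, rfl⟩
  · simp
  · obtain ⟨h1, h2⟩ := hl
    simp only [List.concat_eq_append] at *
    rw [FreeGroup.IsReduced, List.isChain_cons] at h1
    refine ⟨?_, ?_⟩
    · rw [FreeGroup.IsReduced, List.isChain_append]
      refine ⟨h1.2, by simp, ?_⟩
      intro a ha b hb
      exact h2 a (by
        rw [← List.cons_append, List.getLast?_concat]; simpa using ha) b (by simpa using hb)
    · intro a ha b hb
      have ha : v = a := by simpa using ha
      subst ha
      apply h1.1
      rcases l' with _ | ⟨c, l'⟩ <;> simpa using hb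

theorem isParabolicAt_rotate {v : ι × Bool} {l : List (ι × Bool)} (h : IsSchottky g D)
    (hp : IsParabolicAt (FreeGroup.lift g (FreeGroup.mk (v :: l))) p) :
    IsParabolicAt (FreeGroup.lift g (FreeGroup.mk (l ++ [v])))
      ((FreeGroup.lift g (FreeGroup.mk [v]))⁻¹ p) := by
  have := hp.conjugate (mobius.inv_mem (h.lift_mem (FreeGroup.mk [v])))
  convert this using 1
  rw [← map_inv, ← map_inv, ← map_mul, ← map_mul, mk_cons v l,
    show FreeGroup.mk (l ++ [v]) = FreeGroup.mk l * FreeGroup.mk [v] from FreeGroup.mul_mk.symm]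
  congr 1
  group

end Tangency

end IsSchottky

end TwoParabolic

end

/-! ### The evolution of points of tangency along a word -/

noncomputable section

namespace TwoParabolic

open OnePoint

/-- A partial injection of a finite type extends to a permutation. -/
theorem exists_perm_of_injective_rel {α : Type*} [Finite α] (r : α → α → Prop)
    (h1 : ∀ u w w', r u w → r u w' → w = w') (h2 : ∀ u u' w, r u w → r u' w → u = u') :
    ∃ σ : Equiv.Perm α, ∀ u w, r u w → σ u = w := by
  classical
  cases nonempty_fintype α
  let f : α → α := fun u => if h : ∃ w, r u w then h.choose else u
  have hf : ∀ u w, r u w → f u = w := by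
    intro u w h
    have hex : ∃ w, r u w := ⟨w, h⟩
    simp only [f, dif_pos hex]
    exact h1 u _ _ hex.choose_spec h
  obtain ⟨e, he⟩ := Set.MapsTo.exists_equiv_extend_of_card_eq (t := (Finset.univ : Finset α))
    Finset.card_univ.symm (s := {u | ∃ w, r u w}) (f := f) (fun _ _ => Finset.mem_coe.2 (Finset.mem_univ _)) (by
      rintro u ⟨w, hw⟩ u' ⟨w', hw'⟩ h
      rw [hf u w hw, hf u' w' hw'] at h
      subst h
      exact h2 u u' w hw hw')
  refine ⟨e.trans (Equiv.subtypeUnivEquiv Finset.mem_univ), fun u w h => ?_⟩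
  have := he u ⟨w, h⟩
  rw [hf u w h] at this
  exact this

namespace IsSchottky

section Relation

variable {ι : Type*} {g : ι → Equiv.Perm Sphere} {D : ι × Bool → Circle}

/-- The letter `v` takes the point of tangency of `D w` and `D v⁻¹` to that of `D v` and `D u`. -/
def Tangent (g : ι → Equiv.Perm Sphere) (D : ι × Bool → Circle) (v u w : ι × Bool) : Prop :=
  u ≠ v ∧ w ≠ invLetter v ∧ ∃ p, (D u).form p = 0 ∧ (D v).form p = 0 ∧
    (D w).form ((FreeGroup.lift g (FreeGroup.mk [v]))⁻¹ p) = 0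

theorem eq_of_tangent [Nontrivial ι] (h : IsSchottky g D) {u v : ι × Bool} (huv : u ≠ v)
    {p q : Sphere} (h1 : (D u).form p = 0) (h2 : (D v).form p = 0) (h3 : (D u).form q = 0)
    (h4 : (D v).form q = 0) : p = q := by
  obtain ⟨w, hw1, hw2⟩ := exists_ne_ne u v
  exact Circle.eq_of_common_of_disjoint (h.disj u v huv) (h.disj u w hw1.symm)
    (h.disj v w hw2.symm) h1 h2 h3 h4

theorem Tangent.symm (h : IsSchottky g D) {v u w : ι × Bool} (ht : Tangent g D v u w) :
    Tangent g D (invLetter v) w u := by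
  obtain ⟨h1, h2, p, hp1, hp2, hp3⟩ := ht
  refine ⟨h2, by simpa using h1, (FreeGroup.lift g (FreeGroup.mk [v]))⁻¹ p, hp3, ?_, ?_⟩
  · rw [← h.zero_iff]
    simpa using hp2
  · rw [mk_invLetter, map_inv, inv_inv]
    simpa using hp1

/-- Two of the circles have only one common point, so `u` and `v` determine `p`. The preimage of `p`
lies on the circle of `v⁻¹`, and at most one further circle can pass through it. -/
theorem Tangent.right_unique [Nontrivial ι] (h : IsSchottky g D) {v u w w' : ι × Bool}
    (ht : Tangent g D v u w) (ht' : Tangent g D v u w') : w = w' := by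
  obtain ⟨h1, h2', p', hp1', hp2', hp3'⟩ := ht'
  obtain ⟨-, h2, p, hp1, hp2, hp3⟩ := ht
  obtain rfl := h.eq_of_tangent h1 hp1 hp2 hp1' hp2'
  by_contra hne
  refine Circle.not_common_of_disjoint (h.disj _ _ hne) (h.disj _ (invLetter v) h2)
    (h.disj _ (invLetter v) h2') hp3 hp3' ?_
  rw [← h.zero_iff]
  simpa using hp2

/-- Tangency is a partial injection with `u ≠ v` and `w ≠ v⁻¹`, so the pair `(v, v⁻¹)` can be added
before extending to a permutation. That pair makes the reduced states invariant. Only positive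
letters need a choice, by `Tangent.symm`; inverse letters receive the inverse permutation. -/
theorem exists_perms [Finite ι] [Nontrivial ι] (h : IsSchottky g D) :
    ∃ σ : ι × Bool → Equiv.Perm (ι × Bool), (∀ v, σ v v = invLetter v) ∧
      (∀ v, σ (invLetter v) = (σ v)⁻¹) ∧ ∀ v u w, Tangent g D v u w → σ v u = w := by
  have key : ∀ i : ι, ∃ σ : Equiv.Perm (ι × Bool), ∀ u w,
      (Tangent g D (i, true) u w ∨ (u = (i, true) ∧ w = invLetter (i, true))) → σ u = w := by
    intro i
    apply exists_perm_of_injective_rel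
    · rintro u w w' (h1 | ⟨h1, h2⟩) (h1' | ⟨h1', h2'⟩)
      · exact h1.right_unique h h1'
      · exact absurd h1' h1.1
      · exact absurd h1 h1'.1
      · rw [h2, h2']
    · rintro u u' w (h1 | ⟨h1, h2⟩) (h1' | ⟨h1', h2'⟩)
      · exact (h1.symm h).right_unique h (h1'.symm h)
      · exact absurd h2' h1.2.1
      · exact absurd h2 h1'.2.1
      · rw [h1, h1']
  choose τ hτ using key
  have e0 : ∀ i, τ i (i, true) = (i, false) := fun i => hτ i _ _ (Or.inr ⟨rfl, rfl⟩)
  refine ⟨fun v => if v.2 then τ v.1 else (τ v.1)⁻¹, ?_, ?_, ?_⟩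
  · rintro ⟨i, b⟩
    cases b
    · simp only [Bool.false_eq_true, if_false, Equiv.Perm.inv_eq_iff_eq]
      exact (e0 i).symm
    · exact e0 i
  · rintro ⟨i, b⟩
    cases b <;> simp [invLetter]
  · rintro ⟨i, b⟩ u w ht
    cases b
    · simp only [Bool.false_eq_true, if_false, Equiv.Perm.inv_eq_iff_eq]
      exact (hτ i w u (Or.inl (ht.symm h))).symm
    · exact hτ i u w (Or.inl ht)

theorem isCyclicallyReduced_rotate_nat {l : List (ι × Bool)} (h : IsSchottky g D) (hne : l ≠ [])
    (hl : FreeGroup.IsCyclicallyReduced l) {p : Sphere}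
    (hp : IsParabolicAt (FreeGroup.lift g (FreeGroup.mk l)) p) (i : ℕ) :
    FreeGroup.IsCyclicallyReduced (l.rotate i) ∧
      ∃ q, IsParabolicAt (FreeGroup.lift g (FreeGroup.mk (l.rotate i))) q := by
  induction i with
  | zero => simpa using ⟨hl, p, hp⟩
  | succ i ih =>
    obtain ⟨h1, q, h2⟩ := ih
    rw [← List.rotate_rotate]
    rcases hw : l.rotate i with _ | ⟨v, l'⟩
    · rw [List.rotate_eq_nil_iff] at hw
      exact absurd hw hne
    · rw [hw] at h1 h2
      rw [List.rotate_cons_succ, List.rotate_zero]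
      exact ⟨isCyclicallyReduced_rotate h1, _, h.isParabolicAt_rotate h2⟩

/-- Each rotation of the word is again parabolic and cyclically reduced, so its fixed point is a
point of tangency of the circles of its first letter and of its inverted last letter. Rotating by
one letter moves the fixed point by the inverse of that letter. -/
theorem tangent_of_parabolic {l : List (ι × Bool)} (h : IsSchottky g D) (hne : l ≠ [])
    (hl : FreeGroup.IsCyclicallyReduced l) {p : Sphere}
    (hp : IsParabolicAt (FreeGroup.lift g (FreeGroup.mk l)) p) (i : ℕ) :
    Tangent g D (l[(i + 1) % l.length]'(Nat.mod_lt _ (List.length_pos_iff.2 hne)))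
      (invLetter (l[i % l.length]'(Nat.mod_lt _ (List.length_pos_iff.2 hne))))
      (l[(i + 2) % l.length]'(Nat.mod_lt _ (List.length_pos_iff.2 hne))) := by
  have hlen := List.length_pos_iff.2 hne
  have hne' : ∀ j, l.rotate j ≠ [] := fun j => by rwa [ne_eq, List.rotate_eq_nil_iff]
  have hhead : ∀ j, (l.rotate j).head (hne' j) = l[j % l.length]'(Nat.mod_lt _ hlen) := by
    intro j
    rw [List.head_eq_getElem, List.getElem_rotate]
    simp
  have hlast : ∀ j, (l.rotate (j + 1)).getLast (hne' _) = l[j % l.length]'(Nat.mod_lt _ hlen) := by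
    intro j
    rw [List.getLast_eq_getElem, List.getElem_rotate]
    congr 1
    rw [List.length_rotate, show l.length - 1 + (j + 1) = j + l.length by omega,
      Nat.add_mod_right]
  obtain ⟨h1, q, h2⟩ := h.isCyclicallyReduced_rotate_nat hne hl hp (i + 1)
  obtain ⟨a1, a2, a3⟩ := h.form_eq_zero h1 (hne' _) h2
  rw [hhead, hlast] at a1
  rw [hhead] at a2
  rw [hlast] at a3
  have h1' := (h.isCyclicallyReduced_rotate_nat hne hl hp (i + 1 + 1)).1
  have h2' : IsParabolicAt (FreeGroup.lift g (FreeGroup.mk (l.rotate (i + 1 + 1))))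
      ((FreeGroup.lift g (FreeGroup.mk [l[(i + 1) % l.length]'(Nat.mod_lt _ hlen)]))⁻¹ q) := by
    rw [← hhead, ← List.rotate_rotate l (i + 1) 1]
    have key : ∀ (m : List (ι × Bool)) (hm : m ≠ []),
        IsParabolicAt (FreeGroup.lift g (FreeGroup.mk m)) q →
        IsParabolicAt (FreeGroup.lift g (FreeGroup.mk (m.rotate 1)))
          ((FreeGroup.lift g (FreeGroup.mk [m.head hm]))⁻¹ q) := by
      intro m hm hq
      rcases m with _ | ⟨v, m⟩
      · exact absurd rfl hm
      · simpa using h.isParabolicAt_rotate hq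
    exact key _ _ h2
  obtain ⟨b1, b2, b3⟩ := h.form_eq_zero h1' (hne' _) h2'
  rw [hhead, hlast] at b1
  rw [hhead] at b2
  exact ⟨a1.symm, b1, q, a3, a2, b2⟩

end Relation

section RankTwo

variable {g : Fin 2 → Equiv.Perm Sphere} {D : Fin 2 × Bool → Circle}

theorem exists_cycle (h : IsSchottky g D) {σ : Fin 2 × Bool → Equiv.Perm (Fin 2 × Bool)}
    (hσ : ∀ v u w, Tangent g D v u w → σ v u = w) {l : List (Fin 2 × Bool)} (hne : l ≠ [])
    (hl : FreeGroup.IsCyclicallyReduced l) {p : Sphere}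
    (hp : IsParabolicAt (FreeGroup.lift g (FreeGroup.mk l)) p) :
    ∃ s : (Fin 2 × Bool) × (Fin 2 × Bool), s.2 ≠ invLetter s.1 ∧
      (step σ)^[l.length] s = s ∧ stepWord σ l.length s = l := by
  have hlen := List.length_pos_iff.2 hne
  set x : ℕ → Fin 2 × Bool := fun i => l[i % l.length]'(Nat.mod_lt _ hlen) with hx
  have ht : ∀ i, Tangent g D (x (i + 1)) (invLetter (x i)) (x (i + 2)) :=
    fun i => h.tangent_of_parabolic hne hl hp i
  have hstep : ∀ i, step σ (x i, x (i + 1)) = (x (i + 1), x (i + 2)) := fun i => by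
    simp only [step, hσ _ _ _ (ht i)]
  have hiter : ∀ i j, (step σ)^[i] (x j, x (j + 1)) = (x (j + i), x (j + i + 1)) := by
    intro i
    induction i with
    | zero => intro j; rfl
    | succ i ih =>
      intro j
      rw [Function.iterate_succ_apply, hstep, ih]
      congr 2 <;> omega
  have hword : ∀ k j, stepWord σ k (x j, x (j + 1)) = (List.range k).map fun i => x (j + i) := by
    intro k
    induction k with
    | zero => intro j; rfl
    | succ k ih =>
      intro j
      rw [stepWord, hstep, ih, List.range_succ_eq_map, List.map_cons, List.map_map]
      congr 1
      apply List.map_congr_left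
      intro i _
      simp only [Function.comp_apply]
      congr 1; omega
  refine ⟨(x 0, x 1), ?_, ?_, ?_⟩
  · exact ((ht 0).1).symm
  · rw [hiter l.length 0]
    simp [hx]
  · rw [hword l.length 0]
    apply List.ext_getElem
    · simp
    · intro i h1 h2
      simp [hx, Nat.mod_eq_of_lt h2]

theorem exists_cyclicallyReduced {ι : Type*} (s : FreeGroup ι) :
    ∃ l, FreeGroup.IsCyclicallyReduced l ∧ ∃ c, s = c * FreeGroup.mk l * c⁻¹ := by
  classical
  refine ⟨FreeGroup.reduceCyclically s.toWord,
    FreeGroup.reduceCyclically.isCyclicallyReduced FreeGroup.isReduced_toWord,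
    FreeGroup.mk (FreeGroup.reduceCyclically.conjugator s.toWord), ?_⟩
  rw [FreeGroup.inv_mk, FreeGroup.mul_mk, FreeGroup.mul_mk,
    FreeGroup.reduceCyclically.conj_conjugator_reduceCyclically, FreeGroup.mk_toWord]

/-- The cyclically reduced words of two parabolic generators of a Schottky group of rank two. -/
theorem exists_words (h : IsSchottky g D) {s t : FreeGroup (Fin 2)}
    (hst : Subgroup.closure {s, t} = ⊤) {p q : Sphere}
    (hs : IsParabolicAt (FreeGroup.lift g s) p) (ht : IsParabolicAt (FreeGroup.lift g t) q) :
    ∃ l m : List (Fin 2 × Bool), l ≠ [] ∧ m ≠ [] ∧ l.length + m.length ≤ 3 ∧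
      IsConj s (FreeGroup.mk l) ∧ IsConj t (FreeGroup.mk m) := by
  obtain ⟨σ, h1, h2, h3⟩ := h.exists_perms
  have key : ∀ s : FreeGroup (Fin 2), ∀ p, IsParabolicAt (FreeGroup.lift g s) p →
      ∃ l : List (Fin 2 × Bool), l ≠ [] ∧ IsConj s (FreeGroup.mk l) ∧
        ∃ a : (Fin 2 × Bool) × (Fin 2 × Bool), a.2 ≠ invLetter a.1 ∧
          (step σ)^[l.length] a = a ∧ stepWord σ l.length a = l := by
    intro s p hs
    obtain ⟨l, hl, c, hc⟩ := exists_cyclicallyReduced s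
    have hne : l ≠ [] := by
      rintro rfl
      rw [← FreeGroup.one_eq_mk, mul_one, mul_inv_cancel] at hc
      rw [hc, map_one] at hs
      have h1 := (hs.apply_eq_iff ∞).1 rfl
      have h2 := (hs.apply_eq_iff ((0 : ℂ) : Sphere)).1 rfl
      exact OnePoint.coe_ne_infty _ (h2.trans h1.symm)
    refine ⟨l, hne, (isConj_iff.2 ⟨c, hc.symm⟩).symm, h.exists_cycle h3 hne hl
      (p := (FreeGroup.lift g c)⁻¹ p) ?_⟩
    have := hs.conjugate (mobius.inv_mem (h.lift_mem c))
    convert this using 1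
    rw [hc, map_mul, map_mul, map_inv]
    group
  obtain ⟨l, hl, hsl, a, ha1, ha2, ha3⟩ := key s p hs
  obtain ⟨m, hm, htm, b, hb1, hb2, hb3⟩ := key t q ht
  refine ⟨l, m, hl, hm, ?_, hsl, htm⟩
  exact add_le_three h1 h2 ha1 hb1 ha2 hb2 (List.length_pos_iff.2 hl) (List.length_pos_iff.2 hm)
    (by rwa [ha3]) (by rwa [hb3]) hst

end RankTwo

end IsSchottky

end TwoParabolic

end

/-! ### Normal form of two parabolic generators -/

noncomputable section

namespace TwoParabolic

open OnePoint

/-- The inverse of `w` if `b` is `false`, and `w` otherwise. -/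
def signed {H : Type*} [Group H] (b : Bool) (w : H) : H := if b then w else w⁻¹

/-- A Nielsen substitution; `f'` is its inverse. -/
theorem lift_bijective {u v : Fin 2 × Bool} (huv : u.1 ≠ v.1) (e : ℤ) :
    Function.Bijective (FreeGroup.lift ![FreeGroup.mk [u], FreeGroup.mk [u] ^ e * FreeGroup.mk [v]] :
      FreeGroup (Fin 2) →* FreeGroup (Fin 2)) := by
  let x : FreeGroup (Fin 2) := FreeGroup.of 0
  let y : FreeGroup (Fin 2) := FreeGroup.of 1
  let f : FreeGroup (Fin 2) →* FreeGroup (Fin 2) :=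
    FreeGroup.lift ![FreeGroup.mk [u], FreeGroup.mk [u] ^ e * FreeGroup.mk [v]]
  let f' : FreeGroup (Fin 2) →* FreeGroup (Fin 2) :=
    FreeGroup.lift fun i => if i = u.1 then signed u.2 x else signed v.2 (x ^ (-e) * y)
  have hu : f' (FreeGroup.mk [u]) = x := by
    obtain ⟨i, b⟩ := u
    cases b
    · simp only [f', lift_mk_false, signed]; simp
    · simp only [f', lift_mk_true, signed]; simp
  have hv : f' (FreeGroup.mk [v]) = x ^ (-e) * y := by
    obtain ⟨i, b⟩ := v
    cases b
    · simp only [f', lift_mk_false, signed, if_neg (Ne.symm huv)]; simp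
    · simp only [f', lift_mk_true, signed, if_neg (Ne.symm huv)]; simp
  have hfx : f x = FreeGroup.mk [u] := by simp [f, x]
  have hfy : f y = FreeGroup.mk [u] ^ e * FreeGroup.mk [v] := by simp [f, y]
  have h1 : f'.comp f = MonoidHom.id _ := by
    ext i
    fin_cases i
    · change f' (f x) = x
      rw [hfx, hu]
    · change f' (f y) = y
      rw [hfy, map_mul, map_zpow, hu, hv]; group
  have hff' : ∀ w, f (f' (FreeGroup.mk [w])) = FreeGroup.mk [w] →
      f (f' (FreeGroup.of w.1)) = FreeGroup.of w.1 := by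
    rintro ⟨i, b⟩ hw
    cases b
    · have e : FreeGroup.mk [(i, false)] = (FreeGroup.of i)⁻¹ := rfl
      rw [e, map_inv, map_inv, inv_inj] at hw
      exact hw
    · exact hw
  have h2 : f.comp f' = MonoidHom.id _ := by
    have a1 := hff' u (by rw [hu, hfx])
    have a2 := hff' v (by rw [hv, map_mul, map_zpow, hfx, hfy]; group)
    ext i
    by_cases hi : i = u.1
    · rw [hi]; exact a1
    · have : i = v.1 := by omega
      rw [this]; exact a2
  exact ⟨Function.LeftInverse.injective (g := f') fun z => DFunLike.congr_fun h1 z,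
    Function.RightInverse.surjective (g := f') fun z => DFunLike.congr_fun h2 z⟩

theorem exists_conj_of_isConj {u v : Fin 2 × Bool} (huv : u.1 ≠ v.1) (e : ℤ)
    {s t : FreeGroup (Fin 2)} (hst : Subgroup.closure {s, t} = ⊤)
    (hs : IsConj s (FreeGroup.mk [u])) (ht : IsConj t (FreeGroup.mk [u] ^ e * FreeGroup.mk [v])) :
    ∃ c, s = c * FreeGroup.mk [u] * c⁻¹ ∧
      t = c * (FreeGroup.mk [u] ^ e * FreeGroup.mk [v]) * c⁻¹ := by
  obtain ⟨a, rfl⟩ := isConj_iff.1 hs.symm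
  obtain ⟨b, rfl⟩ := isConj_iff.1 ht.symm
  have := exists_simultaneous_conj (lift_bijective huv e) (u := a) (v := b)
    (by simpa using hst)
  simpa using this

theorem eq_or_eq_invLetter {ι : Type*} {u v : ι × Bool} (h : u.1 = v.1) :
    v = u ∨ v = invLetter u := by
  by_contra! h'
  exact h'.1 (Prod.ext h.symm (ne_invLetter_iff.1 h'.2 h).symm)

theorem index_ne_of_det : ∀ u v : Fin 2 × Bool,
    ((abelCode ([u].map enc)).1 * (abelCode ([v].map enc)).2
      - (abelCode ([u].map enc)).2 * (abelCode ([v].map enc)).1).natAbs = 1 → u.1 ≠ v.1 := by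
  decide

theorem index_ne_of_det' : ∀ u v w : Fin 2 × Bool,
    ((abelCode ([u].map enc)).1 * (abelCode ([v, w].map enc)).2
      - (abelCode ([u].map enc)).2 * (abelCode ([v, w].map enc)).1).natAbs = 1 →
      (u.1 = v.1 ∧ u.1 ≠ w.1) ∨ (u.1 = w.1 ∧ u.1 ≠ v.1) := by
  decide

namespace IsSchottky

variable {g : Fin 2 → Equiv.Perm Sphere} {D : Fin 2 × Bool → Circle}

/-- Determinant `±1` forces exactly one letter of the index other than that of `u` to occur in `m`.
A second letter is therefore `u` or `u⁻¹`, and a cyclic rotation puts it in front. -/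
theorem exists_conj_of_short {s t : FreeGroup (Fin 2)} (hst : Subgroup.closure {s, t} = ⊤)
    {u : Fin 2 × Bool} {m : List (Fin 2 × Bool)} (hm : m.length = 1 ∨ m.length = 2)
    (hs : IsConj s (FreeGroup.mk [u])) (ht : IsConj t (FreeGroup.mk m)) :
    ∃ c v, u.1 ≠ v.1 ∧ s = c * FreeGroup.mk [u] * c⁻¹ ∧
      ∃ e : ℤ, (e = 0 ∨ e = 1 ∨ e = -1) ∧
        t = c * (FreeGroup.mk [u] ^ e * FreeGroup.mk [v]) * c⁻¹ := by
  have key : ∀ v (e : ℤ), u.1 ≠ v.1 → (e = 0 ∨ e = 1 ∨ e = -1) →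
      IsConj t (FreeGroup.mk [u] ^ e * FreeGroup.mk [v]) →
      ∃ c v, u.1 ≠ v.1 ∧ s = c * FreeGroup.mk [u] * c⁻¹ ∧
      ∃ e : ℤ, (e = 0 ∨ e = 1 ∨ e = -1) ∧
        t = c * (FreeGroup.mk [u] ^ e * FreeGroup.mk [v]) * c⁻¹ := by
    intro v e hv he ht
    obtain ⟨c, h1, h2⟩ := exists_conj_of_isConj hv e hst hs ht
    exact ⟨c, v, hv, h1, e, he, h2⟩
  have hdet := natAbs_det_eq_one_of_closure_eq_top hst
    ((isConj_iff_eq.1 (abel.map_isConj hs)).trans (abel_mk [u]))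
    ((isConj_iff_eq.1 (abel.map_isConj ht)).trans (abel_mk m))
  have hpair : ∀ v w, u.1 = v.1 → u.1 ≠ w.1 → IsConj t (FreeGroup.mk [v, w]) →
      ∃ c v, u.1 ≠ v.1 ∧ s = c * FreeGroup.mk [u] * c⁻¹ ∧
      ∃ e : ℤ, (e = 0 ∨ e = 1 ∨ e = -1) ∧
        t = c * (FreeGroup.mk [u] ^ e * FreeGroup.mk [v]) * c⁻¹ := by
    intro v w hv hw h
    rw [mk_cons] at h
    rcases eq_or_eq_invLetter hv with rfl | rfl
    · exact key w 1 hw (by simp) (by simpa using h)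
    · exact key w (-1) hw (by simp) (by rw [mk_invLetter] at h; simpa using h)
  rcases hm with hm | hm
  · obtain ⟨v, rfl⟩ := List.length_eq_one_iff.1 hm
    exact key v 0 (index_ne_of_det _ _ hdet) (by simp) (by simpa using ht)
  · obtain ⟨v, w, rfl⟩ := List.length_eq_two.1 hm
    rcases index_ne_of_det' _ _ _ hdet with ⟨h1, h2⟩ | ⟨h1, h2⟩
    · exact hpair v w h1 h2 ht
    · refine hpair w v h1 h2 (ht.trans ?_)
      rw [mk_cons v [w], mk_cons w [v]]
      exact isConj_iff.2 ⟨(FreeGroup.mk [v])⁻¹, by group⟩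

/-- Two parabolic generators of a Schottky group of rank two are simultaneously conjugate to one of
the Schottky generators and to the other one, possibly multiplied by the first one. -/
theorem exists_normal_form (h : IsSchottky g D) {s t : FreeGroup (Fin 2)}
    (hst : Subgroup.closure {s, t} = ⊤) {p q : Sphere}
    (hs : IsParabolicAt (FreeGroup.lift g s) p) (ht : IsParabolicAt (FreeGroup.lift g t) q) :
    ∃ c u v, u.1 ≠ v.1 ∧ ∃ e : ℤ, (e = 0 ∨ e = 1 ∨ e = -1) ∧
      ((s = c * FreeGroup.mk [u] * c⁻¹ ∧
          t = c * (FreeGroup.mk [u] ^ e * FreeGroup.mk [v]) * c⁻¹) ∨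
        (t = c * FreeGroup.mk [u] * c⁻¹ ∧
          s = c * (FreeGroup.mk [u] ^ e * FreeGroup.mk [v]) * c⁻¹)) := by
  obtain ⟨l, m, hl, hm, hlm, hsl, htm⟩ := h.exists_words hst hs ht
  have hl := List.length_pos_iff.2 hl
  have hm := List.length_pos_iff.2 hm
  rcases Nat.lt_or_ge 1 l.length with h1 | h1
  · have h2 : m.length = 1 := by omega
    obtain ⟨u, rfl⟩ := List.length_eq_one_iff.1 h2
    obtain ⟨c, v, hv, h3, e, he, h4⟩ :=
      exists_conj_of_short (by rwa [Set.pair_comm] at hst) (Or.inr (by omega)) htm hsl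
    exact ⟨c, u, v, hv, e, he, Or.inr ⟨h3, h4⟩⟩
  · have h2 : l.length = 1 := by omega
    obtain ⟨u, rfl⟩ := List.length_eq_one_iff.1 h2
    obtain ⟨c, v, hv, h3, e, he, h4⟩ := exists_conj_of_short hst (m := m) (by omega) hsl htm
    exact ⟨c, u, v, hv, e, he, Or.inl ⟨h3, h4⟩⟩

theorem exists_generators {ι : Type*} {g : ι → Equiv.Perm Sphere}
    (hinj : Function.Injective (FreeGroup.lift g)) {a b : Equiv.Perm Sphere}
    (h : Subgroup.closure (Set.range g) = Subgroup.closure {a, b}) :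
    ∃ s t, FreeGroup.lift g s = a ∧ FreeGroup.lift g t = b ∧ Subgroup.closure {s, t} = ⊤ := by
  have hr : (FreeGroup.lift g).range = Subgroup.closure {a, b} := by
    rw [FreeGroup.range_lift_eq_closure, h]
  obtain ⟨s, hs⟩ : a ∈ (FreeGroup.lift g).range := by
    rw [hr]; exact Subgroup.subset_closure (by simp)
  obtain ⟨t, ht⟩ : b ∈ (FreeGroup.lift g).range := by
    rw [hr]; exact Subgroup.subset_closure (by simp)
  refine ⟨s, t, hs, ht, ?_⟩
  apply Subgroup.map_injective hinj
  rw [MonoidHom.map_closure, Set.image_pair, hs, ht, ← hr, MonoidHom.range_eq_map]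

end IsSchottky

theorem S_mul_T_ne {lam : ℂ} (hl : lam ≠ 0) : S * T lam ≠ T lam * S := by
  intro h
  have := congrArg (fun f : Equiv.Perm Sphere => f ∞) h
  simp only [Equiv.Perm.mul_apply, T_infty, S_infty, T_coe, OnePoint.coe_eq_coe] at this
  apply hl
  linear_combination -this / 2

/-- The images of two generators span the rational abelianization, of dimension `n`. -/
theorem card_le_two_of_closure_eq_top {n : ℕ} {s t : FreeGroup (Fin n)}
    (h : Subgroup.closure {s, t} = ⊤) : n ≤ 2 := by
  let f : FreeGroup (Fin n) →* Multiplicative (Fin n → ℚ) :=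
    FreeGroup.lift fun i => Multiplicative.ofAdd (Pi.single i 1)
  set a : Fin 2 → (Fin n → ℚ) := ![Multiplicative.toAdd (f s), Multiplicative.toAdd (f t)] with ha
  have hz : ∀ z, Multiplicative.toAdd (f z) ∈ Submodule.span ℚ (Set.range a) := by
    intro z
    have hz : z ∈ Subgroup.closure {s, t} := by rw [h]; trivial
    induction hz using Subgroup.closure_induction with
    | mem z hz =>
      rcases hz with rfl | rfl
      · exact Submodule.subset_span ⟨0, rfl⟩
      · exact Submodule.subset_span ⟨1, rfl⟩
    | one => rw [map_one]; exact zero_mem _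
    | mul p q _ _ hp hq => rw [map_mul]; exact add_mem hp hq
    | inv p _ hp => rw [map_inv]; exact neg_mem hp
  have htop : Submodule.span ℚ (Set.range a) = ⊤ := by
    rw [eq_top_iff, ← (Pi.basisFun ℚ (Fin n)).span_eq, Submodule.span_le]
    rintro _ ⟨i, rfl⟩
    have := hz (FreeGroup.of i)
    simpa [f] using this
  have := finrank_range_le_card (R := ℚ) a
  rw [Set.finrank, htop, finrank_top] at this
  simpa using this

theorem IsClassicalTSchottky.exists_isSchottky {lam : ℂ} (hl : lam ≠ 0)
    (h : IsClassicalTSchottky (G lam)) :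
    ∃ (g : Fin 2 → Equiv.Perm Sphere) (D : Fin 2 × Bool → Circle), IsSchottky g D ∧
      Subgroup.closure (Set.range g) = Subgroup.closure {S, T lam} := by
  obtain ⟨n, g, hg, hm⟩ := h
  obtain ⟨D, hD⟩ := hm.exists_isSchottky
  change _ = Subgroup.closure {S, T lam} at hg
  have hn : 2 ≤ n := by
    by_contra! hn
    have hcomm : ∀ x ∈ Subgroup.closure (Set.range g), ∀ y ∈ Subgroup.closure (Set.range g),
        x * y = y * x := by
      intro x hx y hy
      have hsub : Subsingleton (Fin n) := by
        rw [Fin.subsingleton_iff_le_one]; omega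
      exact congrArg Subtype.val ((Subgroup.isMulCommutative_closure (k := Set.range g) (by
        rintro _ ⟨i, rfl⟩ _ ⟨j, rfl⟩
        rw [Subsingleton.elim i j])).is_comm.comm ⟨x, hx⟩ ⟨y, hy⟩)
    rw [hg] at hcomm
    exact S_mul_T_ne hl (hcomm _ (Subgroup.subset_closure (by simp)) _
      (Subgroup.subset_closure (by simp)))
  have : Nontrivial (Fin n) := Fin.nontrivial_iff_two_le.2 hn
  obtain ⟨s, t, -, -, hst⟩ := IsSchottky.exists_generators hD.injective hg
  obtain rfl : n = 2 := le_antisymm (card_le_two_of_closure_eq_top hst) hn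
  exact ⟨g, D, hD, hg⟩

end TwoParabolic

end

/-! ### The Schottky bound when the Schottky generators are parabolic -/

noncomputable section

namespace TwoParabolic

open OnePoint ComplexConjugate

section Inequalities

theorem two_le_norm_add_abs_im_iff (z : ℂ) : 2 ≤ ‖z‖ + |z.im| ↔ 4 - 4 * |z.im| ≤ z.re ^ 2 := by
  have h1 : ‖z‖ ^ 2 = z.re ^ 2 + z.im ^ 2 := by
    rw [← normSq_eq_norm_sq, normSq_apply]; ring
  have h2 := norm_nonneg z
  have h3 := abs_nonneg z.im
  have h4 := sq_abs z.im
  constructor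
  · intro h
    by_cases h5 : |z.im| ≤ 2
    · nlinarith
    · nlinarith
  · intro h
    by_contra! h'
    nlinarith

/-- The final estimate for the product case. Here `x`, `y` are the coordinates of the translation
parameter and `t` is the slope of the line joining the centres of the discs tangent at `0`. -/
theorem four_sub_le_sq {x y t : ℝ} (h1 : 1 + t ^ 2 ≤ x + t * y)
    (h2 : 2 * (x + t * y) ≤ x ^ 2 + y ^ 2) : 4 - 4 * |y| ≤ x ^ 2 := by
  wlog hy : 0 ≤ y generalizing y t
  · have := this (y := -y) (t := -t) (by linarith) (by linarith) (by linarith)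
    rwa [abs_neg] at this
  rw [abs_of_nonneg hy]
  by_contra! hx
  have hy1 : y < 1 := by nlinarith
  rcases le_or_gt 0 t with ht | ht
  · rcases le_or_gt 1 x with hx1 | hx1
    · have hty : 0 ≤ t * y := mul_nonneg ht hy
      have h3 : 1 - y ^ 2 ≤ x - 1 := by
        by_contra! h3
        nlinarith
      nlinarith
    · have h3 : 1 - x ≤ t * (y - t) := by linarith
      have h4 : t * (y - t) ≤ 1 / 4 * y ^ 2 := by nlinarith [sq_nonneg (y - 2 * t)]
      have h5 : 3 / 4 ≤ x := by nlinarith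
      have h6 : 9 / 16 ≤ x ^ 2 := by nlinarith
      have hty : 0 ≤ t * y := mul_nonneg ht hy
      have h7 : (1 - x) ^ 2 ≤ 1 / 16 := by nlinarith
      nlinarith
  · have h3 : 0 ≤ -t * y := mul_nonneg (by linarith) hy
    have hx1 : 1 ≤ x := by nlinarith [sq_nonneg t]
    have hx2 : x < 2 - y := by nlinarith
    rcases hy.eq_or_lt with rfl | hy
    · nlinarith
    · have h4 : 1 < y + -t := by
        have : (x - 1) ^ 2 < (1 - y) ^ 2 := by nlinarith
        nlinarith
      nlinarith

/-- Twice the right-hand side is `Re (l m̄ b̄) + Re (l m̄ b)`. The first term is at most `‖l‖ ‖m‖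
‖b‖`. The second is split into real and imaginary parts, so that `|Im l|` appears as the other
coefficient of `‖m‖ ‖b‖`. -/
theorem two_le_of_mul_le {l m b : ℂ} (hm : 0 < ‖m‖) (hb : 0 < ‖b‖)
    (h : ‖m‖ * ‖b‖ + |(conj m * b).re| ≤ (conj m * l).re * b.re) : 2 ≤ ‖l‖ + |l.im| := by
  have hMB := mul_pos hm hb
  set e := m * conj b with he
  have e1 : (conj m * b).re = e.re := by simp [he]
  have e2 : 2 * ((conj m * l).re * b.re) = (l * (conj m * conj b)).re + (l * conj e).re := by
    simp [he]; ring
  have e3 : (l * (conj m * conj b)).re ≤ ‖l‖ * (‖m‖ * ‖b‖) := by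
    refine (re_le_norm _).trans ?_
    simp
  have e4 : (l * conj e).re ≤ ‖l‖ * |e.re| + |l.im| * (‖m‖ * ‖b‖) := by
    have h1 : (l * conj e).re = l.re * e.re + l.im * e.im := by simp
    have h2 : l.re * e.re ≤ ‖l‖ * |e.re| := by
      refine (le_abs_self _).trans ?_
      rw [abs_mul]
      exact mul_le_mul_of_nonneg_right (abs_re_le_norm l) (abs_nonneg _)
    have h3 : l.im * e.im ≤ |l.im| * (‖m‖ * ‖b‖) := by
      refine (le_abs_self _).trans ?_
      rw [abs_mul]
      refine mul_le_mul_of_nonneg_left ((abs_im_le_norm e).trans ?_) (abs_nonneg _)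
      simp [he]
    linarith
  rw [e1] at h
  by_contra! h'
  have hl : ‖l‖ < 2 := by linarith [abs_nonneg l.im]
  have h5 : ‖l‖ * |e.re| ≤ 2 * |e.re| := mul_le_mul_of_nonneg_right hl.le (abs_nonneg _)
  nlinarith

theorem four_div_add_le {a b : ℝ} (ha : 0 < a) (hb : 0 < b) : 4 / (a + b) ≤ 1 / a + 1 / b := by
  rw [div_add_div _ _ ha.ne' hb.ne', div_le_div_iff₀ (by positivity) (by positivity)]
  nlinarith [sq_nonneg (a - b)]

end Inequalities

namespace Circle

theorem form_boundary (E : Circle) (ha : E.a ≠ 0) (hc : E.c = 0) {w : ℂ} (hw : ‖w‖ = ‖E.b‖) :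
    E.form (((w - E.b) / E.a : ℂ) : Sphere) = 0 := by
  have h1 : normSq w = normSq E.b := by rw [normSq_eq_norm_sq, normSq_eq_norm_sq, hw]
  have h2 : (w - E.b) / E.a = ((1 / E.a : ℝ) : ℂ) * (w - E.b) := by push_cast; ring
  rw [h2, form_coe, hc, normSq_mul, normSq_ofReal, mul_left_comm (conj E.b), re_ofReal_mul]
  have h3 : E.a * (1 / E.a * (1 / E.a) * normSq (w - E.b)) = 1 / E.a * normSq (w - E.b) := by
    field_simp
  rw [h3]
  have h4 : normSq (w - E.b) + 2 * (conj E.b * (w - E.b)).re = normSq w - normSq E.b := by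
    simp only [normSq_apply, conj_re, conj_im, mul_re, sub_re, sub_im]
    ring
  have : 1 / E.a * normSq (w - E.b) + 2 * (1 / E.a * (conj E.b * (w - E.b)).re) + 0
      = 1 / E.a * (normSq (w - E.b) + 2 * (conj E.b * (w - E.b)).re) := by ring
  rw [this, h4, h1]
  simp

/-- The circle through `0` whose interior is the image of the exterior of `E` under `S`. -/
def imageS (E : Circle) (hb : E.b ≠ 0) : Circle where
  a := 2 * E.b.re - E.a
  b := -E.b
  c := 0
  nondegenerate := by simpa using hb

theorem isImage_imageS (E : Circle) (hb : E.b ≠ 0) (hc : E.c = 0) :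
    IsImage S E.flip (E.imageS hb) := by
  intro p
  rw [flip_form]
  induction p using OnePoint.rec with
  | infty =>
    rw [S_infty]
    congr 1
    simp [imageS]
    ring
  | coe z =>
    rw [S_coe]
    split_ifs with h
    · congr 1
      have : z = -1 := by linear_combination h
      simp [imageS, this, hc]
      ring
    · rw [form_div _ h, sign_mul, sign_pos (inv_pos.2 (normSq_pos.2 h)), one_mul]
      congr 1
      simp only [hform, imageS, form_coe, hc, normSq_apply, conj_re, conj_im, mul_re, mul_im,
        add_re, add_im, neg_re, neg_im, one_re, one_im, map_neg]
      ring

/-- The image of the line `H` with its sides interchanged under the translation by `2 * l`. -/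
def imageT (H : Circle) (l : ℂ) (ha : H.a = 0) : Circle where
  a := 0
  b := -H.b
  c := 4 * (conj H.b * l).re - H.c
  nondegenerate := by simpa [ha] using H.nondegenerate

theorem isImage_imageT (H : Circle) (l : ℂ) (ha : H.a = 0) :
    IsImage (T l) H.flip (H.imageT l ha) := by
  intro p
  rw [flip_form]
  congr 1
  induction p using OnePoint.rec with
  | infty => simp [imageT, ha]
  | coe z =>
    simp only [T_coe, form_coe, imageT, ha, map_neg, mul_re, add_re, add_im, mul_im, neg_re,
      neg_im, conj_re, conj_im, re_ofNat, im_ofNat]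
    ring

theorem interior_eq_of_isImage {k : Equiv.Perm Sphere} {C D D' : Circle} (h : IsImage k C D)
    (h' : IsImage k C D') : D.interior = D'.interior := by
  rw [h.interior_eq, h'.interior_eq]

theorem b_ne_zero_of_mem {E : Circle} (h : E.c = 0) : E.b ≠ 0 := by
  have := E.nondegenerate
  rw [h, mul_zero] at this
  exact normSq_pos.1 this

theorem b_ne_zero_of_a {E : Circle} (h : E.a = 0) : E.b ≠ 0 := by
  have := E.nondegenerate
  rw [h, zero_mul] at this
  exact normSq_pos.1 this

theorem a_pos_of_disjoint {E H K : Circle} (hH : H.a = 0) (hK : K.a = 0)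
    (hEH : Disjoint E.interior H.interior) (hEK : Disjoint E.interior K.interior)
    (hHK : Disjoint H.interior K.interior) : 0 < E.a := by
  have h1 : 0 ≤ E.a := form_nonneg_of_disjoint hEH.symm (p := ∞) hH.le
  refine h1.lt_of_ne fun h => ?_
  exact not_three_halfplanes h.symm hH hK hEH hEK hHK

/-- A disc whose boundary passes through `0` and that is disjoint from a half-plane. -/
theorem halfplane_le {E H : Circle} (ha : 0 < E.a) (hc : E.c = 0) (hH : H.a = 0)
    (h : Disjoint E.interior H.interior) :
    2 * (‖H.b‖ * ‖E.b‖ + (conj H.b * E.b).re) / E.a ≤ H.c := by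
  have hm : 0 < ‖H.b‖ := norm_pos_iff.2 (b_ne_zero_of_a hH)
  set w : ℂ := ((-(‖E.b‖ / ‖H.b‖) : ℝ) : ℂ) * H.b with hw
  have hwn : ‖w‖ = ‖E.b‖ := by
    rw [hw, norm_mul, norm_real, Real.norm_eq_abs, abs_neg, abs_of_nonneg (by positivity)]
    field_simp
  have h1 := form_nonneg_of_disjoint h (form_boundary E ha.ne' hc hwn).le
  have h2 : (w - E.b) / E.a = ((1 / E.a : ℝ) : ℂ) * (w - E.b) := by push_cast; ring
  have h3 : (conj H.b * w).re = -(‖H.b‖ * ‖E.b‖) := by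
    rw [hw, mul_left_comm, ← normSq_eq_conj_mul_self, re_ofReal_mul, ofReal_re,
      normSq_eq_norm_sq]
    field_simp
  rw [h2, form_coe, hH, mul_left_comm (conj H.b), re_ofReal_mul, mul_sub (conj H.b),
    sub_re, h3] at h1
  have h4 : 2 * (‖H.b‖ * ‖E.b‖ + (conj H.b * E.b).re) / E.a
      = -(2 * (1 / E.a * (-(‖H.b‖ * ‖E.b‖) - (conj H.b * E.b).re))) := by ring
  rw [zero_mul] at h1
  linarith

/-- Two discs tangent at `0` lie in a strip whose translate by `2 l` is adjacent to it. Each disc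
must stay clear of both sides of the strip. Since adding the bounds for a single disc would lose the
dependence on the direction, the bounds for the two discs on the same side are combined with
opposite ones, which yields the sharper term `N + |r|`. -/
theorem two_le_of_paired {E E' H H' : Circle} {l : ℂ} (hE : IsImage S E.flip E')
    (hH : IsImage (T l) H.flip H') (hc : E.c = 0) (ha : H.a = 0)
    (d2 : Disjoint H.interior H'.interior)
    (d3 : Disjoint E.interior H.interior) (d4 : Disjoint E.interior H'.interior)
    (d5 : Disjoint E'.interior H.interior) (d6 : Disjoint E'.interior H'.interior) :
    2 ≤ ‖l‖ + |l.im| := by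
  have hb := b_ne_zero_of_mem hc
  have i1 := interior_eq_of_isImage hE (isImage_imageS E hb hc)
  have i2 := interior_eq_of_isImage hH (isImage_imageT H l ha)
  rw [i1] at d5 d6
  rw [i2] at d2 d4 d6
  have p1 : 0 < E.a := a_pos_of_disjoint ha rfl d3 d4 d2
  have p2 : 0 < (E.imageS hb).a := a_pos_of_disjoint ha rfl d5 d6 d2
  have n1 := halfplane_le p1 hc ha d3
  have n2 := halfplane_le p1 hc rfl d4
  have n3 := halfplane_le p2 rfl ha d5
  have n4 := halfplane_le p2 rfl rfl d6
  have hm : 0 < ‖H.b‖ := norm_pos_iff.2 (b_ne_zero_of_a ha)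
  have hb' : 0 < ‖E.b‖ := norm_pos_iff.2 hb
  refine two_le_of_mul_le hm hb' ?_
  simp only [imageS, imageT, norm_neg, map_neg, neg_mul, mul_neg, neg_neg, neg_re] at n1 n2 n3 n4 p2
  set r := (conj H.b * E.b).re
  set α := (conj H.b * l).re
  set N := ‖H.b‖ * ‖E.b‖
  set a' := 2 * E.b.re - E.a with ha'
  have hN : 0 < N := mul_pos hm hb'
  -- The coefficients `a`, `a'` of `|z|²` in the two discs have the fixed sum `2 Re b`, because `S`
  -- pairs the discs. The inequality of harmonic and arithmetic means removes them, with equality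
  -- for equal radii.
  have key := four_div_add_le p1 p2
  have hsum : E.a + a' = 2 * E.b.re := by rw [ha']; ring
  have hre : 0 < E.b.re := by linarith
  rw [hsum] at key
  have k1 : (N + r) * (1 / E.a + 1 / a') ≤ 2 * α := by
    have : (N + r) * (1 / E.a + 1 / a') = (2 * (N + r) / E.a + 2 * (N + r) / a') / 2 := by ring
    linarith
  have k2 : (N - r) * (1 / E.a + 1 / a') ≤ 2 * α := by
    have : (N - r) * (1 / E.a + 1 / a') = (2 * (N + -r) / E.a + 2 * (N + -r) / a') / 2 := by ring
    linarith
  have k3 : (N + |r|) * (1 / E.a + 1 / a') ≤ 2 * α := by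
    rcases abs_cases r with ⟨h, _⟩ | ⟨h, _⟩ <;> rw [h]
    · exact k1
    · exact k2
  have k4 : (N + |r|) * (4 / (2 * E.b.re)) ≤ 2 * α :=
    (mul_le_mul_of_nonneg_left key (by positivity)).trans k3
  have k5 : (N + |r|) * (4 / (2 * E.b.re)) = 2 * ((N + |r|) / E.b.re) := by field_simp; ring
  rw [k5] at k4
  have k6 : (N + |r|) / E.b.re ≤ α := by linarith
  rwa [div_le_iff₀ hre] at k6

end Circle

end TwoParabolic

end

/-! ### The Schottky bound when one parabolic generator is a product -/

noncomputable section

namespace TwoParabolic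

open OnePoint ComplexConjugate

/-- The case of equality in the Cauchy-Schwarz inequality. -/
theorem eq_neg_mul_of_norm_mul_add_re_le {m b : ℂ} (hb : b ≠ 0)
    (h : ‖m‖ * ‖b‖ + (conj m * b).re ≤ 0) : m = -(((‖m‖ / ‖b‖ : ℝ) : ℂ) * b) := by
  have hmb : (‖b‖ : ℂ) * m + ‖m‖ * b = 0 := by
    apply normSq_eq_zero.1
    refine le_antisymm ?_ (normSq_nonneg _)
    have : normSq (‖b‖ * m + ‖m‖ * b)
        = ‖b‖ ^ 2 * normSq m + ‖m‖ ^ 2 * normSq b + 2 * (‖m‖ * ‖b‖) * (conj m * b).re := by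
      simp only [normSq_apply, conj_re, conj_im, mul_re, mul_im, add_re, add_im,
          ofReal_re, ofReal_im]
      ring
    rw [this, normSq_eq_norm_sq, normSq_eq_norm_sq]
    have := mul_nonpos_of_nonneg_of_nonpos (mul_nonneg (norm_nonneg m) (norm_nonneg b)) h
    linarith
  have : (‖b‖ : ℂ) ≠ 0 := by simpa using hb
  push_cast
  field_simp
  linear_combination hmb

namespace Circle

theorem form_center_add (E : Circle) (ha : E.a ≠ 0) (hc : E.c = 0) (h : ℂ) :
    E.form ((h - E.b / E.a : ℂ) : Sphere) = E.a * normSq h - normSq E.b / E.a := by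
  have h2 : h - E.b / E.a = h - ((1 / E.a : ℝ) : ℂ) * E.b := by push_cast; ring
  rw [h2]
  simp only [form_coe, hc, normSq_apply, conj_re, conj_im, mul_re, mul_im, sub_re, sub_im,
    ofReal_re, ofReal_im]
  field_simp
  ring

/-- The fixed point `0` of the product is now a point of tangency of the half-plane `P` and the disc
`Q'`, and the other disc `Q` is the translate by `-2 l` of the disc `E` into which `S` maps the
exterior of `Q'`. Three distances matter: `Q'` from `P'`, `Q` from `P` (measured after translation
by `2 l`), and `Q` from `Q'`. -/
theorem two_le_of_slid {P P' Q Q' : Circle} {l : ℂ} (hP : IsImage (T l) P'.flip P)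
    (hQ : IsImage (T (-l) * S) Q'.flip Q) (ha : P.a = 0) (hc : P.c = 0) (hc' : Q'.c = 0)
    (d1 : Disjoint P.interior P'.interior) (d2 : Disjoint P.interior Q.interior)
    (d3 : Disjoint P.interior Q'.interior) (d4 : Disjoint P'.interior Q.interior)
    (d5 : Disjoint P'.interior Q'.interior) (d6 : Disjoint Q.interior Q'.interior) :
    2 ≤ ‖l‖ + |l.im| := by
  have hTinv : (T l)⁻¹ = T (-l) := T_inv l
  have hb := b_ne_zero_of_mem hc'
  have hmz := b_ne_zero_of_a ha
  -- explicit forms of the remaining circles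
  have iP' : P'.interior = (P.imageT (-l) ha).interior := by
    have h1 := hP.flip_left.inv
    rw [hTinv] at h1
    exact interior_eq_of_isImage h1 (isImage_imageT P (-l) ha)
  set E := Q'.imageS hb with hE
  have hES : IsImage S Q'.flip E := isImage_imageS Q' hb hc'
  have hTQ : IsImage (T l) Q E := by
    have h1 := hQ.inv.trans hES
    have h2 : S * (T (-l) * S)⁻¹ = T l := by rw [mul_inv_rev, mul_inv_cancel_left, T_inv, neg_neg]
    rwa [h2] at h1
  set H := P.flip.imageT l (by simp [flip, ha]) with hH
  have hTP : IsImage (T l) P H := by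
    have := isImage_imageT P.flip l (by simp [flip, ha])
    rwa [flip_flip] at this
  have hTP' : IsImage (T l) P' P.flip := hP.flip_left
  have d2' : Disjoint E.interior H.interior := by
    rw [hTQ.interior_eq, hTP.interior_eq, Set.disjoint_image_iff (T l).injective]
    exact d2.symm
  have d4' : Disjoint E.interior P.flip.interior := by
    rw [hTQ.interior_eq, hTP'.interior_eq, Set.disjoint_image_iff (T l).injective]
    exact d4.symm
  have d1' : Disjoint H.interior P.flip.interior := by
    rw [hTP.interior_eq, hTP'.interior_eq, Set.disjoint_image_iff (T l).injective]
    exact d1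
  rw [iP'] at d5 d1
  have p1 : 0 < Q'.a := a_pos_of_disjoint ha rfl d3.symm d5.symm d1
  have p2 : 0 < E.a := a_pos_of_disjoint (H := H) rfl (by simp [flip, ha]) d2' d4' d1'
  have n1 := halfplane_le p1 hc' ha d3.symm
  have n2 := halfplane_le p1 hc' rfl d5.symm
  have n3 := halfplane_le p2 rfl (H := H) rfl d2'
  have hm : 0 < ‖P.b‖ := norm_pos_iff.2 hmz
  have hb' : 0 < ‖Q'.b‖ := norm_pos_iff.2 hb
  have hEb : E.b = -Q'.b := rfl
  have hEc : E.c = 0 := rfl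
  have hEa : E.a = 2 * Q'.b.re - Q'.a := rfl
  have hHb : H.b = P.b := by simp [hH, imageT, flip]
  have hHc : H.c = -(4 * (conj P.b * l).re) := by
    simp [hH, imageT, flip, hc]; ring
  rw [hHb, hHc, hEb, norm_neg, mul_neg, neg_re] at n3
  simp only [imageT, norm_neg, map_neg, neg_mul, mul_neg, neg_re, hc, sub_zero] at n1 n2
  set b := Q'.b with hbdef
  set m := P.b with hmdef
  set a₁ := Q'.a with ha₁
  set a₂ := E.a with ha₂
  set N := ‖m‖ * ‖b‖ with hN
  have hN0 : 0 < N := mul_pos hm hb'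
  have hr : N + (conj m * b).re ≤ 0 := by
    have : 2 * (N + (conj m * b).re) ≤ 0 := by
      by_contra! h
      exact absurd n1 (not_le.2 (div_pos h p1))
    linarith
  -- the normal of the half-plane is opposite to `b`
  set κ := ‖m‖ / ‖b‖ with hκ
  have hκ0 : 0 < κ := by positivity
  have hmκ : m = -(κ * b) := eq_neg_mul_of_norm_mul_add_re_le hb hr
  set α := (conj b * l).re with hα
  set B := normSq b with hB
  have hB0 : 0 < B := normSq_pos.2 hb
  have e1 : (conj m * b).re = -(κ * B) := by
    rw [hmκ, map_neg, map_mul, conj_ofReal, neg_mul, neg_re, mul_assoc,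
      ← normSq_eq_conj_mul_self, re_ofReal_mul, ofReal_re]
  have e2 : (conj m * l).re = -(κ * α) := by
    rw [hmκ, map_neg, map_mul, conj_ofReal, neg_mul, neg_re, mul_assoc, re_ofReal_mul]
  have e3 : N = κ * B := by
    rw [hN, hB, normSq_eq_norm_sq, hκ]; field_simp
  rw [e1, e2, e3] at n2 n3
  have m1 : B / a₁ ≤ α := by
    have e : 2 * (κ * B + - -(κ * B)) / a₁ = 4 * κ * (B / a₁) := by ring
    rw [e] at n2
    have : 4 * κ * (B / a₁) ≤ 4 * κ * α := by linarith
    exact le_of_mul_le_mul_left this (by positivity)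
  have m2 : B / a₂ ≤ α := by
    have e : 2 * (κ * B + - -(κ * B)) / a₂ = 4 * κ * (B / a₂) := by ring
    rw [e] at n3
    have : 4 * κ * (B / a₂) ≤ 4 * κ * α := by linarith
    exact le_of_mul_le_mul_left this (by positivity)
  set R := 1 / a₁ + 1 / a₂ with hR
  have hR0 : 0 < R := by positivity
  -- The centres of `Q'` and `Q` differ by `R b - 2 l` and the sum of the radii is `R |b|`. If the
  -- distance were smaller, the point `z` dividing the segment between the centres in the ratio of
  -- the radii would lie in both discs.
  have m3 : R * α ≤ normSq l := by
    have hw : R ^ 2 * B ≤ normSq (R * b - 2 * l) := by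
      by_contra! hw
      set w := R * b - 2 * l with hwdef
      have hR' : (R : ℂ) ≠ 0 := by exact_mod_cast hR0.ne'
      have ha₁' : (a₁ : ℂ) ≠ 0 := by exact_mod_cast p1.ne'
      have ha₂' : (a₂ : ℂ) ≠ 0 := by exact_mod_cast p2.ne'
      set z : ℂ := ((1 / (a₁ * R) : ℝ) : ℂ) * w - b / a₁ with hz
      have hRc : (R : ℂ) = 1 / a₁ + 1 / a₂ := by rw [hR]; push_cast; ring
      have hz2 : z + 2 * l = ((-(1 / (a₂ * R)) : ℝ) : ℂ) * w - E.b / a₂ := by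
        have h1 : ((1 / (a₁ * R) : ℝ) : ℂ) + ((1 / (a₂ * R) : ℝ) : ℂ) = 1 := by
          rw [← ofReal_add, ← ofReal_one]
          congr 1
          rw [hR]; field_simp
        have h2 : z + 2 * l - (((-(1 / (a₂ * R)) : ℝ) : ℂ) * w - E.b / a₂)
            = (((1 / (a₁ * R) : ℝ) : ℂ) + ((1 / (a₂ * R) : ℝ) : ℂ)) * w - b / a₁ - b / a₂
              + 2 * l := by
          rw [hz, hEb]; push_cast; ring
        have hw' : w = b / a₁ + b / a₂ - 2 * l := by rw [hwdef, hRc]; ring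
        rw [h1, one_mul] at h2
        linear_combination h2 + hw'
      have f1 : Q'.form z < 0 := by
        rw [hz, form_center_add Q' p1.ne' hc', normSq_mul, normSq_ofReal]
        have : a₁ * (1 / (a₁ * R) * (1 / (a₁ * R)) * normSq w) - B / a₁
            = (normSq w - R ^ 2 * B) / (a₁ * R ^ 2) := by field_simp
        rw [this]
        exact div_neg_of_neg_of_pos (by linarith) (by positivity)
      have f2 : E.form (T l z) < 0 := by
        rw [T_coe, hz2, form_center_add E p2.ne' hEc, normSq_mul, normSq_ofReal, hEb, normSq_neg]
        have : a₂ * (-(1 / (a₂ * R)) * -(1 / (a₂ * R)) * normSq w) - B / a₂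
            = (normSq w - R ^ 2 * B) / (a₂ * R ^ 2) := by field_simp
        rw [this]
        exact div_neg_of_neg_of_pos (by linarith) (by positivity)
      rw [hTQ.neg_iff] at f2
      exact Set.disjoint_left.1 d6 f2 f1
    have e : normSq (R * b - 2 * l) = R ^ 2 * B - 4 * (R * α) + 4 * normSq l := by
      simp only [hα, hB, normSq_apply, conj_re, conj_im, mul_re, mul_im, sub_re, sub_im,
        ofReal_re, ofReal_im, re_ofNat, im_ofNat]
      ring
    linarith
  have hsum : a₁ + a₂ = 2 * b.re := by rw [hEa]; ring
  have hβ : 0 < b.re := by linarith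
  have hR2 : 2 / b.re ≤ R := by
    have := four_div_add_le p1 p2
    rw [hsum] at this
    have e : 4 / (2 * b.re) = 2 / b.re := by field_simp; ring
    rwa [e] at this
  have hα0 : 0 < α := lt_of_lt_of_le (by positivity) m1
  rw [two_le_norm_add_abs_im_iff]
  have hαe : α = b.re * l.re + b.im * l.im := by simp [hα]
  have hBe : B = b.re ^ 2 + b.im ^ 2 := by rw [hB, normSq_apply]; ring
  refine four_sub_le_sq (t := b.im / b.re) ?_ ?_
  · have h1 : R * B ≤ 2 * α := by
      have : R * B = B / a₁ + B / a₂ := by rw [hR]; ring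
      linarith
    have h2 : 2 / b.re * B ≤ 2 * α := (mul_le_mul_of_nonneg_right hR2 hB0.le).trans h1
    have h3 : 1 + (b.im / b.re) ^ 2 = (2 / b.re * B) / (2 * b.re) := by rw [hBe]; field_simp
    have h4 : l.re + b.im / b.re * l.im = (2 * α) / (2 * b.re) := by rw [hαe]; field_simp
    rw [h3, h4]
    gcongr
  · have h1 : 2 / b.re * α ≤ normSq l := (mul_le_mul_of_nonneg_right hR2 hα0.le).trans m3
    have h2 : 2 * (l.re + b.im / b.re * l.im) = 2 / b.re * α := by rw [hαe]; field_simp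
    rw [h2]
    refine h1.trans (le_of_eq ?_)
    rw [normSq_apply]; ring

end Circle

theorem lift_conj {ι H : Type*} [Group H] (g : ι → H) (k : H) (x : FreeGroup ι) :
    FreeGroup.lift (fun i => k * g i * k⁻¹) x = k * FreeGroup.lift g x * k⁻¹ := by
  have : FreeGroup.lift (fun i => k * g i * k⁻¹)
      = (MulAut.conj k).toMonoidHom.comp (FreeGroup.lift g) := by
    ext i
    simp
  rw [this]
  simp

namespace IsSchottky

variable {g : Fin 2 → Equiv.Perm Sphere} {D : Fin 2 × Bool → Circle}

/-- The exponent `-1` reduces to `1` by passing from `u` and `l` to `u⁻¹` and `-l`, since the bound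
is symmetric under `l ↦ -l`. -/
theorem two_le_of_apply (h : IsSchottky g D) {l : ℂ} (hl : l ≠ 0) {u v : Fin 2 × Bool}
    (huv : u.1 ≠ v.1) (e : ℤ) (he : e = 0 ∨ e = 1 ∨ e = -1)
    (h1 : FreeGroup.lift g (FreeGroup.mk [u]) = T l)
    (h2 : FreeGroup.lift g (FreeGroup.mk [u] ^ e * FreeGroup.mk [v]) = S) :
    2 ≤ ‖l‖ + |l.im| := by
  have huv' : ∀ w w' : Fin 2 × Bool, w.1 = u.1 → w'.1 = v.1 →
      Disjoint (D w).interior (D w').interior := fun w w' hw hw' =>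
    h.disj _ _ fun hww => huv (by rw [← hw, ← hw', hww])
  have htan : ∀ w q, IsParabolicAt (FreeGroup.lift g (FreeGroup.mk [w])) q →
      (D w).form q = 0 ∧ (D (invLetter w)).form q = 0 := fun w q hq =>
    (h.form_eq_zero FreeGroup.IsCyclicallyReduced.singleton (by simp) hq).2
  -- the case in which the second generator is a product
  have key : ∀ (u : Fin 2 × Bool) (l : ℂ), l ≠ 0 → u.1 ≠ v.1 →
      FreeGroup.lift g (FreeGroup.mk [u]) = T l →
      FreeGroup.lift g (FreeGroup.mk [u, v]) = S → 2 ≤ ‖l‖ + |l.im| := by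
    intro u l hl huv h1 h2
    have huv' : ∀ w w' : Fin 2 × Bool, w.1 = u.1 → w'.1 = v.1 →
        Disjoint (D w).interior (D w').interior := fun w w' hw hw' =>
      h.disj _ _ fun hww => huv (by rw [← hw, ← hw', hww])
    have t1 := htan u ∞ (by rw [h1]; exact isParabolicAt_T hl)
    have hcyc : FreeGroup.IsCyclicallyReduced [u, v] := by
      constructor
      · simpa [FreeGroup.IsReduced] using fun h => absurd h huv
      · simpa using fun h => absurd h.symm huv
    have t2 := (h.form_eq_zero hcyc (by simp) (p := ((0 : ℂ) : Sphere))
      (by rw [h2]; exact isParabolicAt_S)).2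
    have i1 := h.image u
    have i2 := h.image v
    rw [h1] at i1
    have hv : FreeGroup.lift g (FreeGroup.mk [v]) = T (-l) * S := by
      rw [← h2, ← T_inv, ← h1, mk_cons u [v], map_mul, inv_mul_cancel_left]
    rw [hv] at i2
    refine Circle.two_le_of_slid i1 i2 t1.1 ?_ ?_ (h.disj _ _ (invLetter_ne u).symm)
      (huv' u v rfl rfl) (huv' u (invLetter v) rfl rfl) (huv' (invLetter u) v rfl rfl)
      (huv' (invLetter u) (invLetter v) rfl rfl)
      (h.disj _ _ (invLetter_ne v).symm)
    · simpa using t2.1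
    · simpa using t2.2
  rcases he with rfl | rfl | rfl
  · rw [zpow_zero, one_mul] at h2
    have t1 := htan u ∞ (by rw [h1]; exact isParabolicAt_T hl)
    have t2 := htan v ((0 : ℂ) : Sphere) (by rw [h2]; exact isParabolicAt_S)
    have i1 := h.image u
    have i2 := h.image v
    rw [h1] at i1
    rw [h2] at i2
    refine Circle.two_le_of_paired i2 i1 ?_ t1.2 (h.disj _ _ (invLetter_ne u))
      (huv' (invLetter u) (invLetter v) rfl rfl).symm (huv' u (invLetter v) rfl rfl).symm
      (huv' (invLetter u) v rfl rfl).symm (huv' u v rfl rfl).symm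
    simpa using t2.2
  · rw [zpow_one, ← mk_cons] at h2
    exact key u l hl huv h1 h2
  · rw [zpow_neg_one, ← mk_invLetter, ← mk_cons] at h2
    have := key (invLetter u) (-l) (neg_ne_zero.2 hl) huv
      (by rw [mk_invLetter, map_inv, h1, T_inv]) h2
    simpa using this

theorem two_le (h : IsSchottky g D) {l : ℂ} (hl : l ≠ 0)
    (hg : Subgroup.closure (Set.range g) = Subgroup.closure {S, T l}) : 2 ≤ ‖l‖ + |l.im| := by
  obtain ⟨s, t, hs, ht, hst⟩ := exists_generators h.injective hg
  obtain ⟨c, u, v, huv, e, he, hc⟩ := h.exists_normal_form hst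
    (by rw [hs]; exact isParabolicAt_S) (by rw [ht]; exact isParabolicAt_T hl)
  set k := FreeGroup.lift g c with hk
  have hkm : k ∈ mobius := h.lift_mem c
  have hconj : ∀ w, FreeGroup.lift g (c * w * c⁻¹) = k * FreeGroup.lift g w * k⁻¹ := fun w => by
    rw [_root_.map_mul, _root_.map_mul, _root_.map_inv]
  rcases hc with ⟨h1, h2⟩ | ⟨h1, h2⟩
  · have hl2 : 2 * l ≠ 0 := by simpa using hl
    set J := invol (2 * l) hl2 with hJ
    obtain ⟨D', hD', -⟩ := h.exists_conj (k := J * k)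
      (mobius.mul_mem (invol_mem_mobius _ _) hkm)
    refine hD'.two_le_of_apply hl huv e he ?_ ?_
    · have : J * S = T l * J := by
        rw [hJ, invol_mul_S, mul_div_cancel_left₀ _ (two_ne_zero)]
      rw [lift_conj, ← mul_inv_eq_iff_eq_mul.2 this, ← hs, h1, hconj]
      group
    · rw [lift_conj, ← mul_inv_eq_iff_eq_mul.2 (invol_mul_T l hl2), ← hJ, ← ht, h2, hconj]
      group
  · obtain ⟨D', hD', -⟩ := h.exists_conj hkm
    refine hD'.two_le_of_apply hl huv e he ?_ ?_
    · rw [lift_conj, ← ht, h1, hconj]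
    · rw [lift_conj, ← hs, h2, hconj]

end IsSchottky

theorem two_le_of_isClassicalTSchottky {lam : ℂ} (hl : lam ≠ 0)
    (h : IsClassicalTSchottky (G lam)) : 2 ≤ ‖lam‖ + |lam.im| := by
  obtain ⟨g, D, hD, hg⟩ := h.exists_isSchottky hl
  exact hD.two_le hl hg

end TwoParabolic

end

/-! ### Explicit circles for large parameters -/

noncomputable section

namespace TwoParabolic

open OnePoint ComplexConjugate

/-- The unit square root in the right half-plane of the direction of `w`. -/
theorem exists_unit_sqrt {w : ℂ} (hw : 0 ≤ w.re) :
    ∃ m : ℂ, normSq m = 1 ∧ 0 < m.re ∧ w = ‖w‖ * m ^ 2 := by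
  refine ⟨exp ((arg w / 2 : ℝ) * I), ?_, ?_, ?_⟩
  · rw [normSq_eq_norm_sq, norm_exp_ofReal_mul_I, one_pow]
  · rw [exp_ofReal_mul_I_re]
    have := abs_le.1 (abs_arg_le_pi_div_two_iff.2 hw)
    have := Real.pi_pos
    exact Real.cos_pos_of_mem_Ioo ⟨by linarith, by linarith⟩
  · rw [← exp_nat_mul]
    convert (norm_mul_exp_arg_mul_I w).symm using 3
    push_cast
    ring

theorem two_mul_re_sq {w m : ℂ} (hm : normSq m = 1) (h : w = ‖w‖ * m ^ 2) :
    2 * (m.re * (‖w‖ * m.re)) = ‖w‖ + w.re := by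
  have h1 : w.re = ‖w‖ * (m ^ 2).re := by
    conv_lhs => rw [h]
    rw [re_ofReal_mul]
  rw [h1, sq, mul_re]
  rw [normSq_apply] at hm
  linear_combination ‖w‖ * hm

theorem conj_mul_re {w m : ℂ} (hm : normSq m = 1) (h : w = ‖w‖ * m ^ 2) :
    (conj m * w).re = ‖w‖ * m.re := by
  have : conj m * w = (‖w‖ : ℂ) * ((normSq m : ℝ) * m) := by
    rw [normSq_eq_conj_mul_self]
    linear_combination conj m * h
  rw [this, hm, re_ofReal_mul]
  simp

namespace Circle

theorem disjoint_of_add_nonneg {C D : Circle} (h : ∀ p, 0 ≤ C.form p + D.form p) :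
    Disjoint C.interior D.interior := by
  refine Set.disjoint_left.2 fun p h1 h2 => ?_
  have h1 : C.form p < 0 := h1
  have h2 : D.form p < 0 := h2
  linarith [h p]

theorem disjoint_of_normSq_le {C D : Circle} (hC : 0 < C.a) (hc : C.c = 0) (hD : D.a = 0)
    (h : normSq (C.b + D.b) ≤ C.a * D.c) : Disjoint C.interior D.interior := by
  refine disjoint_of_add_nonneg fun p => ?_
  induction p using OnePoint.rec with
  | infty => simp [hD, hC.le]
  | coe z =>
    have e : C.a * (C.form z + D.form z)
        = normSq (C.a * z + (C.b + D.b)) + (C.a * D.c - normSq (C.b + D.b)) := by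
      simp only [form_coe, hc, hD, normSq_apply, conj_re, conj_im, mul_re, mul_im, add_re, add_im,
        ofReal_re, ofReal_im]
      ring
    refine nonneg_of_mul_nonneg_right ?_ hC
    rw [e]
    have := normSq_nonneg (C.a * z + (C.b + D.b))
    linarith

theorem disjoint_of_b_eq_neg {C D : Circle} (ha : 0 ≤ C.a + D.a) (hb : D.b = -C.b)
    (hc : 0 ≤ C.c + D.c) : Disjoint C.interior D.interior := by
  refine disjoint_of_add_nonneg fun p => ?_
  induction p using OnePoint.rec with
  | infty => exact ha
  | coe z =>
    have := mul_nonneg ha (normSq_nonneg z)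
    simp only [form_coe, hb, map_neg, neg_mul, neg_re]
    linarith

theorem IsImage.image_exterior {k : Equiv.Perm Sphere} {C D : Circle} (h : IsImage k C.flip D) :
    k '' C.exterior = D.interior := by
  rw [h.interior_eq, flip_interior]

theorem disjointOrTangent_of_disjoint {C D E : Circle}
    (hCD : Disjoint C.interior D.interior) (hCE : Disjoint C.interior E.interior)
    (hDE : Disjoint D.interior E.interior) : C.DisjointOrTangent D := fun _ hp _ hq =>
  eq_of_common_of_disjoint hCD hCE hDE hp.1 hp.2 hq.1 hq.2

theorem not_separates_of_disjoint {C D E : Circle} (hCD : Disjoint C.interior D.interior)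
    (hCE : Disjoint C.interior E.interior) : ¬ C.Separates D E := by
  rintro (⟨⟨p, hp, hp'⟩, -⟩ | ⟨-, ⟨p, hp, hp'⟩⟩)
  · exact absurd hp' (not_lt.2 (form_nonneg_of_disjoint hCD.symm (le_of_eq hp)))
  · exact absurd hp' (not_lt.2 (form_nonneg_of_disjoint hCE.symm (le_of_eq hp)))

end Circle

-- The equality case of the estimates guides the choice: discs of equal radius `1 / Re m`, tangent
-- at `0` with centres `∓ m / Re m`, and lines parallel to the line of centres at distance `‖λ‖ Re
-- m` from it. With `m²` the direction of `∓ i λ`, the discs fit because `2 ‖λ‖ (Re m)² = ‖λ‖ + |Im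
-- λ|`.
open TwoParabolic.Circle in
theorem isClassicalTSchottky_of_le {lam : ℂ} (h : 2 ≤ ‖lam‖ + |lam.im|) :
    IsClassicalTSchottky (G lam) := by
  obtain ⟨ε, hε, him⟩ : ∃ ε : ℝ, ε ^ 2 = 1 ∧ |lam.im| = ε * lam.im := by
    rcases abs_cases lam.im with ⟨h, -⟩ | ⟨h, -⟩
    · exact ⟨1, by norm_num, by rw [h, one_mul]⟩
    · exact ⟨-1, by norm_num, by rw [h, neg_one_mul]⟩
  set w : ℂ := -(ε * I) * lam with hw
  have hre : w.re = |lam.im| := by rw [him, hw]; simp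
  have hεa : |ε| = 1 := by
    rw [← sq_eq_sq₀ (abs_nonneg _) zero_le_one, sq_abs, hε, one_pow]
  have hn : ‖w‖ = ‖lam‖ := by
    rw [hw]; simp [hεa]
  obtain ⟨m, hm, hmr, hmw⟩ := exists_unit_sqrt (hre ▸ abs_nonneg _ : 0 ≤ w.re)
  have k1 := two_mul_re_sq hm hmw
  have k2 := conj_mul_re hm hmw
  rw [hre, hn] at k1
  rw [hn] at k2
  have hm0 : m ≠ 0 := by rintro rfl; simp at hmr
  have hL := norm_nonneg lam
  let E : Circle := ⟨m.re, m, 0, by simp [hm]⟩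
  let H : Circle := ⟨0, ε * I * m, 2 * (‖lam‖ * m.re), by
    rw [zero_mul, normSq_mul, normSq_mul, normSq_ofReal, normSq_I, hm, ← sq, hε]; norm_num⟩
  have hH : H.a = 0 := rfl
  have hEb : E.b ≠ 0 := hm0
  have hEa : (E.imageS hEb).a = m.re := by simp only [imageS, E]; ring
  have hk : (conj H.b * lam).re = ‖lam‖ * m.re := by
    rw [← k2, hw]
    simp only [H, mul_re, mul_im, conj_re, conj_im, ofReal_re, ofReal_im, I_re, I_im, neg_re,
      neg_im]
    ring
  have hHc : (H.imageT lam hH).c = 2 * (‖lam‖ * m.re) := by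
    simp only [imageT, hk, H]; ring
  have hsq : ∀ δ η : ℝ, δ ^ 2 = 1 → η ^ 2 = 1 → normSq (δ * m + η * (ε * I * m)) = 2 := by
    intro δ η hδ hη
    have : normSq (δ * m + η * (ε * I * m)) = (δ ^ 2 + η ^ 2 * ε ^ 2) * normSq m := by
      simp only [normSq_apply, mul_re, mul_im, add_re, add_im, ofReal_re, ofReal_im, I_re, I_im]
      ring
    rw [this, hδ, hη, hε, hm]; norm_num
  have hle : 2 ≤ m.re * (2 * (‖lam‖ * m.re)) := by linarith
  have d1 : Disjoint E.interior (E.imageS hEb).interior :=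
    disjoint_of_b_eq_neg (by rw [hEa]; change 0 ≤ m.re + m.re; linarith) rfl
      (by simp [imageS, E])
  have d2 : Disjoint H.interior (H.imageT lam hH).interior :=
    disjoint_of_b_eq_neg (by simp [imageT, H]) rfl (by
      rw [hHc]
      have : 0 ≤ ‖lam‖ * m.re := by positivity
      change 0 ≤ 2 * (‖lam‖ * m.re) + 2 * (‖lam‖ * m.re)
      linarith)
  have d3 : Disjoint E.interior H.interior := disjoint_of_normSq_le hmr rfl rfl (by
    have := hsq 1 1 (by norm_num) (by norm_num)
    refine le_trans (le_of_eq ?_) hle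
    rw [← this]; congr 1; simp [E, H])
  have d4 : Disjoint E.interior (H.imageT lam hH).interior :=
    disjoint_of_normSq_le hmr rfl rfl (by
      have := hsq 1 (-1) (by norm_num) (by norm_num)
      rw [hHc]
      refine le_trans (le_of_eq ?_) hle
      rw [← this]; congr 1; simp [E, H, imageT])
  have d5 : Disjoint (E.imageS hEb).interior H.interior :=
    disjoint_of_normSq_le (hEa ▸ hmr) rfl rfl (by
      have := hsq (-1) 1 (by norm_num) (by norm_num)
      rw [hEa]
      refine le_trans (le_of_eq ?_) hle
      rw [← this]; congr 1; simp [E, H, imageS])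
  have d6 : Disjoint (E.imageS hEb).interior (H.imageT lam hH).interior :=
    disjoint_of_normSq_le (hEa ▸ hmr) rfl rfl (by
      have := hsq (-1) (-1) (by norm_num) (by norm_num)
      rw [hEa, hHc]
      refine le_trans (le_of_eq ?_) hle
      rw [← this]; congr 1; simp [E, H, imageS, imageT])
  refine ⟨2, ![S, T lam], by rw [Matrix.range_cons_cons_empty, G], ?_,
    ![E, H], ![E.imageS hEb, H.imageT lam hH], ?_, ?_⟩
  · intro i
    fin_cases i
    · exact S_mem_mobius
    · exact T_mem_mobius lam
  · rintro (i | i) (j | j) hij <;> fin_cases i <;> fin_cases j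
    · exact absurd rfl hij
    · exact d3
    · exact d3.symm
    · exact absurd rfl hij
    · exact d1
    · exact d4
    · exact d5.symm
    · exact d2
    · exact d1.symm
    · exact d5
    · exact d4.symm
    · exact d2.symm
    · exact absurd rfl hij
    · exact d6
    · exact d6.symm
    · exact absurd rfl hij
  · intro i
    fin_cases i
    · exact (isImage_imageS E hEb rfl).image_exterior
    · exact (isImage_imageT H lam hH).image_exterior

/-- The half-turn `z ↦ -z`. -/
def negation : Equiv.Perm Sphere :=
  ofMatrix (Matrix.GeneralLinearGroup.mkOfDetNeZero !![-1, 0; 0, 1] (by simp))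

theorem negation_mem_mobius : negation ∈ mobius := ofMatrix_mem_mobius _

@[simp] theorem negation_coe (z : ℂ) : negation (z : Sphere) = ((-z : ℂ) : Sphere) := by
  rw [negation, ofMatrix_coe]
  simp [Matrix.GeneralLinearGroup.mkOfDetNeZero]

@[simp] theorem negation_infty : negation ∞ = ∞ := by
  rw [negation, ofMatrix_infty]
  simp [Matrix.GeneralLinearGroup.mkOfDetNeZero]

theorem negation_mul_self : negation * negation = 1 := by
  ext p
  induction p using OnePoint.rec with
  | infty => simp
  | coe z => simp

theorem isHalfTurn_negation : IsHalfTurn negation ((0 : ℂ) : Sphere) ∞ := by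
  refine ⟨by simp, negation_mem_mobius, by simp, by simp, fun h => ?_, negation_mul_self⟩
  have := congrArg (fun f : Equiv.Perm Sphere => f ((1 : ℂ) : Sphere)) h
  simp only [negation_coe, Equiv.Perm.one_apply, OnePoint.coe_eq_coe] at this
  norm_num at this

theorem S_mul_negation : S * negation = ofMatrix
    (Matrix.GeneralLinearGroup.mkOfDetNeZero !![-1, 0; -1, 1] (by simp)) := by
  rw [S, negation, ← ofMatrix_mul]
  congr 1
  ext i j
  fin_cases i <;> fin_cases j <;>
    simp [Matrix.GeneralLinearGroup.mkOfDetNeZero, Matrix.mul_apply]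

theorem negation_mul_T (l : ℂ) : negation * T l = T (-l) * negation := by
  ext p
  induction p using OnePoint.rec with
  | infty => simp
  | coe z =>
    simp only [Equiv.Perm.mul_apply, T_coe, negation_coe]
    congr 1; ring

theorem negation_mul_S : negation * S = S⁻¹ * negation := by
  rw [eq_inv_mul_iff_mul_eq, ← mul_assoc, S_mul_negation, S, negation, ← ofMatrix_mul]
  congr 1
  ext i j
  fin_cases i <;> fin_cases j <;>
    simp [Matrix.GeneralLinearGroup.mkOfDetNeZero, Matrix.mul_apply]

theorem isHalfTurn_S_mul_negation :
    IsHalfTurn (S * negation) ((0 : ℂ) : Sphere) ((2 : ℂ) : Sphere) := by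
  refine ⟨by simp, mobius.mul_mem S_mem_mobius negation_mem_mobius, ?_, ?_, fun h => ?_, ?_⟩
  · simp [S_coe]
  · have : (-2 : ℂ) + 1 ≠ 0 := by norm_num
    simp only [Equiv.Perm.mul_apply, negation_coe, S_coe, if_neg this, OnePoint.coe_eq_coe]
    norm_num
  · have := congrArg (fun f : Equiv.Perm Sphere => f ∞) h
    simp [S_infty] at this
  · rw [mul_assoc, ← mul_assoc negation, negation_mul_S, mul_assoc, negation_mul_self, mul_one,
      mul_inv_cancel]

theorem isHalfTurn_T_mul_negation (l : ℂ) :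
    IsHalfTurn (T l * negation) ∞ (l : Sphere) := by
  refine ⟨by simp, mobius.mul_mem (T_mem_mobius l) negation_mem_mobius, by simp, ?_, fun h => ?_, ?_⟩
  · simp only [Equiv.Perm.mul_apply, negation_coe, T_coe]
    congr 1; ring
  · have := congrArg (fun f : Equiv.Perm Sphere => f ((l + 1 : ℂ) : Sphere)) h
    simp only [Equiv.Perm.mul_apply, negation_coe, T_coe, Equiv.Perm.one_apply,
      OnePoint.coe_eq_coe] at this
    have h2 : (-2 : ℂ) = 0 := by linear_combination this
    norm_num at h2
  · rw [mul_assoc, ← mul_assoc negation, negation_mul_T, mul_assoc, negation_mul_self, mul_one,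
      ← T_inv, mul_inv_cancel]

theorem IsParabolicAt.isPerpendicularToAxis {f : Equiv.Perm Sphere} {u n n' : Sphere}
    (h : IsParabolicAt f u) (hu : u = n ∨ u = n') : IsPerpendicularToAxis n n' f := by
  refine Or.inl ⟨u, ?_, hu⟩
  ext q
  exact h.apply_eq_iff q

-- Here `S = H_[0, 2] H_[0, ∞]` and `T l = H_[∞, l] H_[0, ∞]`. The unit vector `m` bisects the angle
-- between `1` and `l`. The lines through `0` and `l` with normal `m` bound a strip of width `‖l‖ Re
-- m`. The circle through `0` and `2` tangent to the first line has diameter `2 / Re m`, and it fits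
-- because `2 ‖l‖ (Re m)² = ‖l‖ + Re l`.
open TwoParabolic.Circle in
theorem isMarkedNSDC_of_le {l : ℂ} (hl : 0 ≤ l.re) (h : 4 ≤ ‖l‖ + l.re) : IsMarkedNSDC S (T l) := by
  obtain ⟨m, hm, hmr, hml⟩ := exists_unit_sqrt hl
  have k1 := two_mul_re_sq hm hml
  have k2 := conj_mul_re hm hml
  have hl0 : l ≠ 0 := by rintro rfl; norm_num at h
  refine ⟨S_mem_mobius, T_mem_mobius l, ((0 : ℂ) : Sphere), ((2 : ℂ) : Sphere),
    ((0 : ℂ) : Sphere), ∞, ∞, (l : Sphere),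
    ⟨isParabolicAt_S.isPerpendicularToAxis (Or.inl rfl),
      (isParabolicAt_T hl0).isPerpendicularToAxis (Or.inr rfl),
      S * negation, negation, T l * negation, isHalfTurn_S_mul_negation, isHalfTurn_negation,
      isHalfTurn_T_mul_negation l, ?_, ?_⟩, by simp, by simp, by simp, ?_⟩
  · rw [mul_assoc, negation_mul_self, mul_one]
  · rw [mul_assoc, negation_mul_self, mul_one]
  let CA : Circle := ⟨m.re, -m, 0, by simp [hm]⟩
  let CN : Circle := ⟨0, m, 0, by simp [hm]⟩
  let CB : Circle := ⟨0, -m, 2 * (‖l‖ * m.re), by simp [hm]⟩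
  have d1 : Disjoint CA.interior CN.interior := disjoint_of_normSq_le hmr rfl rfl (by simp [CA, CN])
  have d2 : Disjoint CN.interior CB.interior :=
    disjoint_of_b_eq_neg (by simp [CN, CB]) rfl (by simp only [CN, CB]; positivity)
  have d3 : Disjoint CA.interior CB.interior := disjoint_of_normSq_le hmr rfl rfl (by
    have : normSq (CA.b + CB.b) = 4 := by
      have : CA.b + CB.b = ((-2 : ℝ) : ℂ) * m := by simp only [CA, CB]; push_cast; ring
      rw [this, normSq_mul, normSq_ofReal, hm]; norm_num
    rw [this]
    change 4 ≤ m.re * (2 * (‖l‖ * m.re))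
    linarith)
  refine ⟨CA, CN, CB, ?_, ?_, ?_, ?_, ?_, ?_, disjointOrTangent_of_disjoint d1 d3 d2,
    disjointOrTangent_of_disjoint d2 d1.symm d3.symm, disjointOrTangent_of_disjoint d3 d1 d2.symm,
    not_separates_of_disjoint d1 d3, not_separates_of_disjoint d1.symm d2,
    not_separates_of_disjoint d3.symm d2.symm⟩
  · simp [carrier, CA]
  · simp [carrier, CA]; ring
  · simp [carrier, CN]
  · simp [carrier, CN]
  · simp [carrier, CB]
  · simp only [carrier, Set.mem_ofPred_eq, form_coe, CB, map_neg, neg_mul, neg_re, k2]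
    ring

theorem isNSDC_of_le {lam : ℂ} (h : 4 ≤ ‖lam‖ + |lam.re|) : IsNSDC (G lam) := by
  rcases abs_cases lam.re with ⟨h1, h2⟩ | ⟨h1, h2⟩
  · exact ⟨S, T lam, rfl, isMarkedNSDC_of_le h2 (by rwa [h1] at h)⟩
  · refine ⟨S, T (-lam), ?_, isMarkedNSDC_of_le (by simp; linarith) (by simpa [h1] using h)⟩
    rw [G, ← T_inv]
    refine le_antisymm ?_ ?_ <;> rw [Subgroup.closure_le] <;> rintro _ (rfl | rfl)
    · exact Subgroup.subset_closure (by simp)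
    · exact Subgroup.inv_mem _ (Subgroup.subset_closure (by simp))
    · exact Subgroup.subset_closure (by simp)
    · rw [← inv_inv (T lam)]
      exact Subgroup.inv_mem _ (Subgroup.subset_closure (by simp))

end TwoParabolic

end

/-! ### Orienting the circles of an nsdc group, and half-turns -/

noncomputable section

namespace TwoParabolic

open OnePoint ComplexConjugate

theorem exists_pos_root {A B F : ℝ} (hA : A < 0) (hF : 0 < F) :
    ∃ t : ℝ, 0 < t ∧ A * t ^ 2 + B * t + F = 0 := by
  have hAF : A * F < 0 := mul_neg_of_neg_of_pos hA hF
  have hd : 0 ≤ B ^ 2 - 4 * A * F := by nlinarith [sq_nonneg B]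
  set s := √(B ^ 2 - 4 * A * F) with hs
  have hs2 : s ^ 2 = B ^ 2 - 4 * A * F := Real.sq_sqrt hd
  have hBs : |B| < s := by
    rw [hs]
    refine Real.lt_sqrt_of_sq_lt ?_
    rw [sq_abs]
    linarith
  refine ⟨(B + s) / (-2 * A), div_pos (by linarith [neg_abs_le B]) (by linarith), ?_⟩
  have := hA.ne
  field_simp
  linear_combination hs2

namespace Circle

theorem form_add_mul (C : Circle) (z v : ℂ) (t : ℝ) :
    C.form ((z + t * v : ℂ) : Sphere) = C.a * normSq v * t ^ 2
      + 2 * (conj (C.a * z + C.b) * v).re * t + C.form z := by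
  simp only [form_coe, normSq_apply, conj_re, conj_im, mul_re, mul_im, add_re, add_im,
    ofReal_re, ofReal_im]
  ring

/-- A circle that meets another one in at most one point lies on one closed side of it. -/
theorem DisjointOrTangent.nonneg_or_nonpos {C D : Circle} (h : C.DisjointOrTangent D) :
    (∀ p ∈ D.carrier, 0 ≤ C.form p) ∨ (∀ p ∈ D.carrier, C.form p ≤ 0) := by
  by_contra! hcon
  obtain ⟨⟨p, hp, hCp⟩, q, hq, hCq⟩ := hcon
  obtain ⟨k, hk, hkp⟩ := exists_mobius_apply_eq_infty p
  obtain ⟨C', hC'⟩ := exists_isImage hk C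
  obtain ⟨D', hD'⟩ := exists_isImage hk D
  rw [← hC'.neg_iff, hkp, form_infty] at hCp
  rw [← hC'.pos_iff] at hCq
  replace hp : D'.form (k p) = 0 := (hD'.zero_iff p).2 hp
  replace hq : D'.form (k q) = 0 := (hD'.zero_iff q).2 hq
  rw [hkp, form_infty] at hp
  have hqi : k q ≠ ∞ := by
    intro hqi
    rw [hqi, form_infty] at hCq
    linarith
  obtain ⟨z, hz⟩ := OnePoint.ne_infty_iff_exists.1 hqi
  rw [← hz] at hq hCq
  -- With `p` at `∞`, `D'` is a line of direction `i b`. Along it the form of `C'` is a quadratic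
  -- polynomial, positive at `z` and tending to `-∞` both ways, which gives two common points.
  have hv : 0 < normSq (I * D'.b) :=
    normSq_pos.2 (mul_ne_zero I_ne_zero (b_ne_zero_of_a hp))
  have hA : C'.a * normSq (I * D'.b) < 0 := mul_neg_of_neg_of_pos hCp hv
  obtain ⟨t, ht, hCt⟩ := exists_pos_root
    (B := 2 * (conj (C'.a * z + C'.b) * (I * D'.b)).re) hA hCq
  obtain ⟨t', ht', hCt'⟩ := exists_pos_root
    (B := -(2 * (conj (C'.a * z + C'.b) * (I * D'.b)).re)) hA hCq
  have hD : ∀ t : ℝ, D'.form ((z + t * (I * D'.b) : ℂ) : Sphere) = 0 := by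
    intro t
    rw [form_add_mul, hq, hp]
    have : (conj (((0 : ℝ) : ℂ) * z + D'.b) * (I * D'.b)).re = 0 := by
      simp; ring
    rw [this]; ring
  have key : ∀ t : ℝ, C'.form ((z + t * (I * D'.b) : ℂ) : Sphere) = 0 →
      k⁻¹ ((z + t * (I * D'.b) : ℂ) : Sphere) ∈ C.carrier ∩ D.carrier := by
    intro t hCt
    constructor
    · exact (hC'.inv.zero_iff _).2 hCt
    · exact (hD'.inv.zero_iff _).2 (hD t)
  have := h (key t (by rw [form_add_mul]; exact hCt))
    (key (-t') (by rw [form_add_mul]; linear_combination hCt'))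
  have := k⁻¹.injective this
  rw [OnePoint.coe_eq_coe, add_right_inj] at this
  have := ofReal_injective (mul_right_cancel₀ (normSq_pos.1 hv) this)
  linarith

/-- A circle that does not meet the interior of another one has a side disjoint from it. -/
theorem disjoint_or_disjoint_flip {C D : Circle} (h : ∀ p ∈ D.carrier, 0 ≤ C.form p) :
    Disjoint C.interior D.interior ∨ Disjoint C.interior D.flip.interior := by
  by_contra! hcon
  obtain ⟨⟨p, hCp, hDp⟩, q, hCq, hDq⟩ := And.intro (Set.not_disjoint_iff.1 hcon.1)
    (Set.not_disjoint_iff.1 hcon.2)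
  replace hCp : C.form p < 0 := hCp
  replace hCq : C.form q < 0 := hCq
  replace hDp : D.form p < 0 := hDp
  replace hDq : 0 < D.form q := by rw [flip_interior] at hDq; exact hDq
  obtain ⟨k, hk, hkp⟩ := exists_mobius_apply_eq_infty p
  obtain ⟨C', hC'⟩ := exists_isImage hk C
  obtain ⟨D', hD'⟩ := exists_isImage hk D
  rw [← hC'.neg_iff] at hCp hCq
  rw [← hD'.neg_iff] at hDp
  rw [← hD'.pos_iff] at hDq
  rw [hkp, form_infty] at hCp hDp
  have hqi : k q ≠ ∞ := by
    intro hqi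
    rw [hqi, form_infty] at hDq
    linarith
  obtain ⟨z, hz⟩ := OnePoint.ne_infty_iff_exists.1 hqi
  rw [← hz] at hDq hCq
  -- Along the ray from `z` against the gradient the form of `C'` stays negative, while that of `D'`
  -- starts positive and tends to `-∞`. So the ray meets `D'` inside `C'`.
  set v := -(C'.a * z + C'.b) with hvdef
  have hvn : normSq v = C'.a * C'.form z + (normSq C'.b - C'.a * C'.c) := by
    rw [hvdef]
    simp only [form_coe, normSq_apply, conj_re, conj_im, mul_re, mul_im, add_re, add_im,
      ofReal_re, ofReal_im, neg_re, neg_im]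
    ring
  have hv : 0 < normSq v := by
    rw [hvn]
    have := mul_pos_of_neg_of_neg hCp hCq
    linarith [C'.nondegenerate]
  obtain ⟨t, ht, hDt⟩ := exists_pos_root (B := 2 * (conj (D'.a * z + D'.b) * v).re)
    (mul_neg_of_neg_of_pos hDp hv) hDq
  rw [← form_add_mul] at hDt
  have h1 : D.form (k⁻¹ ((z + t * v : ℂ) : Sphere)) = 0 := (hD'.inv.zero_iff _).2 hDt
  have h2 : 0 ≤ C.form (k⁻¹ ((z + t * v : ℂ) : Sphere)) := h _ h1
  rw [← not_lt, hC'.inv.neg_iff, not_lt, form_add_mul] at h2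
  have h3 : (conj (C'.a * z + C'.b) * v).re = -normSq v := by
    rw [hvdef, mul_neg, neg_re, ← normSq_eq_conj_mul_self, ofReal_re, normSq_neg]
  rw [h3] at h2
  have h4 : C'.a * normSq v * t ^ 2 < 0 :=
    mul_neg_of_neg_of_pos (mul_neg_of_neg_of_pos hCp hv) (by positivity)
  have h5 := mul_pos hv ht
  linarith

/-- Having two distinct points, `D` is not contained in `C`, and a point of `D` off `C` selects the
exterior. Nonseparation then puts `E` on the same closed side. -/
theorem exists_orientation {C D E : Circle} (hCD : C.DisjointOrTangent D) {x y : Sphere}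
    (hxy : x ≠ y) (hx : x ∈ D.carrier) (hy : y ∈ D.carrier) (hs : ¬ C.Separates D E) :
    ∃ C' : Circle, (C' = C ∨ C' = C.flip) ∧ (∀ p ∈ D.carrier, 0 ≤ C'.form p) ∧
      ∀ p ∈ E.carrier, 0 ≤ C'.form p := by
  have hoff : ∃ p ∈ D.carrier, C.form p ≠ 0 := by
    by_contra! hoff
    exact hxy (hCD ⟨hoff x hx, hx⟩ ⟨hoff y hy, hy⟩)
  obtain ⟨p, hp, hp0⟩ := hoff
  rw [Separates, not_or] at hs
  rcases hp0.lt_or_gt with h | h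
  · refine ⟨C.flip, Or.inr rfl, ?_, ?_⟩
    · rcases hCD.nonneg_or_nonpos with h' | h'
      · exact absurd (h' p hp) (not_le.2 h)
      · simpa using h'
    · intro q hq
      rw [flip_form, Left.nonneg_neg_iff]
      by_contra! hq'
      exact hs.1 ⟨⟨p, hp, h⟩, q, hq, hq'⟩
  · refine ⟨C, Or.inl rfl, ?_, ?_⟩
    · rcases hCD.nonneg_or_nonpos with h' | h'
      · exact h'
      · exact absurd (h' p hp) (not_le.2 h)
    · intro q hq
      by_contra! hq'
      exact hs.2 ⟨⟨p, hp, h⟩, q, hq, hq'⟩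

/-- The alternative, disjointness from the other side of `D`, would place all of `C` on `D`, but
they have at most one common point. -/
theorem disjoint_of_nonneg {C D : Circle} (hCD : C.DisjointOrTangent D) {x y : Sphere}
    (hxy : x ≠ y) (hx : x ∈ C.carrier) (hy : y ∈ C.carrier) (hD : ∀ p ∈ D.carrier, 0 ≤ C.form p)
    (hC : ∀ p ∈ C.carrier, 0 ≤ D.form p) : Disjoint C.interior D.interior := by
  refine (disjoint_or_disjoint_flip hD).resolve_right fun h => hxy ?_
  have key : ∀ p ∈ C.carrier, p ∈ D.carrier := by
    intro p hp
    have := form_nonneg_of_disjoint h (le_of_eq hp)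
    rw [flip_form, Left.nonneg_neg_iff] at this
    exact le_antisymm this (hC p hp)
  exact hCD ⟨hx, key x hx⟩ ⟨hy, key y hy⟩

theorem carrier_eq_of_eq_or_eq_flip {C C' : Circle} (h : C' = C ∨ C' = C.flip) :
    C'.carrier = C.carrier := by
  rcases h with rfl | rfl
  · rfl
  · exact flip_carrier C

theorem DisjointOrTangent.symm {C D : Circle} (h : C.DisjointOrTangent D) :
    D.DisjointOrTangent C := by
  rwa [DisjointOrTangent, Set.inter_comm]

end Circle

theorem eq_negation {h : Equiv.Perm Sphere} (hm : h ∈ mobius) (h0 : h ((0 : ℂ) : Sphere) = (0 : ℂ))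
    (hi : h ∞ = ∞) (h1 : h ≠ 1) (h2 : h * h = 1) : h = negation := by
  obtain ⟨M, rfl⟩ := exists_eq_ofMatrix hm
  have hc : M 1 0 = 0 := by
    rw [ofMatrix_infty] at hi
    by_contra hc
    simp [hc] at hi
  have hdet := M.det_ne_zero
  rw [Matrix.det_fin_two, hc, mul_zero, sub_zero] at hdet
  have hd : M 1 1 ≠ 0 := right_ne_zero_of_mul hdet
  have hcoe : ∀ z : ℂ, ofMatrix M (z : Sphere) = (((M 0 0 * z + M 0 1) / M 1 1 : ℂ) : Sphere) := by
    intro z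
    rw [ofMatrix_coe, hc]
    simp [hd]
  have hb : M 0 1 = 0 := by
    rw [hcoe, OnePoint.coe_eq_coe] at h0
    simpa [hd] using h0
  set α := M 0 0 / M 1 1 with hα
  have hmul : ∀ z : ℂ, ofMatrix M (z : Sphere) = ((α * z : ℂ) : Sphere) := by
    intro z
    rw [hcoe, hb, add_zero, hα]
    congr 1; ring
  have hsq : α ^ 2 = 1 := by
    have := congrArg (fun f : Equiv.Perm Sphere => f ((1 : ℂ) : Sphere)) h2
    simp only [Equiv.Perm.mul_apply, hmul, Equiv.Perm.one_apply, OnePoint.coe_eq_coe] at this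
    linear_combination this
  have hne : α ≠ 1 := by
    intro hα1
    apply h1
    ext p
    induction p using OnePoint.rec with
    | infty => rw [hi]; rfl
    | coe z => rw [hmul, hα1, one_mul]; rfl
  have hα' : α = -1 := (sq_eq_one_iff.1 hsq).resolve_left hne
  ext p
  induction p using OnePoint.rec with
  | infty => rw [hi, negation_infty]
  | coe z => rw [hmul, hα', negation_coe, neg_one_mul]

theorem exists_mobius_zero_infty {x y : Sphere} (hxy : x ≠ y) :
    ∃ k ∈ mobius, k x = ((0 : ℂ) : Sphere) ∧ k y = ∞ := by
  obtain ⟨k, hk, hky⟩ := exists_mobius_apply_eq_infty y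
  have hx : k x ≠ ∞ := by
    rw [← hky]; exact fun h => hxy (k.injective h)
  obtain ⟨z, hz⟩ := OnePoint.ne_infty_iff_exists.1 hx
  refine ⟨T (-z / 2) * k, mobius.mul_mem (T_mem_mobius _) hk, ?_, ?_⟩
  · rw [Equiv.Perm.mul_apply, ← hz, T_coe]
    congr 1; ring
  · rw [Equiv.Perm.mul_apply, hky, T_infty]

/-- `h` is an involutive Möbius transformation that interchanges the sides of `C`. -/
structure SwapsSides (h : Equiv.Perm Sphere) (C : Circle) : Prop where
  mem : h ∈ mobius
  mul_self : h * h = 1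
  image : Circle.IsImage h C C.flip

/-- Conjugation takes the fixed points to `0` and `∞`. The half-turn becomes `z ↦ -z` and the circle
a line through `0`. -/
theorem IsHalfTurn.swapsSides {h : Equiv.Perm Sphere} {x y : Sphere} (hh : IsHalfTurn h x y)
    {C : Circle} (hx : x ∈ C.carrier) (hy : y ∈ C.carrier) : SwapsSides h C := by
  obtain ⟨hxy, hm, hhx, hhy, h1, h2⟩ := hh
  refine ⟨hm, h2, ?_⟩
  obtain ⟨k, hk, hkx, hky⟩ := exists_mobius_zero_infty hxy
  obtain ⟨D, hD⟩ := Circle.exists_isImage hk C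
  have hn : k * h * k⁻¹ = negation := by
    have kx : k⁻¹ ((0 : ℂ) : Sphere) = x := by rw [← hkx]; exact k.symm_apply_apply x
    have ky : k⁻¹ ∞ = y := by rw [← hky]; exact k.symm_apply_apply y
    refine eq_negation (mobius.mul_mem (mobius.mul_mem hk hm) (mobius.inv_mem hk)) ?_ ?_ ?_ ?_
    · rw [Equiv.Perm.mul_apply, Equiv.Perm.mul_apply, kx, hhx, hkx]
    · rw [Equiv.Perm.mul_apply, Equiv.Perm.mul_apply, ky, hhy, hky]
    · intro h'
      apply h1
      rw [mul_inv_eq_one] at h'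
      simpa using h'
    · calc k * h * k⁻¹ * (k * h * k⁻¹) = k * (h * h) * k⁻¹ := by group
        _ = 1 := by rw [h2]; group
  have hc : D.c = 0 := by
    have := (hD.zero_iff x).2 hx
    rw [hkx] at this
    simpa using this
  have ha : D.a = 0 := by
    have := (hD.zero_iff y).2 hy
    rwa [hky] at this
  have hDn : Circle.IsImage negation D D.flip := by
    intro p
    congr 1
    rw [Circle.flip_form]
    induction p using OnePoint.rec with
    | infty => simp [ha]
    | coe z => simp [ha, hc]; ring
  have := (hD.trans hDn).trans hD.flip.inv
  rw [← hn] at this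
  convert this using 1
  group

namespace SwapsSides

variable {h : Equiv.Perm Sphere} {C : Circle}

theorem inv_eq (hh : SwapsSides h C) : h⁻¹ = h := inv_eq_of_mul_eq_one_left hh.mul_self

theorem apply_apply (hh : SwapsSides h C) (p : Sphere) : h (h p) = p := by
  rw [← Equiv.Perm.mul_apply, hh.mul_self]; rfl

theorem form_eq_zero (hh : SwapsSides h C) {p : Sphere} (hp : h p = p) : C.form p = 0 := by
  have := hh.image p
  rw [hp, Circle.flip_form, Left.sign_neg] at this
  rw [← sign_eq_zero_iff]
  generalize SignType.sign (C.form p) = s at *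
  cases s <;> simp_all

theorem form_apply_eq_zero_iff (hh : SwapsSides h C) (p : Sphere) :
    C.form (h p) = 0 ↔ C.form p = 0 := by
  rw [← hh.image.zero_iff p, Circle.flip_form, neg_eq_zero]

theorem ne_one (hh : SwapsSides h C) : h ≠ 1 := by
  rintro rfl
  obtain ⟨p, hp⟩ := C.interior_nonempty
  exact absurd (hh.form_eq_zero rfl) (ne_of_lt hp)

theorem conjugate (hh : SwapsSides h C) {k : Equiv.Perm Sphere} (hk : k ∈ mobius) {D : Circle}
    (hD : Circle.IsImage k C D) : SwapsSides (k * h * k⁻¹) D := by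
  refine ⟨mobius.mul_mem (mobius.mul_mem hk hh.mem) (mobius.inv_mem hk), ?_, ?_⟩
  · calc k * h * k⁻¹ * (k * h * k⁻¹) = k * (h * h) * k⁻¹ := by group
      _ = 1 := by rw [hh.mul_self]; group
  · rw [mul_assoc]
    exact (hD.inv.trans hh.image).trans hD.flip

end SwapsSides

end TwoParabolic

end

/-! ### Triples of half-turns and the nsdc bound -/

noncomputable section

namespace TwoParabolic

open OnePoint ComplexConjugate

/-- Three involutions that interchange the sides of three circles with disjoint interiors. -/
structure IsTurnTriple (h₁ h₂ h₃ : Equiv.Perm Sphere) (C₁ C₂ C₃ : Circle) : Prop where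
  swaps₁ : SwapsSides h₁ C₁
  swaps₂ : SwapsSides h₂ C₂
  swaps₃ : SwapsSides h₃ C₃
  disj₁₂ : Disjoint C₁.interior C₂.interior
  disj₁₃ : Disjoint C₁.interior C₃.interior
  disj₂₃ : Disjoint C₂.interior C₃.interior

/-- The interiors are the sides that contain neither of the other two circles. The ends of the lines
and the perpendicularity are no longer needed afterwards. -/
theorem IsMarkedNSDC.exists_isTurnTriple {A B : Equiv.Perm Sphere} (h : IsMarkedNSDC A B) :
    ∃ h₁ h₂ h₃ C₁ C₂ C₃, IsTurnTriple h₁ h₂ h₃ C₁ C₂ C₃ ∧ A = h₁ * h₂ ∧ B = h₃ * h₂ := by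
  obtain ⟨-, -, a, a', n, n', b, b', ⟨-, -, h₁, h₂, h₃, t₁, t₂, t₃, hA, hB⟩, ha, hn, hb, CA, CN,
    CB, ca, ca', cn, cn', cb, cb', tAN, tNB, tAB, sA, sN, sB⟩ := h
  obtain ⟨C₁, e₁, p₁, q₁⟩ := Circle.exists_orientation tAN hn cn cn' sA
  obtain ⟨C₂, e₂, p₂, q₂⟩ := Circle.exists_orientation tAN.symm ha ca ca' sN
  obtain ⟨C₃, e₃, p₃, q₃⟩ := Circle.exists_orientation tAB.symm ha ca ca' sB
  have f₁ := Circle.carrier_eq_of_eq_or_eq_flip e₁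
  have f₂ := Circle.carrier_eq_of_eq_or_eq_flip e₂
  have f₃ := Circle.carrier_eq_of_eq_or_eq_flip e₃
  simp only [Circle.DisjointOrTangent] at tAN tNB tAB
  rw [← f₁] at ca ca' p₂ p₃ tAN tAB
  rw [← f₂] at cn cn' p₁ q₃ tAN tNB
  rw [← f₃] at cb cb' q₁ q₂ tNB tAB
  exact ⟨h₁, h₂, h₃, C₁, C₂, C₃, ⟨t₁.swapsSides ca ca', t₂.swapsSides cn cn',
    t₃.swapsSides cb cb', Circle.disjoint_of_nonneg tAN ha ca ca' p₁ p₂,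
    Circle.disjoint_of_nonneg tAB ha ca ca' q₁ p₃,
    Circle.disjoint_of_nonneg tNB hn cn cn' q₂ q₃⟩, hA, hB⟩

/-- By `2 (Re m) m̄ = |m|² + m̄²`, followed by the triangle inequality. -/
theorem four_le_of_mul_le {l m : ℂ} (hm : m ≠ 0)
    (h : 2 * normSq m ≤ m.re * (conj m * l).re) : 4 ≤ ‖l‖ + |l.re| := by
  have hM : 0 < normSq m := normSq_pos.2 hm
  have e : 2 * (m.re * (conj m * l).re) = normSq m * l.re + (conj m * conj m * l).re := by
    simp only [normSq_apply, conj_re, conj_im, mul_re, mul_im]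
    ring
  have e1 : (conj m * conj m * l).re ≤ normSq m * ‖l‖ := by
    refine (re_le_norm _).trans (le_of_eq ?_)
    rw [norm_mul, norm_mul, RCLike.norm_conj, normSq_eq_norm_sq, sq]
  have e2 : normSq m * l.re ≤ normSq m * |l.re| :=
    mul_le_mul_of_nonneg_left (le_abs_self _) hM.le
  have : normSq m * 4 ≤ normSq m * (‖l‖ + |l.re|) := by linarith
  exact le_of_mul_le_mul_left this hM

namespace IsTurnTriple

variable {h₁ h₂ h₃ : Equiv.Perm Sphere} {C₁ C₂ C₃ : Circle}

theorem swap (h : IsTurnTriple h₁ h₂ h₃ C₁ C₂ C₃) : IsTurnTriple h₃ h₂ h₁ C₃ C₂ C₁ :=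
  ⟨h.swaps₃, h.swaps₂, h.swaps₁, h.disj₂₃.symm, h.disj₁₃.symm, h.disj₁₂.symm⟩

theorem exchange (h : IsTurnTriple h₁ h₂ h₃ C₁ C₂ C₃) : IsTurnTriple h₂ h₁ h₃ C₂ C₁ C₃ :=
  ⟨h.swaps₂, h.swaps₁, h.swaps₃, h.disj₁₂.symm, h.disj₂₃, h.disj₁₃⟩

theorem exists_conj (h : IsTurnTriple h₁ h₂ h₃ C₁ C₂ C₃) {k : Equiv.Perm Sphere}
    (hk : k ∈ mobius) : ∃ D₁ D₂ D₃,
      IsTurnTriple (k * h₁ * k⁻¹) (k * h₂ * k⁻¹) (k * h₃ * k⁻¹) D₁ D₂ D₃ := by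
  obtain ⟨D₁, i₁⟩ := Circle.exists_isImage hk C₁
  obtain ⟨D₂, i₂⟩ := Circle.exists_isImage hk C₂
  obtain ⟨D₃, i₃⟩ := Circle.exists_isImage hk C₃
  refine ⟨D₁, D₂, D₃, h.swaps₁.conjugate hk i₁, h.swaps₂.conjugate hk i₂,
    h.swaps₃.conjugate hk i₃, ?_, ?_, ?_⟩ <;>
  simp only [i₁.interior_eq, i₂.interior_eq, i₃.interior_eq, Set.disjoint_image_iff k.injective]
  · exact h.disj₁₂
  · exact h.disj₁₃
  · exact h.disj₂₃

/-- The images of the outer circles under the middle involution lie on its other side. -/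
theorem disjoint_image {C D D' : Circle} {h : Equiv.Perm Sphere} {C₂ : Circle}
    (hh : SwapsSides h C₂) (hC : Disjoint C.interior C₂.interior)
    (hD : Disjoint D.interior C₂.interior) (hD' : Circle.IsImage h D D') :
    Disjoint C.interior D'.interior := by
  refine Set.disjoint_left.2 fun p hp hp' => ?_
  have h1 : D.form (h p) < 0 := by
    rw [← hD'.neg_iff, hh.apply_apply]; exact hp'
  have h2 : 0 ≤ C₂.form (h p) := Circle.form_nonneg_of_disjoint hD h1.le
  have h3 : C₂.form p ≤ 0 := by
    have := hh.image.nonpos_iff (h p)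
    rw [hh.apply_apply, Circle.flip_form] at this
    by_contra! h4
    exact absurd (this.1 (by linarith)) (by
      intro h5
      have h6 := (hh.form_apply_eq_zero_iff p).1 (le_antisymm h5 h2)
      linarith)
  exact absurd hp (not_lt.2 (Circle.form_nonneg_of_disjoint hC.symm h3))

/-- The interior of `C₂` contains those of the images of `C₁` and `C₃` under `h₂`, so the four discs
are disjoint. The product `h₁ * h₂` maps the exterior of `h₂ C₁` first to that of `C₁` and then to
its interior. -/
theorem exists_isSchottky (h : IsTurnTriple h₁ h₂ h₃ C₁ C₂ C₃) :
    ∃ D, IsSchottky ![h₁ * h₂, h₃ * h₂] D ∧ D (0, true) = C₁ ∧ D (1, true) = C₃ ∧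
      Circle.IsImage h₂ C₁ (D (0, false)) ∧ Circle.IsImage h₂ C₃ (D (1, false)) := by
  obtain ⟨E₁, i₁⟩ := Circle.exists_isImage h.swaps₂.mem C₁
  obtain ⟨E₃, i₃⟩ := Circle.exists_isImage h.swaps₂.mem C₃
  let D : Fin 2 × Bool → Circle := fun v => if v.2 then ![C₁, C₃] v.1 else ![E₁, E₃] v.1
  refine ⟨D, isSchottky_of_isImage ?_ ?_ ?_, rfl, rfl, i₁, i₃⟩
  · intro i
    fin_cases i
    · exact mobius.mul_mem h.swaps₁.mem h.swaps₂.mem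
    · exact mobius.mul_mem h.swaps₃.mem h.swaps₂.mem
  · have d₁ := disjoint_image h.swaps₂ h.disj₁₂ h.disj₁₂ i₁
    have d₂ := disjoint_image h.swaps₂ h.disj₁₂ h.disj₂₃.symm i₃
    have d₃ := disjoint_image h.swaps₂ h.disj₂₃.symm h.disj₁₂ i₁
    have d₄ := disjoint_image h.swaps₂ h.disj₂₃.symm h.disj₂₃.symm i₃
    have d₅ : Disjoint E₁.interior E₃.interior := by
      rw [i₁.interior_eq, i₃.interior_eq, Set.disjoint_image_iff h₂.injective]
      exact h.disj₁₃
    rintro ⟨i, b⟩ ⟨j, c⟩ hne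
    fin_cases i <;> fin_cases j <;> cases b <;> cases c
    · exact absurd rfl hne
    · exact d₁.symm
    · exact d₁
    · exact absurd rfl hne
    · exact d₅
    · exact d₃.symm
    · exact d₂
    · exact h.disj₁₃
    · exact d₅.symm
    · exact d₂.symm
    · exact d₃
    · exact h.disj₁₃.symm
    · exact absurd rfl hne
    · exact d₄.symm
    · exact d₄
    · exact absurd rfl hne
  · have e₁ := i₁.flip.inv
    have e₃ := i₃.flip.inv
    rw [h.swaps₂.inv_eq] at e₁ e₃
    have s₁ := h.swaps₁.image.flip
    have s₃ := h.swaps₃.image.flip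
    rw [Circle.flip_flip] at s₁ s₃
    intro i
    fin_cases i
    · exact e₁.trans s₁
    · exact e₃.trans s₃

/-- The fixed point of a parabolic product of two of the involutions is the point of tangency of
their circles, and is fixed by both. -/
theorem fixed_of_isParabolicAt (h : IsTurnTriple h₁ h₂ h₃ C₁ C₂ C₃) {p : Sphere}
    (hp : IsParabolicAt (h₁ * h₂) p) :
    C₁.form p = 0 ∧ C₂.form p = 0 ∧ h₁ p = p ∧ h₂ p = p := by
  obtain ⟨D, hD, hD₁, hD₃, i₁, i₃⟩ := h.exists_isSchottky
  have t := (hD.form_eq_zero (l := [(0, true)]) FreeGroup.IsCyclicallyReduced.singleton (by simp)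
    (by rw [lift_mk_true]; exact hp)).2
  simp only [List.head_cons, List.getLast_singleton] at t
  have t1 : C₁.form p = 0 := hD₁ ▸ t.1
  have t2 : C₁.form (h₂ p) = 0 := by
    rw [← i₁.zero_iff, h.swaps₂.apply_apply]
    exact t.2
  have f1 : 0 ≤ C₂.form p := Circle.form_nonneg_of_disjoint h.disj₁₂ t1.le
  have f2 : 0 ≤ C₂.form (h₂ p) := Circle.form_nonneg_of_disjoint h.disj₁₂ t2.le
  have f3 : C₂.form p = 0 := by
    refine le_antisymm ?_ f1
    by_contra! hpos
    have := h.swaps₂.image.nonpos_iff p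
    rw [Circle.flip_form] at this
    linarith [this.1 (by linarith)]
  have f4 := (h.swaps₂.form_apply_eq_zero_iff p).2 f3
  have f5 : h₂ p = p :=
    Circle.eq_of_common_of_disjoint h.disj₁₂ h.disj₁₃ h.disj₂₃ t2 f4 t1 f3
  refine ⟨t1, f3, ?_, f5⟩
  have := hp.apply_self
  rwa [Equiv.Perm.mul_apply, f5] at this

/-- The fixed point `q` would lie on `C₁` and on `h₂ C₃`. As both `q` and `h₂ q` lie outside or on
`C₂`, they lie on it, so `q` is the point where `C₁` and `C₂` touch. This point is fixed by `h₂`,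
and would lie on all three circles. -/
theorem not_isParabolicAt_mul (h : IsTurnTriple h₁ h₂ h₃ C₁ C₂ C₃) {p q : Sphere}
    (hp : IsParabolicAt (h₁ * h₂) p) : ¬ IsParabolicAt (h₁ * h₂ * (h₃ * h₂)) q := by
  intro hq
  obtain ⟨p1, p2, -, p3⟩ := h.fixed_of_isParabolicAt hp
  obtain ⟨D, hD, hD₁, hD₃, i₁, i₃⟩ := h.exists_isSchottky
  have hcyc : FreeGroup.IsCyclicallyReduced [((0 : Fin 2), true), (1, true)] := by
    constructor
    · simp [FreeGroup.IsReduced]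
    · simp
  have t := (hD.form_eq_zero hcyc (by simp) (p := q) (by
    rw [mk_cons (0, true) [(1, true)], map_mul, lift_mk_true, lift_mk_true]; exact hq)).2
  simp only [List.head_cons] at t
  have t1 : C₁.form q = 0 := hD₁ ▸ t.1
  have t2 : C₃.form (h₂ q) = 0 := by
    rw [← i₃.zero_iff, h.swaps₂.apply_apply]
    exact t.2
  have f1 : 0 ≤ C₂.form q := Circle.form_nonneg_of_disjoint h.disj₁₂ t1.le
  have f2 : 0 ≤ C₂.form (h₂ q) := Circle.form_nonneg_of_disjoint h.disj₂₃.symm t2.le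
  have f3 : C₂.form q = 0 := by
    refine le_antisymm ?_ f1
    by_contra! hpos
    have := h.swaps₂.image.nonpos_iff q
    rw [Circle.flip_form] at this
    linarith [this.1 (by linarith)]
  have hqp : q = p :=
    Circle.eq_of_common_of_disjoint h.disj₁₂ h.disj₁₃ h.disj₂₃ t1 f3 p1 p2
  rw [hqp, p3] at t2
  exact Circle.not_common_of_disjoint h.disj₁₂ h.disj₁₃ h.disj₂₃ p1 p2 t2

/-- The parabolic fixed points `0` and `∞` are fixed by `h₂`, which is therefore `z ↦ -z`; this
determines `h₁` and `h₃`. Thus `C₁` passes through `0` and `2` and touches the line `C₂` at `0`, and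
`C₃` is the parallel line through `l`. The bound says that the disc of `C₁` fits between the lines.
-/
theorem four_le_of_eq (h : IsTurnTriple h₁ h₂ h₃ C₁ C₂ C₃) {l : ℂ} (hl : l ≠ 0)
    (hS : h₁ * h₂ = S) (hT : h₃ * h₂ = T l) : 4 ≤ ‖l‖ + |l.re| := by
  obtain ⟨a1, a2, a3, a4⟩ :=
    h.fixed_of_isParabolicAt (p := ((0 : ℂ) : Sphere)) (hS ▸ isParabolicAt_S)
  obtain ⟨b1, b2, b3, b4⟩ := h.swap.fixed_of_isParabolicAt (p := ∞) (hT ▸ isParabolicAt_T hl)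
  have hn : h₂ = negation := eq_negation h.swaps₂.mem a4 b4 h.swaps₂.ne_one h.swaps₂.mul_self
  have e1 : h₁ = S * negation := by
    rw [← hS, ← hn, mul_assoc, h.swaps₂.mul_self, mul_one]
  have e3 : h₃ = T l * negation := by
    rw [← hT, ← hn, mul_assoc, h.swaps₂.mul_self, mul_one]
  have c1 : C₁.form ((2 : ℂ) : Sphere) = 0 :=
    h.swaps₁.form_eq_zero (by rw [e1]; exact isHalfTurn_S_mul_negation.2.2.2.1)
  have c3 : C₃.form (l : Sphere) = 0 :=
    h.swaps₃.form_eq_zero (by rw [e3]; exact (isHalfTurn_T_mul_negation l).2.2.2.1)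
  have a1 : C₁.c = 0 := by simpa using a1
  have a2 : C₂.c = 0 := by simpa using a2
  rw [Circle.form_infty] at b1 b2
  have hre : C₁.a = -C₁.b.re := by
    simp [a1] at c1
    linarith
  have p1 : 0 < C₁.a := Circle.a_pos_of_disjoint b2 b1 h.disj₁₂ h.disj₁₃ h.disj₂₃
  obtain ⟨μ, hμ, hb3⟩ := Circle.exists_b_eq_neg_mul b2 b1 h.disj₂₃
  have n2 := Circle.halfplane_le p1 a1 b1 h.disj₁₃
  have n1 := Circle.halfplane_le p1 a1 b2 h.disj₁₂
  have hb : C₁.b ≠ 0 := Circle.b_ne_zero_of_mem a1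
  have hm : C₂.b ≠ 0 := Circle.b_ne_zero_of_a b2
  rw [a2] at n1
  have hr : ‖C₂.b‖ * ‖C₁.b‖ + (conj C₂.b * C₁.b).re ≤ 0 := by
    by_contra! hpos
    exact absurd n1 (not_le.2 (div_pos (by linarith) p1))
  have hb2 := eq_neg_mul_of_norm_mul_add_re_le hb hr
  obtain ⟨κ, hκ, hb2⟩ : ∃ κ : ℝ, 0 < κ ∧ C₂.b = -(κ * C₁.b) :=
    ⟨_, div_pos (norm_pos_iff.2 hm) (norm_pos_iff.2 hb), hb2⟩
  have hν := mul_pos hμ hκ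
  have hb3' : C₃.b = ((μ * κ : ℝ) : ℂ) * C₁.b := by
    rw [hb3, hb2]; push_cast; ring
  have k1 : ‖C₃.b‖ * ‖C₁.b‖ + (conj C₃.b * C₁.b).re = 2 * (μ * κ * normSq C₁.b) := by
    rw [hb3', norm_mul, norm_real, Real.norm_of_nonneg hν.le, map_mul, conj_ofReal,
      mul_assoc (μ * κ), mul_assoc ((μ * κ : ℝ) : ℂ), ← normSq_eq_conj_mul_self, re_ofReal_mul, ofReal_re, normSq_eq_norm_sq]
    ring
  have k2 : C₃.c = -(2 * (μ * κ * (conj C₁.b * l).re)) := by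
    rw [Circle.form_coe, b1, hb3', map_mul, conj_ofReal, mul_assoc, re_ofReal_mul] at c3
    linear_combination c3
  rw [k1, k2, div_le_iff₀ p1, hre] at n2
  refine four_le_of_mul_le hb ?_
  have : (2 * (μ * κ)) * (2 * normSq C₁.b) ≤ (2 * (μ * κ)) * (C₁.b.re * (conj C₁.b * l).re) := by
    linarith
  exact le_of_mul_le_mul_left this (by positivity)

/-- The two parabolic generators `S` and `T l`, in either order. -/
def IsGeneratingPair (l : ℂ) (P Q : Equiv.Perm Sphere) : Prop :=
  (P = S ∧ Q = T l) ∨ (P = T l ∧ Q = S)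

theorem IsGeneratingPair.isParabolicAt {l : ℂ} (hl : l ≠ 0) {P Q : Equiv.Perm Sphere}
    (h : IsGeneratingPair l P Q) :
    (∃ p, IsParabolicAt P p) ∧ ∃ q, IsParabolicAt Q q := by
  rcases h with ⟨rfl, rfl⟩ | ⟨rfl, rfl⟩
  · exact ⟨⟨_, isParabolicAt_S⟩, _, isParabolicAt_T hl⟩
  · exact ⟨⟨_, isParabolicAt_T hl⟩, _, isParabolicAt_S⟩

theorem mul_inv (h : IsTurnTriple h₁ h₂ h₃ C₁ C₂ C₃) : (h₁ * h₂)⁻¹ = h₂ * h₁ := by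
  rw [mul_inv_rev, h.swaps₁.inv_eq, h.swaps₂.inv_eq]

theorem four_le_of_direct (h : IsTurnTriple h₁ h₂ h₃ C₁ C₂ C₃) {l : ℂ} (hl : l ≠ 0)
    {P Q : Equiv.Perm Sphere} (hP : P = h₁ * h₂ ∨ P = (h₁ * h₂)⁻¹)
    (hQ : Q = h₃ * h₂ ∨ Q = (h₃ * h₂)⁻¹) (hPQ : IsGeneratingPair l P Q) : 4 ≤ ‖l‖ + |l.re| := by
  have key : ∀ {h₁ h₂ h₃ : Equiv.Perm Sphere} {C₁ C₂ C₃ : Circle},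
      IsTurnTriple h₁ h₂ h₃ C₁ C₂ C₃ → S = h₁ * h₂ →
      (T l = h₃ * h₂ ∨ T l = (h₃ * h₂)⁻¹) → 4 ≤ ‖l‖ + |l.re| := by
    intro h₁ h₂ h₃ C₁ C₂ C₃ h hS hT
    rcases hT with hT | hT
    · exact h.four_le_of_eq hl hS.symm hT.symm
    · have := h.four_le_of_eq (l := -l) (neg_ne_zero.2 hl) hS.symm (by rw [← T_inv, hT, inv_inv])
      simpa using this
  have key' : ∀ {h₁ h₂ h₃ : Equiv.Perm Sphere} {C₁ C₂ C₃ : Circle},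
      IsTurnTriple h₁ h₂ h₃ C₁ C₂ C₃ → (S = h₁ * h₂ ∨ S = (h₁ * h₂)⁻¹) →
      (T l = h₃ * h₂ ∨ T l = (h₃ * h₂)⁻¹) → 4 ≤ ‖l‖ + |l.re| := by
    intro h₁ h₂ h₃ C₁ C₂ C₃ h hS hT
    rcases hS with hS | hS
    · exact key h hS hT
    -- Conjugation by `h₂` inverts both products at once, so only their relative orientation
    -- matters.
    · obtain ⟨D₁, D₂, D₃, h'⟩ := h.exists_conj h.swaps₂.mem
      have e : ∀ g, h₂ * g * h₂⁻¹ * (h₂ * h₂ * h₂⁻¹) = h₂ * g := by intro g; group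
      refine key h' (by rw [hS, h.mul_inv, e]) ?_
      rw [e, ← h.swap.mul_inv, inv_inv]
      exact hT.symm
  rcases hPQ with ⟨rfl, rfl⟩ | ⟨rfl, rfl⟩
  · exact key' h hP hQ
  · exact key' h.swap hQ hP

/-- With `(h₃ h₂)⁻¹ = h₂ h₃` the product is `h₁ h₃`, and `h₁` becomes the middle involution. With
`(h₁ h₂)⁻¹` and `h₃ h₂` the same happens after conjugation by `h₂`. In the two remaining cases the
product, up to conjugation, is excluded by `not_isParabolicAt_mul`. -/
theorem four_le_of_product (h : IsTurnTriple h₁ h₂ h₃ C₁ C₂ C₃) {l : ℂ} (hl : l ≠ 0)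
    {P P' b : Equiv.Perm Sphere} (hP : P = h₁ * h₂ ∨ P = (h₁ * h₂)⁻¹)
    (hP' : P' = h₁ * h₂ ∨ P' = (h₁ * h₂)⁻¹)
    (hb : b = h₃ * h₂ ∨ b = (h₃ * h₂)⁻¹) (hPQ : IsGeneratingPair l P (P' * b)) :
    4 ≤ ‖l‖ + |l.re| := by
  obtain ⟨⟨p, hp⟩, q, hq⟩ := hPQ.isParabolicAt hl
  have hp' : IsParabolicAt (h₁ * h₂) p := by
    rcases hP with rfl | rfl
    · exact hp
    · simpa using hp.inv
  have s₁ := h.swaps₁.inv_eq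
  have s₂ := h.swaps₂.inv_eq
  have s₃ := h.swaps₃.inv_eq
  have inv₂₁ : (h₂ * h₁)⁻¹ = h₁ * h₂ := h.exchange.mul_inv
  have hP₂ : P = h₂ * h₁ ∨ P = (h₂ * h₁)⁻¹ := by
    rw [inv₂₁, ← h.mul_inv]; exact hP.symm
  rcases hP' with rfl | rfl <;> rcases hb with rfl | rfl
  · exact absurd hq (h.not_isParabolicAt_mul hp')
  · refine h.exchange.four_le_of_direct hl hP₂ (Or.inr ?_) hPQ
    rw [mul_inv_rev, mul_inv_rev, s₁, s₂, s₃, mul_assoc, ← mul_assoc h₂ h₂, h.swaps₂.mul_self,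
      one_mul]
  · obtain ⟨D₁, D₂, D₃, h'⟩ := h.exists_conj h.swaps₂.mem
    refine h'.exchange.four_le_of_direct hl ?_ (Or.inr ?_) hPQ
    · have e : h₂ * h₂ * h₂⁻¹ * (h₂ * h₁ * h₂⁻¹) = h₁ * h₂ := by
        rw [s₂]
        rw [mul_assoc h₂ h₂, h.swaps₂.mul_self, mul_one, mul_assoc h₂, ← mul_assoc h₂ h₂,
          h.swaps₂.mul_self, one_mul]
      rw [e]
      exact hP
    · rw [h.mul_inv, mul_inv_rev]
      simp only [mul_inv_rev, inv_inv, s₁, s₃, mul_assoc, inv_mul_cancel_left]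
      rw [s₂]
  · have := hq.conjugate h.swaps₂.mem
    refine absurd this ?_
    have e : h₂ * ((h₁ * h₂)⁻¹ * (h₃ * h₂)⁻¹) * h₂⁻¹ = h₁ * h₂ * (h₃ * h₂) := by
      rw [mul_inv_rev, mul_inv_rev, s₁, s₂, s₃]
      simp only [mul_assoc]
      rw [← mul_assoc h₂ h₂, h.swaps₂.mul_self, one_mul]
    rw [e]
    exact h.not_isParabolicAt_mul hp'

theorem four_le_of_pair (h : IsTurnTriple h₁ h₂ h₃ C₁ C₂ C₃) {l : ℂ} (hl : l ≠ 0)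
    {P b : Equiv.Perm Sphere} (hP : P = h₁ * h₂ ∨ P = (h₁ * h₂)⁻¹)
    (hb : b = h₃ * h₂ ∨ b = (h₃ * h₂)⁻¹) {e : ℤ} (he : e = 0 ∨ e = 1 ∨ e = -1)
    (hPQ : IsGeneratingPair l P (P ^ e * b)) : 4 ≤ ‖l‖ + |l.re| := by
  rcases he with rfl | rfl | rfl
  · rw [zpow_zero, one_mul] at hPQ
    exact h.four_le_of_direct hl hP hb hPQ
  · rw [zpow_one] at hPQ
    exact h.four_le_of_product hl hP hP hb hPQ
  · rw [zpow_neg_one] at hPQ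
    refine h.four_le_of_product hl hP ?_ hb hPQ
    rcases hP with rfl | rfl
    · exact Or.inr rfl
    · exact Or.inl (inv_inv _)

theorem four_le (h : IsTurnTriple h₁ h₂ h₃ C₁ C₂ C₃) {l : ℂ} (hl : l ≠ 0)
    (hG : Subgroup.closure {h₁ * h₂, h₃ * h₂} = Subgroup.closure {S, T l}) :
    4 ≤ ‖l‖ + |l.re| := by
  obtain ⟨D, hD, -⟩ := h.exists_isSchottky
  obtain ⟨s, t, hs, ht, hst⟩ := IsSchottky.exists_generators hD.injective
    ((congrArg Subgroup.closure (Matrix.range_cons_cons_empty _ _ _)).trans hG)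
  obtain ⟨c, u, v, huv, e, he, hc⟩ := hD.exists_normal_form hst
    (by rw [hs]; exact isParabolicAt_S) (by rw [ht]; exact isParabolicAt_T hl)
  set g : Fin 2 → Equiv.Perm Sphere := ![h₁ * h₂, h₃ * h₂] with hg
  set k := FreeGroup.lift g c with hk
  have hconj : ∀ w, FreeGroup.lift g (c * w * c⁻¹) = k * FreeGroup.lift g w * k⁻¹ := fun w => by
    rw [_root_.map_mul, _root_.map_mul, _root_.map_inv]
  obtain ⟨D₁, D₂, D₃, h'⟩ := h.exists_conj (hD.lift_mem c)
  set P := k * FreeGroup.lift g (FreeGroup.mk [u]) * k⁻¹ with hP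
  set b := k * FreeGroup.lift g (FreeGroup.mk [v]) * k⁻¹ with hb
  have hQ : P ^ e * b = k * FreeGroup.lift g (FreeGroup.mk [u] ^ e * FreeGroup.mk [v]) * k⁻¹ := by
    rw [hP, hb, conj_zpow, _root_.map_mul, _root_.map_zpow]
    group
  have hPQ : IsGeneratingPair l P (P ^ e * b) := by
    rw [hQ, hP, ← hconj, ← hconj]
    rcases hc with ⟨h1, h2⟩ | ⟨h1, h2⟩
    · exact Or.inl ⟨by rw [← h1, hs], by rw [← h2, ht]⟩
    · exact Or.inr ⟨by rw [← h1, ht], by rw [← h2, hs]⟩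
  have hletter : ∀ (w : Fin 2 × Bool) (x : Equiv.Perm Sphere), g w.1 = x * h₂ →
      k * FreeGroup.lift g (FreeGroup.mk [w]) * k⁻¹ = (k * x * k⁻¹) * (k * h₂ * k⁻¹) ∨
      k * FreeGroup.lift g (FreeGroup.mk [w]) * k⁻¹
        = ((k * x * k⁻¹) * (k * h₂ * k⁻¹))⁻¹ := by
    rintro ⟨i, β⟩ x hx
    cases β
    · right
      rw [lift_mk_false, hx]; group
    · left
      rw [lift_mk_true, hx]; group
  rcases Fin.exists_fin_two.1 ⟨u.1, rfl⟩ with hu | hu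
  · have hv : v.1 = 1 := by omega
    exact h'.four_le_of_pair hl (hletter u h₁ (by rw [hu]; rfl))
      (hletter v h₃ (by rw [hv]; rfl)) he hPQ
  · have hv : v.1 = 0 := by omega
    exact h'.swap.four_le_of_pair hl (hletter u h₃ (by rw [hu]; rfl))
      (hletter v h₁ (by rw [hv]; rfl)) he hPQ

end IsTurnTriple

theorem four_le_of_isNSDC {lam : ℂ} (hl : lam ≠ 0) (h : IsNSDC (G lam)) :
    4 ≤ ‖lam‖ + |lam.re| := by
  obtain ⟨A, B, hAB, hm⟩ := h
  obtain ⟨h₁, h₂, h₃, C₁, C₂, C₃, ht, rfl, rfl⟩ := hm.exists_isTurnTriple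
  exact ht.four_le hl hAB

end TwoParabolic

end

/-! ### The two spaces and their boundaries -/

noncomputable section

namespace TwoParabolic

open Topology Filter

theorem nsdcSpace_eq : nsdcSpace = {lam | 4 ≤ ‖lam‖ + |lam.re|} := by
  ext lam
  refine ⟨fun h => four_le_of_isNSDC h.1 h.2, fun h => ⟨?_, isNSDC_of_le h⟩⟩
  rintro rfl
  norm_num at h

theorem classicalTSchottkySpace_eq : classicalTSchottkySpace = {lam | 2 ≤ ‖lam‖ + |lam.im|} := by
  ext lam
  refine ⟨fun h => two_le_of_isClassicalTSchottky h.1 h.2,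
    fun h => ⟨?_, isClassicalTSchottky_of_le h⟩⟩
  rintro rfl
  norm_num at h

/-- The boundary of a superlevel set of a homogeneous function. -/
theorem frontier_le_of_homogeneous {f : ℂ → ℝ} (hf : Continuous f)
    (hom : ∀ (t : ℝ) (z : ℂ), 0 ≤ t → f (t * z) = t * f z) {c : ℝ} (hc : 0 < c) :
    frontier {z | c ≤ f z} = {z | f z = c} := by
  have hclosed : IsClosed {z | c ≤ f z} := isClosed_le continuous_const hf
  rw [frontier, hclosed.closure_eq]
  have hint : interior {z | c ≤ f z} = {z | c < f z} := by
    refine subset_antisymm ?_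
      (interior_maximal (fun z (hz : c < f z) => hz.le) (isOpen_lt continuous_const hf))
    intro z hz
    have hz' : z ∈ {z | c ≤ f z} := interior_subset hz
    rw [Set.mem_ofPred_eq] at hz'
    refine lt_of_le_of_ne hz' fun h => ?_
    -- On the ray through `z` the function drops below `c` just before `z` when `f z = c`, so such a
    -- point is not interior.
    have hcont : Continuous fun t : ℝ => (t : ℂ) * z := by fun_prop
    have hmem : (fun t : ℝ => (t : ℂ) * z) ⁻¹' interior {z | c ≤ f z} ∈ 𝓝 (1 : ℝ) :=
      (isOpen_interior.preimage hcont).mem_nhds (by simpa using hz)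
    have h1 : ∀ᶠ t : ℝ in 𝓝[<] 1, (t : ℂ) * z ∈ interior {z | c ≤ f z} :=
      nhdsWithin_le_nhds hmem
    have h2 : ∀ᶠ t : ℝ in 𝓝[<] 1, 0 < t :=
      nhdsWithin_le_nhds (lt_mem_nhds zero_lt_one)
    obtain ⟨t, ht1, ht2, ht3⟩ := (h1.and (h2.and self_mem_nhdsWithin)).exists
    have ht1 : t * z ∈ {z | c ≤ f z} := interior_subset ht1
    have ht3 : t < 1 := ht3
    rw [Set.mem_ofPred_eq, hom t z ht2.le, ← h] at ht1
    nlinarith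
  rw [hint]
  ext z
  simp only [Set.mem_sdiff, Set.mem_ofPred_eq, not_lt]
  exact ⟨fun h => le_antisymm h.2 h.1, fun h => ⟨h.ge, h.le⟩⟩

theorem frontier_nsdcSpace : frontier nsdcSpace = {lam | ‖lam‖ + |lam.re| = 4} := by
  rw [nsdcSpace_eq]
  refine frontier_le_of_homogeneous (by fun_prop) (fun t z ht => ?_) (by norm_num)
  rw [norm_mul, norm_real, Real.norm_of_nonneg ht, re_ofReal_mul, abs_mul, abs_of_nonneg ht]
  ring

theorem frontier_classicalTSchottkySpace :
    frontier classicalTSchottkySpace = {lam | ‖lam‖ + |lam.im| = 2} := by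
  rw [classicalTSchottkySpace_eq]
  refine frontier_le_of_homogeneous (by fun_prop) (fun t z ht => ?_) (by norm_num)
  rw [norm_mul, norm_real, Real.norm_of_nonneg ht, im_ofReal_mul, abs_mul, abs_of_nonneg ht]
  ring

theorem norm_polar {r : ℝ} (hr : 0 ≤ r) (ω : ℝ) : ‖(r : ℂ) * exp (ω * I)‖ = r := by
  rw [norm_mul, norm_exp_ofReal_mul_I, mul_one, norm_real, Real.norm_of_nonneg hr]

theorem norm_add_abs_re_polar {r : ℝ} (hr : 0 ≤ r) (ω : ℝ) :
    ‖(r : ℂ) * exp (ω * I)‖ + |((r : ℂ) * exp (ω * I)).re| = r * (1 + |Real.cos ω|) := by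
  rw [norm_polar hr, re_ofReal_mul, exp_ofReal_mul_I_re, abs_mul, abs_of_nonneg hr]
  ring

theorem norm_add_abs_im_polar {r : ℝ} (hr : 0 ≤ r) (ω : ℝ) :
    ‖(r : ℂ) * exp (ω * I)‖ + |((r : ℂ) * exp (ω * I)).im| = r * (1 + |Real.sin ω|) := by
  rw [norm_polar hr, im_ofReal_mul, exp_ofReal_mul_I_im, abs_mul, abs_of_nonneg hr]
  ring

/-- The parabola with focus `0`, in focal form and in Cartesian form. -/
theorem sqrt_add_eq_iff {x y c : ℝ} (hc : 0 < c) :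
    √(x ^ 2 + y ^ 2) + |x| = c ↔ y ^ 2 = c ^ 2 - 2 * c * |x| := by
  have h1 : 0 ≤ x ^ 2 + y ^ 2 := by positivity
  have h2 := sq_abs x
  constructor
  · intro h
    have h3 : √(x ^ 2 + y ^ 2) = c - |x| := by linarith
    have h4 := Real.sq_sqrt h1
    rw [h3] at h4
    linear_combination -h4 + h2
  · intro h
    have h3 : |x| ≤ c := by nlinarith [sq_nonneg y, abs_nonneg x]
    have h4 : x ^ 2 + y ^ 2 = (c - |x|) ^ 2 := by rw [h]; linear_combination -h2
    rw [h4, Real.sqrt_sq (by linarith)]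
    ring

theorem norm_eq_sqrt_re_im (z : ℂ) : ‖z‖ = √(z.re ^ 2 + z.im ^ 2) := by
  rw [norm_def, normSq_apply, sq, sq]

end TwoParabolic

end

theorem theorem4p2 :
    (∀ r ω : ℝ, 0 < r →
      ((r : ℂ) * Complex.exp (ω * Complex.I) ∈ TwoParabolic.nsdcSpace ↔
        4 ≤ r * (1 + |Real.cos ω|))) ∧
    (∀ r ω : ℝ, 0 < r →
      ((r : ℂ) * Complex.exp (ω * Complex.I) ∈ frontier TwoParabolic.nsdcSpace ↔
        r * (1 + |Real.cos ω|) = 4)) ∧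
    frontier TwoParabolic.nsdcSpace = {lam : ℂ | lam.im ^ 2 = 16 - 8 * |lam.re|} ∧
    frontier TwoParabolic.classicalTSchottkySpace =
      {lam : ℂ | |lam.im| = 1 - lam.re ^ 2 / 4} ∧
    frontier TwoParabolic.classicalTSchottkySpace =
      {lam : ℂ | ∃ ω : ℝ,
        lam = 2 * Complex.exp (ω * Complex.I) / ((1 + |Real.sin ω| : ℝ) : ℂ)} := by
  rw [TwoParabolic.frontier_nsdcSpace, TwoParabolic.nsdcSpace_eq,
    TwoParabolic.frontier_classicalTSchottkySpace]
  refine ⟨fun r ω hr => ?_, fun r ω hr => ?_, ?_, ?_, ?_⟩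
  · rw [Set.mem_ofPred_eq, TwoParabolic.norm_add_abs_re_polar hr.le]
  · rw [Set.mem_ofPred_eq, TwoParabolic.norm_add_abs_re_polar hr.le]
  · ext z
    rw [Set.mem_ofPred_eq, Set.mem_ofPred_eq, TwoParabolic.norm_eq_sqrt_re_im,
      TwoParabolic.sqrt_add_eq_iff (by norm_num)]
    norm_num
  · ext z
    rw [Set.mem_ofPred_eq, Set.mem_ofPred_eq, TwoParabolic.norm_eq_sqrt_re_im, add_comm (_ ^ 2),
      TwoParabolic.sqrt_add_eq_iff (by norm_num)]
    constructor <;> intro h <;> linarith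
  · ext z
    rw [Set.mem_ofPred_eq, Set.mem_ofPred_eq]
    have hpos : ∀ ω : ℝ, 0 < 1 + |Real.sin ω| := fun ω => by positivity
    have heq : ∀ ω : ℝ, 2 * Complex.exp (ω * Complex.I) / ((1 + |Real.sin ω| : ℝ) : ℂ)
        = ((2 / (1 + |Real.sin ω|) : ℝ) : ℂ) * Complex.exp (ω * Complex.I) := fun ω => by
      push_cast; ring
    constructor
    · intro h
      refine ⟨Complex.arg z, ?_⟩
      have h1 := TwoParabolic.norm_add_abs_im_polar (norm_nonneg z) (Complex.arg z)
      rw [Complex.norm_mul_exp_arg_mul_I, h] at h1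
      rw [heq, h1, mul_div_cancel_right₀ _ (hpos _).ne', Complex.norm_mul_exp_arg_mul_I]
    · rintro ⟨ω, rfl⟩
      rw [heq, TwoParabolic.norm_add_abs_im_polar (div_nonneg zero_le_two (hpos ω).le),
        div_mul_cancel₀ _ (hpos ω).ne']
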